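/- Let $N\ge 4$ be even and let $a,b\in\mathbb R$ with $a>2|b|$. On $L^2(\mathbb R^N)$, with position and momentum operators $x_j$ (multiplication by the $j$-th coordinate) and $p_j=-\mathrm i\,\partial_j$, consider the Hamiltonian of the periodic harmonic chain on $L=\{1,\dots,N\}$ with $P=\mathbb 1$ and nearest-neighbour coupling, $$H=\frac12\sum_{i,j\in L}\bigl(p_iP_{i,j}p_j+x_iX_{i,j}x_j\bigr),\qquad P=\mathbb 1,\quad X=\mathrm{circ}(a,b,0,\dots,0,b)$$ (the self-adjoint closure of the operator given by this expression on Schwartz functions). Then $H$ has a ground state, that is, a unit eigenvector $\psi$ for its lowest energy. For every ground state $\psi$, put $\rho=|\psi\rangle\langle\psi|$, let $I=\{1,\dots,N/2\}$ be the half-chain, $O=L\setminus I$, $\rho_I=\mathrm{tr}_O[\rho]$ the reduced state, $S(\rho_I)=-\mathrm{tr}[\rho_I\log_2\rho_I]$ its von Neumann entropy, and $E_N(\rho,I)=\log_2\|\rho^{\Gamma_I}\|_1$ the logarithmic negativity, where $\rho^{\Gamma_I}$ is the partial transpose of $\rho$ with respect to $I$ and $\|A\|_1=\mathrm{tr}[(A^\dagger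 A)^{1/2}]$ is the trace norm. Then $$S(\rho_I)\ \le\ E_N(\rho,I)\ =\ \frac14\log_2\!\left(\frac{a+2|b|}{a-2|b|}\right)\ =\ \frac12\log_2\!\left(\frac{\|X\|^{1/2}}{\Delta E}\right),$$ where $\|\cdot\|$ is the operator norm, $\Delta E=\lambda_{\min}(X)^{1/2}$, and $\lambda_{\min}(X)$ is the smallest eigenvalue of $X$. In particular, the value of $E_N(\rho,I)$ does not depend on $N$. -/

import Mathlib

open MeasureTheory
open scoped SchwartzMap LineDeriv ENNReal InnerProductSpace

noncomputable section

namespace HarmonicChain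

set_option linter.unusedSectionVars false

/-! ## Trace, trace norm and entropy on a complex Hilbert space -/

section Operators

variable (E : Type*) [NormedAddCommGroup E] [InnerProductSpace ℂ E] [CompleteSpace E]

/-- The index set of an orthonormal (Hilbert) basis of `E`, chosen once and for all. -/
def basisIndex : Set E := (exists_hilbertBasis ℂ E).choose

/-- An orthonormal (Hilbert) basis of `E`, chosen once and for all. -/
def stdBasis : HilbertBasis (basisIndex E) ℂ E := (exists_hilbertBasis ℂ E).choose_spec.choose

variable {E}

/-- The trace `∑ₖ ⟨eₖ, A eₖ⟩ ∈ [0, ∞]` of a positive bounded operator `A`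
(it does not depend on the orthonormal basis). -/
def posTrace (A : E →L[ℂ] E) : ℝ≥0∞ :=
  ∑' k, ENNReal.ofReal (RCLike.re ⟪stdBasis E k, A (stdBasis E k)⟫_ℂ)

/-- The trace norm `‖A‖₁ = tr[(A† A)^{1/2}] ∈ [0, ∞]`. -/
def traceNorm (A : E →L[ℂ] E) : ℝ≥0∞ := posTrace (CFC.sqrt (star A * A))

/-- The von Neumann entropy `S(ρ) = -tr[ρ log₂ ρ] ∈ [0, ∞]` of a density operator `ρ`:
the trace of the positive operator `η(ρ)`, where `η(t) = -t log₂ t` and `η(0) = 0`. -/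
def vonNeumannEntropy (ρ : E →L[ℂ] E) : ℝ≥0∞ :=
  posTrace (cfc (fun t : ℝ => -(t * Real.logb 2 t)) ρ)

/-- The pure state `|ψ⟩⟨ψ|`. -/
def pureState (ψ : E) : E →L[ℂ] E := InnerProductSpace.rankOne ℂ ψ ψ

end Operators

/-- `log₂ : [0, ∞] → [-∞, ∞]`. -/
def log2 (t : ℝ≥0∞) : EReal := ENNReal.log t / (Real.log 2 : ℝ)

/-! ## The Hilbert space of a bosonic lattice and its factorisation -/

/-- The Hilbert space `L²(ℝ^ι)` (complex valued, Lebesgue measure) of one bosonic mode per site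
of the finite set `ι`. -/
abbrev Space (ι : Type) [Fintype ι] : Type := Lp ℂ 2 (volume : Measure (ι → ℝ))

section Tensor

variable {L : Type} [Fintype L] [DecidableEq L] (I : Finset L)

/-- The Hilbert space of the sites in `I`. -/
abbrev SpaceIn : Type := Space {i : L // i ∈ I}

/-- The Hilbert space of the sites outside `I`. -/
abbrev SpaceOut : Type := Space {i : L // i ∉ I}

/-- The function `x ↦ f(x_I) g(x_O)` on `ℝ^L`, for functions `f` on `ℝ^I` and `g` on `ℝ^O`,
where `O` is the complement of `I`. -/
def tensorFun (f : ({i : L // i ∈ I} → ℝ) → ℂ) (g : ({i : L // i ∉ I} → ℝ) → ℂ) : (L → ℝ) → ℂ :=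
  fun x => f (fun i => x i) * g (fun i => x i)

lemma tensorFun_eq_comp (f : ({i : L // i ∈ I} → ℝ) → ℂ) (g : ({i : L // i ∉ I} → ℝ) → ℂ) :
    tensorFun I f g = (fun z : ({i : L // i ∈ I} → ℝ) × ({i : L // i ∉ I} → ℝ) => f z.1 * g z.2) ∘
      MeasurableEquiv.piEquivPiSubtypeProd (fun _ : L => ℝ) (· ∈ I) := rfl

lemma measurePreserving_split :
    MeasurePreserving (MeasurableEquiv.piEquivPiSubtypeProd (fun _ : L => ℝ) (· ∈ I))
      volume ((volume : Measure ({i : L // i ∈ I} → ℝ)).prod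
        (volume : Measure ({i : L // i ∉ I} → ℝ))) := by
  have h := volume_preserving_piEquivPiSubtypeProd (fun _ : L => ℝ) (· ∈ I)
  rw [Measure.volume_eq_prod] at h
  convert h
  rfl

lemma aestronglyMeasurable_mul_prod (f : SpaceIn I) (g : SpaceOut I) :
    AEStronglyMeasurable
      (fun z : ({i : L // i ∈ I} → ℝ) × ({i : L // i ∉ I} → ℝ) => f z.1 * g z.2)
      ((volume : Measure ({i : L // i ∈ I} → ℝ)).prod
        (volume : Measure ({i : L // i ∉ I} → ℝ))) :=
  ((Lp.aestronglyMeasurable f).comp_fst).mul ((Lp.aestronglyMeasurable g).comp_snd)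

lemma eLpNorm_tensorFun (f : SpaceIn I) (g : SpaceOut I) :
    eLpNorm (tensorFun I f g) 2 volume = eLpNorm f 2 volume * eLpNorm g 2 volume := by
  rw [tensorFun_eq_comp, eLpNorm_comp_measurePreserving (aestronglyMeasurable_mul_prod I f g)
    (measurePreserving_split I)]
  simp only [eLpNorm_eq_lintegral_rpow_enorm_toReal (p := 2) (by norm_num) (by norm_num)]
  rw [← ENNReal.mul_rpow_of_nonneg _ _ (by norm_num)]
  congr 1
  simp only [enorm_mul, ENNReal.mul_rpow_of_nonneg _ _ (ENNReal.toReal_nonneg)]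
  exact lintegral_prod_mul ((Lp.aestronglyMeasurable f).enorm.pow_const _)
    ((Lp.aestronglyMeasurable g).enorm.pow_const _)

lemma memLp_tensorFun (f : SpaceIn I) (g : SpaceOut I) :
    MemLp (tensorFun I f g) 2 volume := by
  refine ⟨?_, ?_⟩
  · rw [tensorFun_eq_comp]
    exact (aestronglyMeasurable_mul_prod I f g).comp_measurePreserving (measurePreserving_split I)
  · rw [eLpNorm_tensorFun]
    exact ENNReal.mul_lt_top (Lp.eLpNorm_lt_top f) (Lp.eLpNorm_lt_top g)

/-- The product vector `f ⊗ g ∈ L²(ℝ^L)` of `f ∈ L²(ℝ^I)` and `g ∈ L²(ℝ^O)`. -/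
def tensor (f : SpaceIn I) (g : SpaceOut I) : Space L := (memLp_tensorFun I f g).toLp _

lemma tensor_ae (f : SpaceIn I) (g : SpaceOut I) : tensor I f g =ᵐ[volume] tensorFun I f g :=
  (memLp_tensorFun I f g).coeFn_toLp

lemma norm_tensor (f : SpaceIn I) (g : SpaceOut I) : ‖tensor I f g‖ = ‖f‖ * ‖g‖ := by
  rw [tensor, Lp.norm_toLp, eLpNorm_tensorFun, ENNReal.toReal_mul, Lp.norm_def, Lp.norm_def]

lemma ae_restrict_in {f f' : ({i : L // i ∈ I} → ℝ) → ℂ} (h : f =ᵐ[volume] f') :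
    ∀ᵐ x : L → ℝ, f (fun i => x i) = f' (fun i => x i) :=
  (Measure.quasiMeasurePreserving_fst.comp
    (measurePreserving_split I).quasiMeasurePreserving).ae h

lemma ae_restrict_out {g g' : ({i : L // i ∉ I} → ℝ) → ℂ} (h : g =ᵐ[volume] g') :
    ∀ᵐ x : L → ℝ, g (fun i => x i) = g' (fun i => x i) :=
  (Measure.quasiMeasurePreserving_snd.comp
    (measurePreserving_split I).quasiMeasurePreserving).ae h

/-- `f ⊗ g` as a bilinear map. -/
def tensorBilin : SpaceIn I →ₗ[ℂ] SpaceOut I →ₗ[ℂ] Space L :=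
  LinearMap.mk₂ ℂ (tensor I)
    (fun f f' g => by
      ext1
      filter_upwards [tensor_ae I (f + f') g, tensor_ae I f g, tensor_ae I f' g,
        ae_restrict_in I (Lp.coeFn_add f f'), Lp.coeFn_add (tensor I f g) (tensor I f' g)]
        with x h1 h2 h3 h4 h5
      simp only [h1, h5, h2, h3, tensorFun, h4, Pi.add_apply, add_mul])
    (fun c f g => by
      ext1
      filter_upwards [tensor_ae I (c • f) g, tensor_ae I f g,
        ae_restrict_in I (Lp.coeFn_smul c f), Lp.coeFn_smul c (tensor I f g)]
        with x h1 h2 h4 h5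
      simp only [h1, h5, h2, tensorFun, h4, Pi.smul_apply, smul_eq_mul, mul_assoc])
    (fun f g g' => by
      ext1
      filter_upwards [tensor_ae I f (g + g'), tensor_ae I f g, tensor_ae I f g',
        ae_restrict_out I (Lp.coeFn_add g g'), Lp.coeFn_add (tensor I f g) (tensor I f g')]
        with x h1 h2 h3 h4 h5
      simp only [h1, h5, h2, h3, tensorFun, h4, Pi.add_apply, mul_add])
    (fun c f g => by
      ext1
      filter_upwards [tensor_ae I f (c • g), tensor_ae I f g,
        ae_restrict_out I (Lp.coeFn_smul c g), Lp.coeFn_smul c (tensor I f g)]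
        with x h1 h2 h4 h5
      simp only [h1, h5, h2, tensorFun, h4, Pi.smul_apply, smul_eq_mul, mul_left_comm])

/-- The bounded operator `|f⟩ ⊗ 1 : L²(ℝ^O) → L²(ℝ^L)`, `g ↦ f ⊗ g`. Its adjoint is `⟨f| ⊗ 1`. -/
def ketIn (f : SpaceIn I) : SpaceOut I →L[ℂ] Space L :=
  (tensorBilin I f).mkContinuous ‖f‖ fun g => (norm_tensor I f g).le

/-- The bounded operator `1 ⊗ |g⟩ : L²(ℝ^I) → L²(ℝ^L)`, `f ↦ f ⊗ g`. Its adjoint is `1 ⊗ ⟨g|`. -/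
def ketOut (g : SpaceOut I) : SpaceIn I →L[ℂ] Space L :=
  ((tensorBilin I).flip g).mkContinuous ‖g‖ fun f => by
    rw [mul_comm]; exact (norm_tensor I f g).le

/-- The reduced state `ρ_I = tr_O[ρ] = ∑ₖ (1 ⊗ ⟨gₖ|) ρ (1 ⊗ |gₖ⟩)`, with `(gₖ)` an orthonormal
basis of `L²(ℝ^O)`. For a density operator `ρ` the series is absolutely summable in operator
norm, and its sum does not depend on the basis. -/
def partialTrace (ρ : Space L →L[ℂ] Space L) : SpaceIn I →L[ℂ] SpaceIn I :=
  ∑' k, (ketOut I (stdBasis (SpaceOut I) k)).adjoint ∘L ρ ∘L ketOut I (stdBasis (SpaceOut I) k)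

/-- The partial transpose `ρ^{Γ_I}` with respect to `I`: writing
`ρ = ∑_{k,l} |fₖ⟩⟨fₗ| ⊗ ρₖₗ` with `(fₖ)` an orthonormal basis of `L²(ℝ^I)` and
`ρₖₗ = (⟨fₖ| ⊗ 1) ρ (|fₗ⟩ ⊗ 1)`, it is `∑_{k,l} |fₗ⟩⟨fₖ| ⊗ ρₖₗ`. For a density operator
(more generally, a Hilbert-Schmidt operator) `ρ` this family is unconditionally summable in
operator norm. Another basis changes `ρ^{Γ_I}` only by conjugation with a unitary acting
on `I`, hence leaves its trace norm unchanged. -/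
def partialTranspose (ρ : Space L →L[ℂ] Space L) : Space L →L[ℂ] Space L :=
  ∑' kl : basisIndex (SpaceIn I) × basisIndex (SpaceIn I),
    ketIn I (stdBasis (SpaceIn I) kl.2) ∘L
      ((ketIn I (stdBasis (SpaceIn I) kl.1)).adjoint ∘L ρ ∘L
        ketIn I (stdBasis (SpaceIn I) kl.2)) ∘L
      (ketIn I (stdBasis (SpaceIn I) kl.1)).adjoint

/-- The logarithmic negativity `E_N(ρ, I) = log₂ ‖ρ^{Γ_I}‖₁`. -/
def logNegativity (ρ : Space L →L[ℂ] Space L) : EReal := log2 (traceNorm (partialTranspose I ρ))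

end Tensor

/-! ## The harmonic Hamiltonian and its ground states -/

section Hamiltonian

variable {L : Type} [Fintype L] [DecidableEq L]

/-- The position operator `xᵢ` on Schwartz functions: multiplication by the `i`-th coordinate. -/
def position (i : L) : 𝓢(L → ℝ, ℂ) →L[ℂ] 𝓢(L → ℝ, ℂ) :=
  SchwartzMap.smulLeftCLM ℂ (fun x : L → ℝ => (x i : ℂ))

lemma position_apply (i : L) (f : 𝓢(L → ℝ, ℂ)) (x : L → ℝ) :
    position i f x = (x i : ℂ) * f x := by
  have h : Function.HasTemperateGrowth (fun x : L → ℝ => (x i : ℂ)) :=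
    (Complex.ofRealCLM ∘L ContinuousLinearMap.proj (R := ℝ) (φ := fun _ : L => ℝ) i
      ).hasTemperateGrowth
  rw [position, SchwartzMap.smulLeftCLM_apply_apply h, smul_eq_mul]

/-- The momentum operator `pᵢ = -i ∂/∂xᵢ` on Schwartz functions. -/
def momentum (i : L) : 𝓢(L → ℝ, ℂ) →L[ℂ] 𝓢(L → ℝ, ℂ) :=
  (-Complex.I) • LineDeriv.lineDerivOpCLM ℂ 𝓢(L → ℝ, ℂ) (Pi.single i (1 : ℝ) : L → ℝ)

/-- The harmonic Hamiltonian `½ ∑_{i,j} (pᵢ P_{ij} pⱼ + xᵢ X_{ij} xⱼ)` on Schwartz functions. -/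
def hamiltonian (P X : Matrix L L ℝ) : 𝓢(L → ℝ, ℂ) →L[ℂ] 𝓢(L → ℝ, ℂ) :=
  (1 / 2 : ℂ) • ∑ i, ∑ j, ((P i j : ℂ) • (momentum i ∘L momentum j) +
    (X i j : ℂ) • (position i ∘L position j))

/-- The graph of the self-adjoint Hamiltonian on `L²(ℝ^L)`, which is the closure of its
restriction to the Schwartz functions (on which it is essentially self-adjoint). -/
def hamiltonianGraph (P X : Matrix L L ℝ) : Submodule ℂ (Space L × Space L) :=
  (LinearMap.range
    ((SchwartzMap.toLpCLM ℂ ℂ 2 (volume : Measure (L → ℝ))).prod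
      (SchwartzMap.toLpCLM ℂ ℂ 2 (volume : Measure (L → ℝ)) ∘L hamiltonian P X)
      ).toLinearMap).topologicalClosure

/-- `ψ` is a (normalised) ground state vector: a unit vector in the domain of the Hamiltonian `H`
with `H ψ = e ψ`, where `e` is the least energy: `e ‖φ‖² ≤ ⟨φ, H φ⟩` on the domain of `H`. -/
def IsGroundState (P X : Matrix L L ℝ) (ψ : Space L) : Prop :=
  ‖ψ‖ = 1 ∧ ∃ e : ℝ, (ψ, (e : ℂ) • ψ) ∈ hamiltonianGraph P X ∧
    ∀ φ χ : Space L, (φ, χ) ∈ hamiltonianGraph P X → e * ‖φ‖ ^ 2 ≤ RCLike.re ⟪φ, χ⟫_ℂ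

end Hamiltonian

/-! ## The nearest-neighbour chain -/

/-- The circulant matrix `circ(a, b, 0, …, 0, b)` of size `N` (meant for `N ≥ 3`). -/
def chainCoupling (N : ℕ) (a b : ℝ) : Matrix (Fin N) (Fin N) ℝ :=
  Matrix.circulant fun k : Fin N =>
    if k.val = 0 then a else if k.val = 1 ∨ k.val = N - 1 then b else 0

/-- The first half of the chain: its first `N / 2` sites. -/
def halfChain (N : ℕ) : Finset (Fin N) := Finset.univ.filter fun i => i.val < N / 2

/-- The smallest eigenvalue of a real symmetric matrix. -/
def lambdaMin {N : ℕ} (X : Matrix (Fin N) (Fin N) ℝ) : ℝ := sInf (spectrum ℝ X)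

/-- The operator norm of a matrix with respect to the Euclidean norm. -/
def opNorm {N : ℕ} (X : Matrix (Fin N) (Fin N) ℝ) : ℝ := ‖Matrix.toEuclideanCLM (𝕜 := ℝ) X‖

end HarmonicChain

end

namespace HarmonicChain

set_option linter.unusedSectionVars false

/-! ## Hilbert space preliminaries -/

section Hilbert

variable {E F : Type*} [NormedAddCommGroup E] [InnerProductSpace ℂ E] [CompleteSpace E]
  [NormedAddCommGroup F] [InnerProductSpace ℂ F]

/-! Write `X = A * A` with `A` symmetric and positive. Then `H = ½ ∑ᵢ cᵢ† cᵢ + ½ tr A` with `cᵢ = ∂ᵢ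
+ (A x)ᵢ` (`hamiltonian_eq`), and the Gaussian `exp(-½ x·Ax)` is annihilated by every `cᵢ`. A state
of least energy is orthogonal to the range of every `cᵢ†`, which says that `exp(½ x·Ax) ψ` has
vanishing weak gradient. So the ground state is this Gaussian up to a scalar
(`exists_smul_gaussian_of_isGroundState`).

For a vector with Schmidt coefficients `sⱼ`, the partial transpose is a weighted flip and its trace
norm is `(∑ sⱼ)²` (`IsSchmidt.traceNorm_partialTranspose`). Hence `E_N = 2 log₂ ∑ sⱼ`, and concavity
of the logarithm bounds the entropy by the same number (`IsSchmidt.vonNeumannEntropy_le`). It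
remains to find `∑ sⱼ`.

The reflection of the chain exchanges the two halves. In reflected coordinates, with a sign `ε = ±1`
on the second half, `x·Ax` splits into a form `P` in `x - y` and a form `Q` in `x + y`, where `P²`
and `Q²` are the inner block of `X` plus and minus `-ε` times the cross block. The sign is chosen
such that `P² ≥ Q²`, hence `P ≥ Q` by operator monotonicity of the square root. Completing a square
(a Hubbard–Stratonovich transformation) then writes the Gaussian as `∫ g_t ⊗ g_t dt`. So it is the
kernel of a positive operator, the Schmidt coefficients are its eigenvalues, and their sum is its
trace, a Gaussian integral (`exists_isSchmidt_of_kernel`, `exists_isSchmidt_gaussian`). The outcome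
is `∑ sⱼ = (det P / det Q)^{1/4}`, that is, `E_N = ¼ log₂ (det P² / det Q²)`.

For the nearest-neighbour chain, `P²` and `Q²` are multiples of the identity corrected by signed
Laplacians of a path. Sylvester's determinant identity with the incidence matrices leaves a common
determinant, which cancels, and the ratio is `(a + 2|b|) / (a - 2|b|)` for every length
(`entanglement_halfChain`). -/

lemma cfc_apply_eigenvector {S : E →L[ℂ] E} (hS : IsSelfAdjoint S) {f : ℝ → ℝ}
    (hf : Continuous f) {e : E} {μ : ℝ} (he : S e = (μ : ℂ) • e) :
    cfc f S e = (f μ : ℂ) • e := by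
  by_cases h0 : e = 0
  · simp [h0]
  have hμ : μ ∈ spectrum ℝ S := by
    rw [spectrum.mem_iff]
    intro hu
    obtain ⟨u, hu⟩ := hu
    have h1 : (u : E →L[ℂ] E) e = 0 := by
      rw [hu, sub_apply, he, Algebra.algebraMap_eq_smul_one]
      simp
    have h2 : (↑u⁻¹ * (u : E →L[ℂ] E)) e = 0 := by
      rw [mul_apply_eq_comp, h1, map_zero]
    rw [u.inv_mul] at h2
    exact h0 h2
  rw [cfc_apply f S hS hf.continuousOn]
  -- Stone–Weierstrass: the functions with this property form a closed star subalgebra containing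
  -- the constants and the identity.
  have key : ∀ g : C(spectrum ℝ S, ℝ), cfcHom hS g e = (g ⟨μ, hμ⟩ : ℂ) • e := by
    intro g
    induction g using ContinuousMap.induction_on_of_compact with
    | const r =>
      have : ContinuousMap.const (spectrum ℝ S) r = algebraMap ℝ C(spectrum ℝ S, ℝ) r := rfl
      rw [this, AlgHomClass.commutes, Algebra.algebraMap_eq_smul_one]
      simp
    | id => rw [cfcHom_id, he]; rfl
    | star_id => rw [map_star, cfcHom_id, hS.star_eq, he]; simp
    | add f g hf hg => rw [map_add, add_apply, hf, hg]; simp [add_smul]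
    | mul f g hf hg =>
      rw [map_mul, mul_apply_eq_comp, hg, map_smul, hf, smul_smul, mul_comm]; simp
    | frequently f h =>
      have hc : IsClosed {g : C(spectrum ℝ S, ℝ) | cfcHom hS g e = (g ⟨μ, hμ⟩ : ℂ) • e} := by
        refine isClosed_eq ?_ ?_
        · exact (ContinuousLinearMap.apply ℂ E e).continuous.comp (cfcHom_continuous hS)
        · fun_prop
      exact hc.closure_subset (mem_closure_iff_frequently.mpr h)
  exact key _

lemma hasSum_eigen {ι : Type*} (e : HilbertBasis ι ℂ E) {B : E →L[ℂ] E} {t : ι → ℝ}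
    (hB : ∀ i, B (e i) = (t i : ℂ) • e i) (x : E) :
    HasSum (fun i => t i * ‖⟪e i, x⟫_ℂ‖ ^ 2) (RCLike.re ⟪x, B x⟫_ℂ) := by
  have h1 := (innerSL ℂ x).hasSum (B.hasSum (e.hasSum_repr x))
  have h2 : HasSum _ (RCLike.re ⟪x, B x⟫_ℂ) := RCLike.hasSum_re ℂ h1
  convert h2 using 1
  funext i
  rw [map_smul, hB, HilbertBasis.repr_apply_apply, innerSL_apply_apply, inner_smul_right,
    inner_smul_right, ← inner_conj_symm x (e i)]
  have : ⟪e i, x⟫_ℂ * ((t i : ℂ) * (starRingEnd ℂ) ⟪e i, x⟫_ℂ) =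
      ((t i * ‖⟪e i, x⟫_ℂ‖ ^ 2 : ℝ) : ℂ) := by
    rw [mul_left_comm, RCLike.mul_conj]; push_cast; rfl
  rw [this]; exact (Complex.ofReal_re _).symm

lemma hasSum_sq_norm_inner {ι : Type*} (e : HilbertBasis ι ℂ E) (x : E) :
    HasSum (fun i => ‖⟪e i, x⟫_ℂ‖ ^ 2) (‖x‖ ^ 2) := by
  have h := hasSum_eigen e (B := ContinuousLinearMap.id ℂ E) (t := fun _ => 1) (by simp) x
  simpa [inner_self_eq_norm_sq_to_K, ← Complex.ofReal_pow] using h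

lemma tsum_ofReal_sq_norm_inner {ι : Type*} (e : HilbertBasis ι ℂ E) (x : E) :
    ∑' i, ENNReal.ofReal (‖⟪e i, x⟫_ℂ‖ ^ 2) = ENNReal.ofReal (‖x‖ ^ 2) := by
  have h := hasSum_sq_norm_inner e x
  rw [← ENNReal.ofReal_tsum_of_nonneg (fun _ => by positivity) h.summable, h.tsum_eq]

/-- Parseval and the exchange of sums in `[0, ∞]` replace the arbitrarily chosen basis in `posTrace`
by an eigenbasis. -/
lemma posTrace_eq_tsum_eigen {ι : Type*} (e : HilbertBasis ι ℂ E) {B : E →L[ℂ] E} {t : ι → ℝ}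
    (ht : ∀ i, 0 ≤ t i) (hB : ∀ i, B (e i) = (t i : ℂ) • e i) :
    posTrace B = ∑' i, ENNReal.ofReal (t i) := by
  have h1 : ∀ k, ENNReal.ofReal (RCLike.re ⟪stdBasis E k, B (stdBasis E k)⟫_ℂ) =
      ∑' i, ENNReal.ofReal (t i) * ENNReal.ofReal (‖⟪stdBasis E k, e i⟫_ℂ‖ ^ 2) := by
    intro k
    have h := hasSum_eigen e hB (stdBasis E k)
    rw [← h.tsum_eq, ENNReal.ofReal_tsum_of_nonneg
      (fun i => mul_nonneg (ht i) (by positivity)) h.summable]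
    refine tsum_congr fun i => ?_
    rw [ENNReal.ofReal_mul (ht i), norm_inner_symm]
  rw [posTrace, tsum_congr h1, ENNReal.tsum_comm]
  refine tsum_congr fun i => ?_
  rw [ENNReal.tsum_mul_left, tsum_ofReal_sq_norm_inner]
  simp [e.orthonormal.1 i]

lemma traceNorm_eq_tsum_of_eigen {ι : Type*} (e : HilbertBasis ι ℂ E) {T : E →L[ℂ] E}
    {t : ι → ℝ} (ht : ∀ i, 0 ≤ t i) (hT : ∀ i, (star T * T) (e i) = ((t i ^ 2 : ℝ) : ℂ) • e i) :
    traceNorm T = ∑' i, ENNReal.ofReal (t i) := by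
  have h0 : 0 ≤ star T * T := star_mul_self_nonneg T
  refine posTrace_eq_tsum_eigen e ht fun i => ?_
  rw [CFC.sqrt_eq_real_sqrt _ h0, cfcₙ_eq_cfc (hf := Real.continuous_sqrt.continuousOn),
    cfc_apply_eigenvector (IsSelfAdjoint.of_nonneg h0) Real.continuous_sqrt (hT i),
    Real.sqrt_sq (ht i)]

lemma vonNeumannEntropy_eq_tsum_of_eigen {ι : Type*} (e : HilbertBasis ι ℂ E) {ρ : E →L[ℂ] E}
    (hρ : IsSelfAdjoint ρ) {p : ι → ℝ} (hp0 : ∀ i, 0 ≤ p i) (hp1 : ∀ i, p i ≤ 1)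
    (h : ∀ i, ρ (e i) = (p i : ℂ) • e i) :
    vonNeumannEntropy ρ = ∑' i, ENNReal.ofReal (-(p i * Real.logb 2 (p i))) := by
  have hc : Continuous fun t : ℝ => -(t * Real.logb 2 t) := by
    have : (fun t : ℝ => -(t * Real.logb 2 t)) = fun t => -(t * Real.log t / Real.log 2) := by
      funext t; rw [Real.logb, mul_div_assoc]
    rw [this]
    exact (Real.continuous_mul_log.div_const _).neg
  refine posTrace_eq_tsum_eigen e (fun i => ?_) fun i => cfc_apply_eigenvector hρ hc (h i)
  rw [neg_nonneg]
  exact mul_nonpos_of_nonneg_of_nonpos (hp0 i) (Real.logb_nonpos one_lt_two (hp0 i) (hp1 i))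

lemma exists_hilbertBasis_coe_eq {ι : Type*} {v : ι → E} (hv : Orthonormal ℂ v)
    (h : ∀ x, (∀ i, ⟪v i, x⟫_ℂ = 0) → x = 0) : ∃ b : HilbertBasis ι ℂ E, ⇑b = v := by
  refine ⟨HilbertBasis.mkOfOrthogonalEqBot hv ?_, HilbertBasis.coe_mkOfOrthogonalEqBot _ _⟩
  rw [Submodule.eq_bot_iff]
  intro x hx
  exact h x fun i => (Submodule.mem_orthogonal _ _).1 hx _ (Submodule.subset_span ⟨i, rfl⟩)

lemma eq_of_forall_inner_hilbertBasis {ι : Type*} (e : HilbertBasis ι ℂ E) {x y : E}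
    (h : ∀ i, ⟪e i, x⟫_ℂ = ⟪e i, y⟫_ℂ) : x = y := by
  apply e.repr.injective
  ext i
  simpa [HilbertBasis.repr_apply_apply] using h i

lemma exists_hilbertBasis_of_antiunitary {ι : Type*} (e : HilbertBasis ι ℂ E) {J : E → E}
    (hJ : ∀ x y, ⟪J x, J y⟫_ℂ = ⟪y, x⟫_ℂ) (hs : Function.Surjective J) :
    ∃ b : HilbertBasis ι ℂ E, ∀ i, b i = J (e i) := by
  have ho : Orthonormal ℂ fun i => J (e i) := by
    classical
    rw [orthonormal_iff_ite]
    intro i j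
    rw [hJ, orthonormal_iff_ite.1 e.orthonormal]
    simp [eq_comm]
  obtain ⟨b, hb⟩ := exists_hilbertBasis_coe_eq ho fun x hx => by
    obtain ⟨y, rfl⟩ := hs x
    have : y = 0 := eq_of_forall_inner_hilbertBasis e fun i => by
      rw [inner_zero_right, ← inner_conj_symm, ← hJ, hx, map_zero]
    rw [← inner_self_eq_zero (𝕜 := ℂ), hJ, this, inner_zero_left]
  exact ⟨b, fun i => by rw [hb]⟩

/-- `J` conjugates the coordinates with respect to `f`. It turns the basis-dependent transposition
in `partialTranspose` into complex conjugation of vectors. -/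
lemma exists_antiunitary_of_hilbertBasis {ι : Type*} (f : HilbertBasis ι ℂ E) :
    ∃ J : E → E, (∀ x y, ⟪J x, J y⟫_ℂ = ⟪y, x⟫_ℂ) ∧ Function.Surjective J ∧
      ∀ k x, ⟪f k, J x⟫_ℂ = ⟪x, f k⟫_ℂ := by
  let J : E → E := fun x => f.repr.symm (star (f.repr x))
  have h1 : ∀ k x, ⟪f k, J x⟫_ℂ = ⟪x, f k⟫_ℂ := fun k x => by
    rw [← HilbertBasis.repr_apply_apply]
    simp [J, HilbertBasis.repr_apply_apply]
  refine ⟨J, fun x y => ?_, fun x => ⟨J x, ?_⟩, h1⟩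
  · rw [← (f.hasSum_inner_mul_inner (J x) (J y)).tsum_eq,
      ← (f.hasSum_inner_mul_inner y x).tsum_eq]
    refine tsum_congr fun i => ?_
    rw [h1, ← inner_conj_symm, h1, inner_conj_symm, mul_comm]
  · simp [J]

/-- Basis vectors lie at distance `√2` from each other, so the balls of radius `1/2` around them are
disjoint. Countability is needed to exchange a sum over the basis with an integral. -/
lemma countable_of_hilbertBasis [SecondCountableTopology E] {ι : Type*} (e : HilbertBasis ι ℂ E) :
    Countable ι := by
  have hd : ∀ i j, i ≠ j → 1 ≤ dist (e i) (e j) := fun i j hij => by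
    have h0 : ⟪e i, e j⟫_ℂ = 0 := e.orthonormal.2 hij
    have h2 : ‖e i - e j‖ ^ 2 = 2 := by
      rw [@norm_sub_sq ℂ, h0, e.orthonormal.1, e.orthonormal.1]; norm_num
    rw [dist_eq_norm]
    nlinarith [norm_nonneg (e i - e j)]
  have : (Set.univ : Set ι).PairwiseDisjoint fun i => Metric.ball (e i) (1 / 2) := by
    intro i _ j _ hij
    exact Metric.ball_disjoint_ball (by linarith [hd i j hij])
  have := this.countable_of_isOpen (fun i _ => Metric.isOpen_ball)
    (fun i _ => ⟨e i, Metric.mem_ball_self (by norm_num)⟩)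
  exact Set.countable_univ_iff.1 this

/-- The Cauchy criterion. It serves families that need not be absolutely summable but whose finite
sums are bounded in Hilbert–Schmidt fashion. -/
lemma summable_of_sq_norm_sum_le {ι : Type*} [CompleteSpace F] {c : ι → E →L[ℂ] F} {w : ι → ℝ}
    (hw : Summable w) (h : ∀ s : Finset ι, ‖∑ i ∈ s, c i‖ ^ 2 ≤ ∑ i ∈ s, w i) : Summable c := by
  rw [summable_iff_vanishing_norm] at hw ⊢
  intro ε hε
  obtain ⟨s, hs⟩ := hw (ε ^ 2) (by positivity)
  refine ⟨s, fun t ht => ?_⟩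
  have h1 := (h t).trans_lt ((le_abs_self _).trans_lt (hs t ht))
  exact lt_of_pow_lt_pow_left₀ 2 hε.le h1

/-- A Hilbert–Schmidt operator is the norm limit of the finite-rank sums `∑ |A fₖ⟩⟨fₖ|`, by
Cauchy–Schwarz and Bessel. -/
lemma isCompactOperator_of_summable_sq [CompleteSpace F] {ι : Type*} (f : HilbertBasis ι ℂ E)
    {A : E →L[ℂ] F} (hA : Summable fun k => ‖A (f k)‖ ^ 2) : IsCompactOperator A := by
  have hs : Summable fun k => InnerProductSpace.rankOne ℂ (A (f k)) (f k) := by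
    refine summable_of_sq_norm_sum_le hA fun s => ?_
    have hn : 0 ≤ ∑ i ∈ s, ‖A (f i)‖ ^ 2 := Finset.sum_nonneg fun _ _ => by positivity
    rw [← Real.le_sqrt (norm_nonneg _) hn]
    refine ContinuousLinearMap.opNorm_le_bound _ (Real.sqrt_nonneg _) fun x => ?_
    simp only [sum_apply, InnerProductSpace.rankOne_apply]
    calc ‖∑ i ∈ s, ⟪f i, x⟫_ℂ • A (f i)‖ ≤ ∑ i ∈ s, ‖A (f i)‖ * ‖⟪f i, x⟫_ℂ‖ :=
          (norm_sum_le _ _).trans_eq (by simp only [norm_smul, mul_comm])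
      _ ≤ √(∑ i ∈ s, ‖A (f i)‖ ^ 2) * √(∑ i ∈ s, ‖⟪f i, x⟫_ℂ‖ ^ 2) :=
          Real.sum_mul_le_sqrt_mul_sqrt _ _ _
      _ ≤ _ := by
          gcongr
          exact Real.sqrt_le_iff.2 ⟨norm_nonneg _, f.orthonormal.sum_inner_products_le x⟩
  have hA' : HasSum (fun k => InnerProductSpace.rankOne ℂ (A (f k)) (f k)) A := by
    convert hs.hasSum
    ext x
    have h1 := (ContinuousLinearMap.apply ℂ F x).hasSum hs.hasSum
    refine (h1.unique ?_).symm
    simpa [HilbertBasis.repr_apply_apply] using A.hasSum (f.hasSum_repr x)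
  refine isCompactOperator_of_tendsto hA' (Filter.Eventually.of_forall fun s => ?_)
  have : ∀ k, InnerProductSpace.rankOne ℂ (A (f k)) (f k) ∈
      compactOperator (RingHom.id ℂ) E F := fun k =>
    (isCompactOperator_of_locallyCompactSpace_dom
      (innerSL ℂ (f k))).clm_comp (ContinuousLinearMap.toSpanSingleton ℂ (A (f k)))
  exact Submodule.sum_mem (compactOperator (RingHom.id ℂ) E F) fun k _ => this k

lemma hasSum_congr {α κ : Type*} [AddCommMonoid α] [TopologicalSpace α] {f g : κ → α} {a : α}
    (h : ∀ k, f k = g k) : HasSum f a ↔ HasSum g a := by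
  rw [funext h]

lemma hasSum_inner_apply {κ : Type*} {c : κ → E →L[ℂ] F} {A : E →L[ℂ] F} (h : HasSum c A)
    (x : F) (y : E) : HasSum (fun k => ⟪x, c k y⟫_ℂ) ⟪x, A y⟫_ℂ :=
  (innerSL ℂ x).hasSum ((ContinuousLinearMap.apply ℂ F y).hasSum h)

lemma opNorm_le_of_inner_le {A : E →L[ℂ] F} {C : ℝ} (hC : 0 ≤ C)
    (h : ∀ w u, ‖⟪u, A w⟫_ℂ‖ ≤ C * (‖w‖ * ‖u‖)) : ‖A‖ ≤ C := by
  refine ContinuousLinearMap.opNorm_le_bound _ hC fun w => ?_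
  have h1 := h w (A w)
  rw [inner_self_eq_norm_sq_to_K, norm_pow, RCLike.norm_ofReal, abs_norm] at h1
  by_cases h0 : ‖A w‖ = 0
  · rw [h0]; positivity
  · have h2 : 0 < ‖A w‖ := lt_of_le_of_ne (norm_nonneg _) (Ne.symm h0)
    refine le_of_mul_le_mul_right ?_ h2
    linarith

lemma sum_sq_mul_le_of_hasSum {ι κ : Type*} {α : ι → ℝ} {β : κ → ℝ} {a b : ℝ}
    (ha : HasSum (fun i => α i ^ 2) a) (hb : HasSum (fun k => β k ^ 2) b) (s : Finset (ι × κ)) :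
    ∑ p ∈ s, (α p.1 * β p.2) ^ 2 ≤ a * b := by
  classical
  calc _ ≤ ∑ p ∈ s.image Prod.fst ×ˢ s.image Prod.snd, (α p.1 * β p.2) ^ 2 :=
        Finset.sum_le_sum_of_subset_of_nonneg Finset.subset_product fun _ _ _ => by positivity
    _ = (∑ k ∈ s.image Prod.fst, α k ^ 2) * ∑ l ∈ s.image Prod.snd, β l ^ 2 := by
        rw [Finset.sum_mul_sum, Finset.sum_product]
        simp only [mul_pow]
    _ ≤ a * b := mul_le_mul (sum_le_hasSum _ (fun _ _ => by positivity) ha)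
        (sum_le_hasSum _ (fun _ _ => by positivity) hb)
        (Finset.sum_nonneg fun _ _ => by positivity) (ha.nonneg fun _ => by positivity)

end Hilbert

universe u in
lemma exists_hilbertBasis_eigen {E : Type u} [NormedAddCommGroup E]
    [InnerProductSpace ℂ E] [CompleteSpace E] {T : E →L[ℂ] E} (hT : IsCompactOperator T)
    (hT' : T.IsSymmetric) :
    ∃ (ι : Type u) (e : HilbertBasis ι ℂ E) (μ : ι → ℂ), ∀ i, T (e i) = μ i • e i := by
  let V : ℂ → Submodule ℂ E := fun μ => Module.End.eigenspace (T : Module.End ℂ E) μ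
  have hc : ∀ μ, IsClosed (V μ : Set E) := fun μ => by
    have : (V μ : Set E) = {x | T x = μ • x} := by
      ext x; exact Module.End.mem_eigenspace_iff
    rw [this]
    exact isClosed_eq T.continuous (continuous_const_smul μ)
  have : ∀ μ, CompleteSpace (V μ) := fun μ => (hc μ).completeSpace_coe
  have hof := hT'.orthogonalFamily_eigenspaces
  -- Every complex `μ` may serve as an index, because a trivial eigenspace contributes no basis
  -- vector.
  let v : (Σ μ : ℂ, basisIndex (V μ)) → E := fun i => (stdBasis (V i.1) i.2 : V i.1)
  have ho : Orthonormal ℂ v := by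
    refine ⟨fun i => (stdBasis (V i.1)).orthonormal.1 i.2, ?_⟩
    rintro ⟨μ, k⟩ ⟨ν, l⟩ h
    by_cases hμ : μ = ν
    · subst hμ
      have hkl : k ≠ l := fun h' => h (by rw [h'])
      exact (stdBasis (V μ)).orthonormal.2 hkl
    · exact hof hμ (stdBasis (V μ) k) (stdBasis (V ν) l)
  obtain ⟨b, hb⟩ := exists_hilbertBasis_coe_eq ho fun x hx => by
    have h0 := ContinuousLinearMap.orthogonalComplement_iSup_eigenspaces_eq_bot hT hT'
    rw [← Submodule.mem_bot ℂ (x := x), ← h0, Submodule.mem_orthogonal]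
    intro u hu
    induction hu using Submodule.iSup_induction' with
    | mem μ y hy =>
      have h1 : HasSum (fun k => _) (⟨y, hy⟩ : V μ) := (stdBasis (V μ)).hasSum_repr ⟨y, hy⟩
      have h2 := (V μ).subtypeL.hasSum h1
      have h3 := (innerSL ℂ x).hasSum h2
      have h4 : ⟪x, y⟫_ℂ = 0 := by
        refine h3.unique ?_
        convert hasSum_zero using 1
        funext k
        have := hx ⟨μ, k⟩
        rw [← inner_conj_symm, map_eq_zero] at this
        rw [map_smul, innerSL_apply_apply, inner_smul_right]
        exact mul_eq_zero_of_right _ this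
      rw [← inner_conj_symm, h4, map_zero]
    | zero => simp
    | add y z _ _ hy hz => rw [inner_add_left, hy, hz, add_zero]
  refine ⟨(Σ μ : ℂ, basisIndex (V μ)), b, fun i => i.1, fun i => ?_⟩
  rw [hb]
  exact Module.End.mem_eigenspace_iff.1 (stdBasis (V i.1) i.2).2

/-! ## Product vectors -/

/-- Rectangles are a generating π-system, so on each finite rectangle `S n` the vanishing integrals
extend to all measurable sets, and these rectangles cover the space. This gives totality of the
product vectors, tested on indicator functions. -/
lemma ae_eq_zero_of_forall_setIntegral_prod {α β : Type*} [MeasurableSpace α] [MeasurableSpace β]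
    {μ : Measure α} {ν : Measure β} [SigmaFinite μ] [SigmaFinite ν] {h : α × β → ℂ}
    (hi : ∀ s, (μ.prod ν) s < ∞ → IntegrableOn h s (μ.prod ν))
    (h0 : ∀ A B, MeasurableSet A → MeasurableSet B → μ A < ∞ → ν B < ∞ →
      ∫ z in A ×ˢ B, h z ∂(μ.prod ν) = 0) : h =ᵐ[μ.prod ν] 0 := by
  let S : ℕ → Set (α × β) := fun n => spanningSets μ n ×ˢ spanningSets ν n
  have hSm : ∀ n, MeasurableSet (S n) := fun n =>
    (measurableSet_spanningSets μ n).prod (measurableSet_spanningSets ν n)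
  have hSf : ∀ n, (μ.prod ν) (S n) < ∞ := fun n => by
    rw [Measure.prod_prod]
    exact ENNReal.mul_lt_top (measure_spanningSets_lt_top μ n) (measure_spanningSets_lt_top ν n)
  have key : ∀ n, h =ᵐ[(μ.prod ν).restrict (S n)] 0 := by
    intro n
    have hint : Integrable h ((μ.prod ν).restrict (S n)) := hi _ (hSf n)
    have hrect : ∀ A B, MeasurableSet A → MeasurableSet B →
        ∫ z in A ×ˢ B, h z ∂((μ.prod ν).restrict (S n)) = 0 := by
      intro A B hA hB
      rw [Measure.restrict_restrict (hA.prod hB), Set.prod_inter_prod]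
      exact h0 _ _ (hA.inter (measurableSet_spanningSets μ n))
        (hB.inter (measurableSet_spanningSets ν n))
        ((measure_mono Set.inter_subset_right).trans_lt (measure_spanningSets_lt_top μ n))
        ((measure_mono Set.inter_subset_right).trans_lt (measure_spanningSets_lt_top ν n))
    have hall : ∀ s, MeasurableSet s → ∫ z in s, h z ∂((μ.prod ν).restrict (S n)) = 0 := by
      intro s hs
      induction s, hs using MeasurableSpace.induction_on_inter generateFrom_prod.symm
        isPiSystem_prod with
      | empty => simp
      | basic t ht =>
        obtain ⟨A, hA, B, hB, rfl⟩ := ht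
        exact hrect A B hA hB
      | compl t ht h1 =>
        rw [setIntegral_compl ht hint, h1, sub_zero]
        simpa using hrect Set.univ Set.univ MeasurableSet.univ MeasurableSet.univ
      | iUnion f hd hf h1 =>
        rw [integral_iUnion hf hd hint.integrableOn]
        simp [h1]
    exact ae_eq_zero_of_forall_setIntegral_eq_of_sigmaFinite
      (fun s _ _ => hint.integrableOn) fun s hs _ => hall s hs
  have hU : ⋃ n, S n = Set.univ := by
    rw [Set.eq_univ_iff_forall]
    rintro ⟨x, y⟩
    obtain ⟨i, hi⟩ := Set.mem_iUnion.1 ((iUnion_spanningSets μ).symm ▸ Set.mem_univ x)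
    obtain ⟨j, hj⟩ := Set.mem_iUnion.1 ((iUnion_spanningSets ν).symm ▸ Set.mem_univ y)
    exact Set.mem_iUnion.2 ⟨max i j, monotone_spanningSets μ (le_max_left i j) hi,
      monotone_spanningSets ν (le_max_right i j) hj⟩
  have := (ae_restrict_iUnion_iff S (fun z => h z = 0)).2 key
  rwa [hU, Measure.restrict_univ] at this

section Tensor

variable {L : Type} [Fintype L] [DecidableEq L] (I : Finset L)

/-- The restriction of a configuration to the sites in `I` and to those outside `I`. -/
abbrev splitEquiv : (L → ℝ) ≃ᵐ ({i : L // i ∈ I} → ℝ) × ({i : L // i ∉ I} → ℝ) :=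
  MeasurableEquiv.piEquivPiSubtypeProd (fun _ : L => ℝ) (· ∈ I)

lemma inner_tensor_left (f : SpaceIn I) (g : SpaceOut I) (h : Space L) :
    ⟪tensor I f g, h⟫_ℂ =
      ∫ z : ({i : L // i ∈ I} → ℝ) × ({i : L // i ∉ I} → ℝ),
        starRingEnd ℂ (f z.1 * g z.2) * h ((splitEquiv I).symm z) ∂(volume.prod volume) := by
  rw [L2.inner_def, ← (measurePreserving_split I).integral_comp']
  refine integral_congr_ae ?_
  filter_upwards [tensor_ae I f g] with x hx
  rw [hx, MeasurableEquiv.symm_apply_apply, RCLike.inner_apply, mul_comm]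
  rfl

lemma inner_tensor (f f' : SpaceIn I) (g g' : SpaceOut I) :
    ⟪tensor I f g, tensor I f' g'⟫_ℂ = ⟪f, f'⟫_ℂ * ⟪g, g'⟫_ℂ := by
  rw [inner_tensor_left, L2.inner_def, L2.inner_def, ← integral_prod_mul]
  refine integral_congr_ae ?_
  have h := ((measurePreserving_split I).symm).quasiMeasurePreserving.ae (tensor_ae I f' g')
  filter_upwards [h] with z hz
  rw [hz, tensorFun_eq_comp, Function.comp_apply, MeasurableEquiv.apply_symm_apply]
  simp only [RCLike.inner_apply, map_mul]
  ring

lemma eq_zero_of_forall_inner_tensor {h : Space L} (h0 : ∀ f g, ⟪tensor I f g, h⟫_ℂ = 0) :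
    h = 0 := by
  have hmp := (measurePreserving_split I).symm
  have hmem : MemLp (h ∘ (splitEquiv I).symm) 2 (volume.prod volume) :=
    (Lp.memLp h).comp_measurePreserving hmp
  have key : h ∘ (splitEquiv I).symm =ᵐ[volume.prod volume] 0 := by
    refine ae_eq_zero_of_forall_setIntegral_prod (fun s hs => ?_) fun A B hA hB hμA hμB => ?_
    · have : Fact ((volume.prod volume : Measure (({i : L // i ∈ I} → ℝ) ×
          ({i : L // i ∉ I} → ℝ))) s < ∞) := ⟨hs⟩
      exact hmem.restrict s |>.integrable one_le_two
    · have h1 := h0 (indicatorConstLp 2 hA hμA.ne 1) (indicatorConstLp 2 hB hμB.ne 1)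
      rw [inner_tensor_left] at h1
      rw [← integral_indicator (hA.prod hB), ← h1]
      refine integral_congr_ae ?_
      have hA' := Measure.quasiMeasurePreserving_fst (μ := volume)
        (ν := (volume : Measure ({i : L // i ∉ I} → ℝ))) |>.ae
        (indicatorConstLp_coeFn (p := 2) (hs := hA) (hμs := hμA.ne) (c := (1 : ℂ)))
      have hB' := Measure.quasiMeasurePreserving_snd (ν := volume)
        (μ := (volume : Measure ({i : L // i ∈ I} → ℝ))) |>.ae
        (indicatorConstLp_coeFn (p := 2) (hs := hB) (hμs := hμB.ne) (c := (1 : ℂ)))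
      filter_upwards [hA', hB'] with z hzA hzB
      rw [hzA, hzB]
      by_cases h1 : z.1 ∈ A <;> by_cases h2 : z.2 ∈ B <;>
        simp [Set.indicator, h1, h2]
  rw [Lp.eq_zero_iff_ae_eq_zero]
  have := (measurePreserving_split I).quasiMeasurePreserving.ae key
  filter_upwards [this] with x hx
  simpa using hx

/-- Completeness is obtained one factor at a time: a vector orthogonal to all `aᵢ ⊗ bₖ` has
vanishing partial inner product with `aᵢ`, hence is orthogonal to every `aᵢ ⊗ g`, and then to every
`f ⊗ g`. -/
lemma exists_hilbertBasis_tensor {ι κ : Type*} (a : HilbertBasis ι ℂ (SpaceIn I))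
    (b : HilbertBasis κ ℂ (SpaceOut I)) :
    ∃ e : HilbertBasis (ι × κ) ℂ (Space L), ∀ i k, e (i, k) = tensor I (a i) (b k) := by
  classical
  have ho : Orthonormal ℂ fun p : ι × κ => tensor I (a p.1) (b p.2) := by
    rw [orthonormal_iff_ite]
    rintro ⟨i, k⟩ ⟨j, l⟩
    rw [inner_tensor, orthonormal_iff_ite.1 a.orthonormal, orthonormal_iff_ite.1 b.orthonormal]
    simp only [Prod.mk.injEq, ite_and]
    split_ifs <;> simp
  obtain ⟨e, he⟩ := exists_hilbertBasis_coe_eq ho fun x hx => by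
    refine eq_zero_of_forall_inner_tensor I fun f g => ?_
    have h1 : ∀ i, ⟪tensor I (a i) g, x⟫_ℂ = 0 := fun i => by
      have h2 : (ketIn I (a i)).adjoint x = 0 := eq_of_forall_inner_hilbertBasis b fun k => by
        rw [ContinuousLinearMap.adjoint_inner_right, inner_zero_right]
        exact hx (i, k)
      have h3 := ContinuousLinearMap.adjoint_inner_right (ketIn I (a i)) g x
      rw [h2, inner_zero_right] at h3
      exact h3.symm
    have h2 : (ketOut I g).adjoint x = 0 := eq_of_forall_inner_hilbertBasis a fun i => by
      rw [ContinuousLinearMap.adjoint_inner_right, inner_zero_right]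
      exact h1 i
    have h3 := ContinuousLinearMap.adjoint_inner_right (ketOut I g) f x
    rw [h2, inner_zero_right] at h3
    exact h3.symm
  exact ⟨e, fun i k => by rw [he]⟩

variable {I}

lemma ketIn_apply (f : SpaceIn I) (g : SpaceOut I) : ketIn I f g = tensor I f g := rfl

lemma inner_ketIn_adjoint (f : SpaceIn I) (g : SpaceOut I) (h : Space L) :
    ⟪g, (ketIn I f).adjoint h⟫_ℂ = ⟪tensor I f g, h⟫_ℂ :=
  ContinuousLinearMap.adjoint_inner_right _ _ _

lemma inner_ketOut_adjoint (f : SpaceIn I) (g : SpaceOut I) (h : Space L) :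
    ⟪f, (ketOut I g).adjoint h⟫_ℂ = ⟪tensor I f g, h⟫_ℂ :=
  ContinuousLinearMap.adjoint_inner_right _ _ _

lemma hasSum_sq_norm_ketIn_adjoint {ι : Type*} (a : HilbertBasis ι ℂ (SpaceIn I)) (h : Space L) :
    HasSum (fun i => ‖(ketIn I (a i)).adjoint h‖ ^ 2) (‖h‖ ^ 2) := by
  obtain ⟨e, he⟩ := exists_hilbertBasis_tensor I a (stdBasis (SpaceOut I))
  refine (hasSum_sq_norm_inner e h).prod_fiberwise fun i => ?_
  convert hasSum_sq_norm_inner (stdBasis (SpaceOut I)) ((ketIn I (a i)).adjoint h) using 2 with k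
  rw [he, inner_ketIn_adjoint]

lemma hasSum_sq_norm_ketOut_adjoint {ι : Type*} (b : HilbertBasis ι ℂ (SpaceOut I))
    (h : Space L) :
    HasSum (fun i => ‖(ketOut I (b i)).adjoint h‖ ^ 2) (‖h‖ ^ 2) := by
  obtain ⟨e, he⟩ := exists_hilbertBasis_tensor I (stdBasis (SpaceIn I)) b
  refine ((Equiv.prodComm _ _).hasSum_iff.2 (hasSum_sq_norm_inner e h)).prod_fiberwise
    fun i => ?_
  convert hasSum_sq_norm_inner (stdBasis (SpaceIn I)) ((ketOut I (b i)).adjoint h) using 2 with k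
  rw [Function.comp_apply, Equiv.prodComm_apply, Prod.swap_prod_mk, he, inner_ketOut_adjoint]

end Tensor

/-! ## Entropy and negativity from a Schmidt decomposition -/

section Schmidt

variable {L : Type} [Fintype L] [DecidableEq L] {I : Finset L}

/-- The Schmidt decomposition `ψ = ∑ⱼ sⱼ aⱼ ⊗ bⱼ`, expressed through its coefficients. -/
structure IsSchmidt {ι : Type*} (ψ : Space L) (a : HilbertBasis ι ℂ (SpaceIn I))
    (b : HilbertBasis ι ℂ (SpaceOut I)) (s : ι → ℝ) : Prop where
  nonneg : ∀ j, 0 ≤ s j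
  inner_self : ∀ j, ⟪tensor I (a j) (b j), ψ⟫_ℂ = s j
  inner_of_ne : ∀ j k, j ≠ k → ⟪tensor I (a j) (b k), ψ⟫_ℂ = 0

namespace IsSchmidt

variable {ι : Type*} {ψ : Space L} {a : HilbertBasis ι ℂ (SpaceIn I)}
  {b : HilbertBasis ι ℂ (SpaceOut I)} {s : ι → ℝ}

lemma inner_right (h : IsSchmidt ψ a b s) (f : SpaceIn I) (k : ι) :
    ⟪tensor I f (b k), ψ⟫_ℂ = s k * ⟪f, a k⟫_ℂ := by
  have h1 : (ketOut I (b k)).adjoint ψ = (s k : ℂ) • a k :=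
    eq_of_forall_inner_hilbertBasis a fun j => by
      rw [inner_ketOut_adjoint, inner_smul_right]
      by_cases hjk : j = k
      · subst hjk
        rw [h.inner_self, inner_self_eq_norm_sq_to_K, a.orthonormal.1]
        simp
      · rw [h.inner_of_ne _ _ hjk, a.orthonormal.2 hjk, mul_zero]
  rw [← inner_ketOut_adjoint, h1, inner_smul_right]

lemma inner_left (h : IsSchmidt ψ a b s) (g : SpaceOut I) (k : ι) :
    ⟪tensor I (a k) g, ψ⟫_ℂ = s k * ⟪g, b k⟫_ℂ := by
  have h1 : (ketIn I (a k)).adjoint ψ = (s k : ℂ) • b k :=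
    eq_of_forall_inner_hilbertBasis b fun j => by
      rw [inner_ketIn_adjoint, inner_smul_right]
      by_cases hjk : k = j
      · subst hjk
        rw [h.inner_self, inner_self_eq_norm_sq_to_K, b.orthonormal.1]
        simp
      · rw [h.inner_of_ne _ _ hjk, b.orthonormal.2 (Ne.symm hjk), mul_zero]
  rw [← inner_ketIn_adjoint, h1, inner_smul_right]

lemma hasSum_sq (h : IsSchmidt ψ a b s) : HasSum (fun j => s j ^ 2) (‖ψ‖ ^ 2) := by
  obtain ⟨e, he⟩ := exists_hilbertBasis_tensor I a b
  have h1 := hasSum_sq_norm_inner e ψ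
  have hinj : Function.Injective fun j : ι => (j, j) := fun i j hij => (Prod.mk.inj hij).1
  rw [← hinj.hasSum_iff] at h1
  · convert h1 using 2 with j
    rw [Function.comp_apply, he, h.inner_self]
    simp
  · rintro ⟨i, j⟩ hij
    have : i ≠ j := fun h' => hij ⟨i, by rw [h']⟩
    rw [he, h.inner_of_ne _ _ this]
    simp

end IsSchmidt

lemma hasSum_partialTrace_pureState (ψ : Space L) :
    HasSum (fun k => InnerProductSpace.rankOne ℂ ((ketOut I (stdBasis (SpaceOut I) k)).adjoint ψ)
      ((ketOut I (stdBasis (SpaceOut I) k)).adjoint ψ)) (partialTrace I (pureState ψ)) := by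
  have h1 : ∀ g : SpaceOut I, (ketOut I g).adjoint ∘L pureState ψ ∘L ketOut I g =
      InnerProductSpace.rankOne ℂ ((ketOut I g).adjoint ψ) ((ketOut I g).adjoint ψ) := by
    intro g
    ext1 x
    simp [pureState, ContinuousLinearMap.adjoint_inner_left]
  rw [partialTrace]
  simp only [h1]
  refine (Summable.of_norm ?_).hasSum
  simp only [InnerProductSpace.norm_rankOne, ← sq]
  exact (hasSum_sq_norm_ketOut_adjoint (stdBasis (SpaceOut I)) ψ).summable

lemma inner_partialTrace_pureState (ψ : Space L) (x y : SpaceIn I) :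
    HasSum (fun k => ⟪tensor I x (stdBasis (SpaceOut I) k), ψ⟫_ℂ *
      starRingEnd ℂ ⟪tensor I y (stdBasis (SpaceOut I) k), ψ⟫_ℂ)
      ⟪x, partialTrace I (pureState ψ) y⟫_ℂ := by
  refine (hasSum_congr fun k => ?_).1
    (hasSum_inner_apply (hasSum_partialTrace_pureState (I := I) ψ) x y)
  rw [InnerProductSpace.rankOne_apply, inner_smul_right, inner_ketOut_adjoint,
    ← inner_conj_symm, inner_ketOut_adjoint, mul_comm]

lemma isSelfAdjoint_partialTrace_pureState (ψ : Space L) :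
    IsSelfAdjoint (partialTrace I (pureState ψ)) := by
  rw [ContinuousLinearMap.isSelfAdjoint_iff_isSymmetric]
  intro x y
  have h1 := (inner_partialTrace_pureState ψ y x).star
  have h2 := inner_partialTrace_pureState ψ x y
  have h3 : ⟪partialTrace I (pureState ψ) x, y⟫_ℂ =
      star ⟪y, partialTrace I (pureState ψ) x⟫_ℂ := (inner_conj_symm _ _).symm
  refine h3.trans (h1.unique ((hasSum_congr fun k => ?_).1 h2))
  rw [star_mul', mul_comm, ← starRingEnd_apply, ← starRingEnd_apply, Complex.conj_conj]

/-- Parseval in the tracing basis collapses the sum to `sᵢ sⱼ ⟨bⱼ, bᵢ⟩`, so the Schmidt vectors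
diagonalise the reduced state. -/
lemma IsSchmidt.partialTrace_apply {ι : Type*} {ψ : Space L} {a : HilbertBasis ι ℂ (SpaceIn I)}
    {b : HilbertBasis ι ℂ (SpaceOut I)} {s : ι → ℝ} (h : IsSchmidt ψ a b s) (j : ι) :
    partialTrace I (pureState ψ) (a j) = ((s j ^ 2 : ℝ) : ℂ) • a j := by
  refine eq_of_forall_inner_hilbertBasis a fun i => ?_
  have h1 := inner_partialTrace_pureState ψ (a i) (a j)
  have h2 := ((stdBasis (SpaceOut I)).hasSum_inner_mul_inner (b j) (b i)).mul_left
    ((s i : ℂ) * s j)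
  have h3 : ⟪a i, partialTrace I (pureState ψ) (a j)⟫_ℂ = (s i * s j) * ⟪b j, b i⟫_ℂ := by
    refine h1.unique ((hasSum_congr fun k => ?_).1 h2)
    rw [h.inner_left, h.inner_left, map_mul, Complex.conj_ofReal, inner_conj_symm]
    ring
  rw [h3, inner_smul_right]
  by_cases hij : i = j
  · subst hij
    rw [inner_self_eq_norm_sq_to_K, inner_self_eq_norm_sq_to_K, b.orthonormal.1,
      a.orthonormal.1]
    push_cast
    ring
  · rw [b.orthonormal.2 (Ne.symm hij), a.orthonormal.2 hij, mul_zero, mul_zero]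

/-- For a pure state each term has rank one. Finite sums are bounded by the Hilbert–Schmidt norm of
their coefficients, which comes from Parseval for `ψ`. -/
lemma hasSum_partialTranspose_pureState (ψ : Space L) :
    HasSum (fun kl : basisIndex (SpaceIn I) × basisIndex (SpaceIn I) =>
      InnerProductSpace.rankOne ℂ
        (tensor I (stdBasis (SpaceIn I) kl.2) ((ketIn I (stdBasis (SpaceIn I) kl.1)).adjoint ψ))
        (tensor I (stdBasis (SpaceIn I) kl.1) ((ketIn I (stdBasis (SpaceIn I) kl.2)).adjoint ψ)))
      (partialTranspose I (pureState ψ)) := by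
  set f := stdBasis (SpaceIn I)
  have h1 : ∀ u v : SpaceIn I, ketIn I v ∘L ((ketIn I u).adjoint ∘L pureState ψ ∘L ketIn I v) ∘L
      (ketIn I u).adjoint = InnerProductSpace.rankOne ℂ (tensor I v ((ketIn I u).adjoint ψ))
        (tensor I u ((ketIn I v).adjoint ψ)) := by
    intro u v
    ext1 w
    simp only [pureState, ContinuousLinearMap.comp_apply, InnerProductSpace.rankOne_apply,
      map_smul, ketIn_apply]
    rw [← inner_conj_symm, ← inner_ketIn_adjoint, inner_conj_symm, inner_ketIn_adjoint]
  rw [partialTranspose]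
  simp only [h1]
  refine (summable_of_sq_norm_sum_le (w := fun p => (‖(ketIn I (f p.1)).adjoint ψ‖ *
    ‖(ketIn I (f p.2)).adjoint ψ‖) ^ 2) ?_ fun s => ?_).hasSum
  · exact summable_of_sum_le (fun _ => by positivity) fun s => sum_sq_mul_le_of_hasSum
      (hasSum_sq_norm_ketIn_adjoint f ψ) (hasSum_sq_norm_ketIn_adjoint f ψ) s
  · set W := ∑ p ∈ s, (‖(ketIn I (f p.1)).adjoint ψ‖ * ‖(ketIn I (f p.2)).adjoint ψ‖) ^ 2
    have hW : 0 ≤ W := Finset.sum_nonneg fun _ _ => by positivity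
    rw [← Real.le_sqrt (norm_nonneg _) hW]
    refine opNorm_le_of_inner_le (Real.sqrt_nonneg _) fun w u => ?_
    rw [sum_apply, inner_sum]
    -- The factors are regrouped so that Cauchy–Schwarz over the pairs separates `ψ` from the test
    -- vectors `w` and `u`.
    calc _ ≤ ∑ p ∈ s, (‖(ketIn I (f p.1)).adjoint ψ‖ * ‖(ketIn I (f p.2)).adjoint ψ‖) *
            (‖(ketIn I (f p.1)).adjoint w‖ * ‖(ketIn I (f p.2)).adjoint u‖) := by
            refine (norm_sum_le _ _).trans (Finset.sum_le_sum fun p _ => ?_)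
            rw [InnerProductSpace.rankOne_apply, inner_smul_right, norm_mul, norm_inner_symm u,
              ← inner_ketIn_adjoint, ← inner_ketIn_adjoint]
            have h3 := norm_inner_le_norm (𝕜 := ℂ) ((ketIn I (f p.2)).adjoint ψ)
              ((ketIn I (f p.1)).adjoint w)
            have h4 := norm_inner_le_norm (𝕜 := ℂ) ((ketIn I (f p.1)).adjoint ψ)
              ((ketIn I (f p.2)).adjoint u)
            refine (mul_le_mul h3 h4 (norm_nonneg _) (by positivity)).trans_eq ?_
            ring
      _ ≤ √W * √(∑ p ∈ s,
            (‖(ketIn I (f p.1)).adjoint w‖ * ‖(ketIn I (f p.2)).adjoint u‖) ^ 2) :=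
            Real.sum_mul_le_sqrt_mul_sqrt _ _ _
      _ ≤ √W * (‖w‖ * ‖u‖) := by
            refine mul_le_mul_of_nonneg_left ?_ (Real.sqrt_nonneg _)
            refine Real.sqrt_le_iff.2 ⟨by positivity, ?_⟩
            rw [mul_pow]
            exact sum_sq_mul_le_of_hasSum (hasSum_sq_norm_ketIn_adjoint f w)
              (hasSum_sq_norm_ketIn_adjoint f u) s

lemma inner_partialTranspose_pureState (ψ : Space L) (u u' : SpaceIn I) (v v' : SpaceOut I) :
    HasSum (fun kl : basisIndex (SpaceIn I) × basisIndex (SpaceIn I) =>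
      (⟪stdBasis (SpaceIn I) kl.1, u⟫_ℂ * ⟪tensor I (stdBasis (SpaceIn I) kl.1) v', ψ⟫_ℂ) *
      (⟪u', stdBasis (SpaceIn I) kl.2⟫_ℂ *
        starRingEnd ℂ ⟪tensor I (stdBasis (SpaceIn I) kl.2) v, ψ⟫_ℂ))
      ⟪tensor I u' v', partialTranspose I (pureState ψ) (tensor I u v)⟫_ℂ := by
  refine (hasSum_congr fun kl => ?_).1 (hasSum_inner_apply
    (hasSum_partialTranspose_pureState (I := I) ψ) (tensor I u' v') (tensor I u v))
  rw [InnerProductSpace.rankOne_apply, inner_smul_right, inner_tensor, inner_tensor,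
    inner_ketIn_adjoint, ← inner_ketIn_adjoint _ v, inner_conj_symm]
  ring

/-- In the basis `a'ᵢ ⊗ bⱼ`, with `a'ᵢ` the conjugate of `aᵢ`, the partial transpose sends the
vector `(i, j)` to `sᵢ sⱼ` times the vector `(j, i)`. Its absolute value is therefore diagonal with
entries `sᵢ sⱼ`, whose sum factorises. -/
lemma IsSchmidt.traceNorm_partialTranspose {ι : Type*} {ψ : Space L}
    {a : HilbertBasis ι ℂ (SpaceIn I)} {b : HilbertBasis ι ℂ (SpaceOut I)} {s : ι → ℝ}
    (h : IsSchmidt ψ a b s) :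
    traceNorm (partialTranspose I (pureState ψ)) = (∑' j, ENNReal.ofReal (s j)) ^ 2 := by
  classical
  obtain ⟨J, hJ, hJs, hJf⟩ := exists_antiunitary_of_hilbertBasis (stdBasis (SpaceIn I))
  obtain ⟨a', ha'⟩ := exists_hilbertBasis_of_antiunitary a hJ hJs
  obtain ⟨e, he⟩ := exists_hilbertBasis_tensor I a' b
  set T := partialTranspose I (pureState ψ)
  have hm : ∀ p q i j, ⟪e (p, q), T (e (i, j))⟫_ℂ =
      (s q * ⟪a i, a q⟫_ℂ) * (s j * ⟪a j, a p⟫_ℂ) := by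
    intro p q i j
    have h1 := inner_partialTranspose_pureState ψ (a' i) (a' p) (b j) (b q)
    rw [he, he]
    refine (h1.prod_fiberwise fun k => ?_).unique
      ((((stdBasis (SpaceIn I)).hasSum_inner_mul_inner (a i) (a q)).mul_left
        (s q : ℂ)).mul_right (s j * ⟪a j, a p⟫_ℂ))
    refine (hasSum_congr fun l => ?_).1
      ((((stdBasis (SpaceIn I)).hasSum_inner_mul_inner (a j) (a p)).mul_left (s j : ℂ)).mul_left
        (s q * (⟪a i, stdBasis (SpaceIn I) k⟫_ℂ * ⟪stdBasis (SpaceIn I) k, a q⟫_ℂ)))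
    rw [h.inner_right, h.inner_right, map_mul, Complex.conj_ofReal, inner_conj_symm, ha', ha',
      hJf, ← inner_conj_symm (J (a p)), hJf, inner_conj_symm]
    ring
  have hon := orthonormal_iff_ite.1 a.orthonormal
  have hoe := orthonormal_iff_ite.1 e.orthonormal
  have hT : ∀ i j, T (e (i, j)) = ((s i * s j : ℝ) : ℂ) • e (j, i) := by
    intro i j
    refine eq_of_forall_inner_hilbertBasis e fun p => ?_
    obtain ⟨p, q⟩ := p
    rw [hm, inner_smul_right, hoe, hon, hon]
    by_cases h1 : i = q <;> by_cases h2 : j = p <;> simp [h1, h2, eq_comm]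
  have hT' : ∀ i j, star T (e (i, j)) = ((s i * s j : ℝ) : ℂ) • e (j, i) := by
    intro i j
    refine eq_of_forall_inner_hilbertBasis e fun p => ?_
    obtain ⟨p, q⟩ := p
    rw [ContinuousLinearMap.star_eq_adjoint, ContinuousLinearMap.adjoint_inner_right, hT,
      inner_smul_left, inner_smul_right, hoe, hoe, Complex.conj_ofReal]
    by_cases h1 : i = q <;> by_cases h2 : j = p <;> simp [h1, h2, eq_comm, mul_comm]
  rw [traceNorm_eq_tsum_of_eigen e (t := fun p => s p.1 * s p.2)
    (fun p => mul_nonneg (h.nonneg _) (h.nonneg _))]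
  · rw [ENNReal.tsum_prod (f := fun i j => ENNReal.ofReal (s i * s j)), sq, ← ENNReal.tsum_mul_right]
    refine tsum_congr fun i => ?_
    rw [← ENNReal.tsum_mul_left]
    exact tsum_congr fun j => ENNReal.ofReal_mul (h.nonneg _)
  · rintro ⟨i, j⟩
    rw [mul_apply_eq_comp, hT, map_smul, hT', smul_smul]
    congr 1
    push_cast
    ring

lemma IsSchmidt.logNegativity_eq {ι : Type*} {ψ : Space L}
    {a : HilbertBasis ι ℂ (SpaceIn I)} {b : HilbertBasis ι ℂ (SpaceOut I)} {s : ι → ℝ}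
    (h : IsSchmidt ψ a b s) {τ : ℝ} (hτ : 0 < τ)
    (hs : ∑' j, ENNReal.ofReal (s j) = ENNReal.ofReal τ) :
    logNegativity I (pureState ψ) = ((2 * Real.logb 2 τ : ℝ) : EReal) := by
  rw [logNegativity, h.traceNorm_partialTranspose, hs, ← ENNReal.ofReal_pow hτ.le, log2,
    ENNReal.log_ofReal_of_pos (by positivity), ← EReal.coe_div, Real.log_pow, Real.logb]
  rw [← mul_div_assoc]
  norm_cast

/-- Jensen's inequality for the weights `sⱼ²` in the form `∑ sⱼ² log (1/sⱼ) ≤ log ∑ sⱼ`. It is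
proved termwise from `log y ≤ y - 1` at `y = 1/(sⱼ τ)`; the error terms `sⱼ/τ - sⱼ²` sum to `1 - 1 =
0`. -/
lemma IsSchmidt.vonNeumannEntropy_le {ι : Type*} {ψ : Space L}
    {a : HilbertBasis ι ℂ (SpaceIn I)} {b : HilbertBasis ι ℂ (SpaceOut I)} {s : ι → ℝ}
    (h : IsSchmidt ψ a b s) (hψ : ‖ψ‖ = 1) {τ : ℝ} (hτ : 0 < τ)
    (hs : ∑' j, ENNReal.ofReal (s j) = ENNReal.ofReal τ) :
    ((vonNeumannEntropy (partialTrace I (pureState ψ)) : ℝ≥0∞) : EReal) ≤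
      ((2 * Real.logb 2 τ : ℝ) : EReal) := by
  have hsq := h.hasSum_sq
  rw [hψ, one_pow] at hsq
  have hsum : HasSum s τ := by
    have hS : Summable s := by
      have := ENNReal.summable_toReal (f := fun j => ENNReal.ofReal (s j))
        (by rw [hs]; exact ENNReal.ofReal_ne_top)
      simpa [ENNReal.toReal_ofReal (h.nonneg _)] using this
    have h1 := hS.hasSum
    rw [← ENNReal.ofReal_tsum_of_nonneg h.nonneg hS,
      ENNReal.ofReal_eq_ofReal_iff (tsum_nonneg h.nonneg) hτ.le] at hs
    rwa [hs] at h1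
  have hle1 : ∀ j, s j ^ 2 ≤ 1 := fun j => le_hasSum hsq j fun _ _ => by positivity
  have hl2 : 0 < Real.log 2 := Real.log_pos one_lt_two
  have hη0 : ∀ j, 0 ≤ -(s j ^ 2 * Real.logb 2 (s j ^ 2)) := fun j => by
    rw [neg_nonneg]
    exact mul_nonpos_of_nonneg_of_nonpos (by positivity)
      (Real.logb_nonpos one_lt_two (by positivity) (hle1 j))
  have hη : ∀ j, -(s j ^ 2 * Real.logb 2 (s j ^ 2)) ≤
      2 / Real.log 2 * (s j ^ 2 * Real.log τ + (s j / τ - s j ^ 2)) := fun j => by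
    rcases (h.nonneg j).eq_or_lt with h0 | h0
    · simp [← h0]
    have h1 := Real.log_le_sub_one_of_pos (x := (s j * τ)⁻¹) (by positivity)
    rw [Real.log_inv, Real.log_mul h0.ne' hτ.ne'] at h1
    have h2 : s j ^ 2 * -Real.log (s j) ≤ s j ^ 2 * Real.log τ + (s j / τ - s j ^ 2) := by
      have h3 := mul_le_mul_of_nonneg_left h1 (sq_nonneg (s j))
      have h4 : s j ^ 2 * ((s j * τ)⁻¹ - 1) = s j / τ - s j ^ 2 := by
        field_simp
      rw [h4] at h3
      linarith
    rw [Real.logb, Real.log_pow]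
    calc _ = 2 / Real.log 2 * (s j ^ 2 * -Real.log (s j)) := by push_cast; ring
      _ ≤ _ := by gcongr
  have hR : HasSum (fun j => 2 / Real.log 2 * (s j ^ 2 * Real.log τ + (s j / τ - s j ^ 2)))
      (2 * Real.logb 2 τ) := by
    have h1 := ((hsq.mul_right (Real.log τ)).add ((hsum.div_const τ).sub hsq)).mul_left
      (2 / Real.log 2)
    have h2 : 2 / Real.log 2 * (1 * Real.log τ + (τ / τ - 1)) = 2 * Real.logb 2 τ := by
      rw [div_self hτ.ne', ← Real.log_div_log]
      ring
    rwa [h2] at h1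
  have hη' : Summable fun j => -(s j ^ 2 * Real.logb 2 (s j ^ 2)) :=
    Summable.of_nonneg_of_le hη0 hη hR.summable
  rw [vonNeumannEntropy_eq_tsum_of_eigen a (isSelfAdjoint_partialTrace_pureState ψ)
    (p := fun j => s j ^ 2) (fun j => by positivity) hle1 h.partialTrace_apply,
    ← ENNReal.ofReal_tsum_of_nonneg hη0 hη', EReal.coe_ennreal_ofReal,
    max_eq_left (tsum_nonneg hη0)]
  exact_mod_cast hasSum_le hη hη'.hasSum hR

end Schmidt

/-! ## Schmidt decomposition of a positive kernel -/

section Kernel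

variable {α T : Type*} [MeasurableSpace α] [MeasurableSpace T] {μ : Measure α} {ν : Measure T}
  [SigmaFinite μ] [SigmaFinite ν]

lemma integral_norm_mul_le {u : α → ℂ} (hu : MemLp u 2 μ) {g : α → ℝ} (hg : MemLp g 2 μ) :
    ∫ x, ‖u x * g x‖ ∂μ ≤ √(∫ x, ‖u x‖ ^ 2 ∂μ) * √(∫ x, g x ^ 2 ∂μ) := by
  have h := integral_mul_le_Lp_mul_Lq_of_nonneg (μ := μ) (f := fun x => ‖u x‖)
    (g := fun x => ‖g x‖) Real.HolderConjugate.two_two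
    (Filter.Eventually.of_forall fun _ => norm_nonneg _)
    (Filter.Eventually.of_forall fun _ => norm_nonneg _)
    (by simpa using hu.norm) (by simpa using hg.norm)
  rw [Real.sqrt_eq_rpow, Real.sqrt_eq_rpow]
  simpa using h

lemma integrable_ofReal_mul {u : α → ℂ} (hu : MemLp u 2 μ) {g : α → ℝ} (hg : MemLp g 2 μ) :
    Integrable (fun x => u x * (g x : ℂ)) μ :=
  hu.integrable_mul (hg.ofReal (K := ℂ))

/-- Fubini applies because Cauchy–Schwarz bounds the inner integral of the norm by `‖u‖ ‖v‖ ‖g_t‖²`,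
which is integrable in `t`. -/
lemma integral_prod_kernel {g : T → α → ℝ} (hg : Measurable (Function.uncurry g))
    (hg2 : ∀ t, MemLp (g t) 2 μ) (hfin : Integrable (fun t => ∫ x, g t x ^ 2 ∂μ) ν)
    {u v : α → ℂ} (hu : MemLp u 2 μ) (hv : MemLp v 2 μ)
    (hum : StronglyMeasurable u) (hvm : StronglyMeasurable v) :
    ∫ z : α × α, u z.1 * v z.2 * ((∫ t, g t z.1 * g t z.2 ∂ν : ℝ) : ℂ) ∂(μ.prod μ) =
      ∫ t, (∫ x, u x * g t x ∂μ) * (∫ x, v x * g t x ∂μ) ∂ν := by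
  have hg1 : Measurable fun p : (α × α) × T => g p.2 p.1.1 :=
    hg.comp (measurable_snd.prodMk (measurable_fst.comp measurable_fst))
  have hg3 : Measurable fun p : (α × α) × T => g p.2 p.1.2 :=
    hg.comp (measurable_snd.prodMk (measurable_snd.comp measurable_fst))
  have hm : StronglyMeasurable fun p : (α × α) × T =>
      (u p.1.1 * g p.2 p.1.1) * (v p.1.2 * g p.2 p.1.2) := by
    refine StronglyMeasurable.mul (StronglyMeasurable.mul ?_ ?_) (StronglyMeasurable.mul ?_ ?_)
    · exact hum.comp_measurable (measurable_fst.comp measurable_fst)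
    · exact (Complex.measurable_ofReal.comp hg1).stronglyMeasurable
    · exact hvm.comp_measurable (measurable_snd.comp measurable_fst)
    · exact (Complex.measurable_ofReal.comp hg3).stronglyMeasurable
  have hint : Integrable (fun p : (α × α) × T =>
      (u p.1.1 * g p.2 p.1.1) * (v p.1.2 * g p.2 p.1.2)) ((μ.prod μ).prod ν) := by
    rw [integrable_prod_iff' hm.aestronglyMeasurable]
    refine ⟨Filter.Eventually.of_forall fun t =>
      (integrable_ofReal_mul hu (hg2 t)).mul_prod (integrable_ofReal_mul hv (hg2 t)), ?_⟩
    refine (hfin.const_mul (√(∫ x, ‖u x‖ ^ 2 ∂μ) * √(∫ x, ‖v x‖ ^ 2 ∂μ))).mono' ?_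
      (Filter.Eventually.of_forall fun t => ?_)
    · exact (hm.norm.integral_prod_left').aestronglyMeasurable
    · rw [Real.norm_of_nonneg (integral_nonneg fun _ => norm_nonneg _)]
      simp only [norm_mul (_ * _)]
      rw [integral_prod_mul (fun x => ‖u x * (g t x : ℂ)‖) (fun x => ‖v x * (g t x : ℂ)‖)]
      have h1 := integral_norm_mul_le hu (hg2 t)
      have h2 := integral_norm_mul_le hv (hg2 t)
      refine (mul_le_mul h1 h2 (integral_nonneg fun _ => norm_nonneg _)
        (by positivity)).trans_eq ?_
      have h3 := Real.mul_self_sqrt (integral_nonneg (μ := μ) fun x => sq_nonneg (g t x))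
      linear_combination √(∫ x, ‖u x‖ ^ 2 ∂μ) * √(∫ x, ‖v x‖ ^ 2 ∂μ) * h3
  have h1 := integral_integral_swap (f := fun (z : α × α) t =>
    (u z.1 * g t z.1) * (v z.2 * g t z.2)) hint
  calc _ = ∫ z : α × α, ∫ t, (u z.1 * g t z.1) * (v z.2 * g t z.2) ∂ν ∂(μ.prod μ) := by
        refine integral_congr_ae (Filter.Eventually.of_forall fun z => ?_)
        simp only
        rw [← integral_complex_ofReal, ← integral_const_mul]
        refine integral_congr_ae (Filter.Eventually.of_forall fun t => ?_)
        push_cast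
        ring
    _ = _ := by
        rw [h1]
        refine integral_congr_ae (Filter.Eventually.of_forall fun t => ?_)
        exact integral_prod_mul (fun x => u x * (g t x : ℂ)) fun x => v x * (g t x : ℂ)

end Kernel

section Star

variable {α : Type*} [MeasurableSpace α] {μ : Measure α}

lemma inner_star_star (u v : Lp ℂ 2 μ) : ⟪star u, star v⟫_ℂ = ⟪v, u⟫_ℂ := by
  rw [L2.inner_def, L2.inner_def]
  refine integral_congr_ae ?_
  filter_upwards [Lp.coeFn_star u, Lp.coeFn_star v] with x hu hv
  rw [hu, hv]
  simp [mul_comm]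

lemma star_add_Lp (u v : Lp ℂ 2 μ) : star (u + v) = star u + star v := by
  ext1
  filter_upwards [Lp.coeFn_star u, Lp.coeFn_star v, Lp.coeFn_star (u + v), Lp.coeFn_add u v,
    Lp.coeFn_add (star u) (star v)] with x h1 h2 h3 h4 h5
  rw [h3, h5, Pi.star_apply, h4, Pi.add_apply, Pi.add_apply, h1, h2, star_add]
  rfl

lemma star_smul_Lp (c : ℂ) (u : Lp ℂ 2 μ) : star (c • u) = star c • star u := by
  ext1
  filter_upwards [Lp.coeFn_star u, Lp.coeFn_star (c • u), Lp.coeFn_smul c u,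
    Lp.coeFn_smul (star c) (star u)] with x h1 h2 h3 h4
  rw [h2, h4, Pi.star_apply, h3, Pi.smul_apply, Pi.smul_apply, h1, star_smul]
  rfl

end Star

section Positive

variable {L : Type} [Fintype L] [DecidableEq L] {I : Finset L}

/-- The operator on `L²(ℝ^I)` whose kernel is `ψ`, after conjugating one tensor factor and
identifying the other with `L²(ℝ^I)` through `V`. -/
noncomputable def kernelOp (V : SpaceIn I →ₗᵢ[ℂ] SpaceOut I) (ψ : Space L) : SpaceIn I →L[ℂ] SpaceIn I :=
  LinearMap.mkContinuous
    { toFun := fun u => V.toContinuousLinearMap.adjoint ((ketIn I (star u)).adjoint ψ)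
      map_add' := fun u v => by
        refine ext_inner_left ℂ fun w => ?_
        rw [inner_add_right]
        simp only [ContinuousLinearMap.adjoint_inner_right, star_add_Lp, ketIn_apply]
        rw [← inner_add_left]
        congr 1
        exact (tensorBilin I).map_add₂ _ _ _
      map_smul' := fun c u => by
        refine ext_inner_left ℂ fun w => ?_
        rw [RingHom.id_apply, inner_smul_right]
        simp only [ContinuousLinearMap.adjoint_inner_right, star_smul_Lp, ketIn_apply]
        have : tensor I (star c • star u) (V.toContinuousLinearMap w) =
            star c • tensor I (star u) (V.toContinuousLinearMap w) :=
          (tensorBilin I).map_smul₂ _ _ _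
        rw [this, inner_smul_left, ← starRingEnd_apply, Complex.conj_conj] } ‖ψ‖ fun u => by
    have hu : ‖star u‖ = ‖u‖ := by
      rw [@norm_eq_sqrt_re_inner ℂ, inner_star_star, ← @norm_eq_sqrt_re_inner ℂ]
    have h1 := V.toContinuousLinearMap.adjoint.le_opNorm ((ketIn I (star u)).adjoint ψ)
    have h2 := (ketIn I (star u)).adjoint.le_opNorm ψ
    rw [LinearIsometryEquiv.norm_map] at h1 h2
    have h3 : ‖V.toContinuousLinearMap‖ ≤ 1 := V.norm_toContinuousLinearMap_le
    have h4 : ‖ketIn I (star u)‖ ≤ ‖u‖ := by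
      rw [← hu]
      exact LinearMap.mkContinuous_norm_le _ (norm_nonneg _) _
    refine h1.trans ?_
    calc _ ≤ 1 * ‖(ketIn I (star u)).adjoint ψ‖ := by gcongr
      _ ≤ ‖ketIn I (star u)‖ * ‖ψ‖ := by rw [one_mul]; exact h2
      _ ≤ _ := by rw [mul_comm]; gcongr

lemma kernelOp_apply (V : SpaceIn I →ₗᵢ[ℂ] SpaceOut I) (ψ : Space L) (u : SpaceIn I) :
    kernelOp V ψ u = V.toContinuousLinearMap.adjoint ((ketIn I (star u)).adjoint ψ) := rfl

lemma inner_kernelOp (V : SpaceIn I →ₗᵢ[ℂ] SpaceOut I) (ψ : Space L) (u v : SpaceIn I) :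
    ⟪v, kernelOp V ψ u⟫_ℂ = ⟪tensor I (star u) (V v), ψ⟫_ℂ := by
  rw [kernelOp_apply, ContinuousLinearMap.adjoint_inner_right, inner_ketIn_adjoint]
  rfl

/-- An operator with square-integrable kernel is Hilbert–Schmidt. The conjugate of a basis is again
a basis, so Parseval for `ψ` applies to it. -/
lemma isCompactOperator_kernelOp (V : SpaceIn I →ₗᵢ[ℂ] SpaceOut I) (ψ : Space L) :
    IsCompactOperator (kernelOp V ψ) := by
  obtain ⟨f, hf⟩ := exists_hilbertBasis_of_antiunitary (stdBasis (SpaceIn I))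
    (inner_star_star (μ := volume)) star_involutive.surjective
  refine isCompactOperator_of_summable_sq (stdBasis (SpaceIn I)) ?_
  refine Summable.of_nonneg_of_le (fun _ => by positivity) (fun k => ?_)
    (hasSum_sq_norm_ketIn_adjoint f ψ).summable
  have h1 := V.toContinuousLinearMap.adjoint.le_opNorm ((ketIn I (f k)).adjoint ψ)
  rw [LinearIsometryEquiv.norm_map] at h1
  have h3 : ‖V.toContinuousLinearMap‖ ≤ 1 := V.norm_toContinuousLinearMap_le
  rw [kernelOp_apply, ← hf]
  gcongr
  refine h1.trans ?_
  calc _ ≤ 1 * ‖(ketIn I (f k)).adjoint ψ‖ := by gcongr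
    _ = _ := one_mul _

/-- A positive kernel `∫ g_t ⊗ g_t dt` has a Schmidt decomposition whose coefficients sum up to
its trace. -/
lemma exists_isSchmidt_of_kernel {T : Type*} [MeasurableSpace T] {ν : Measure T} [SigmaFinite ν]
    {V : SpaceIn I ≃ₗᵢ[ℂ] SpaceOut I} {ψ : Space L} {G : T → SpaceIn I}
    (hGm : ∀ u : SpaceIn I, AEStronglyMeasurable (fun t => ⟪u, G t⟫_ℂ) ν)
    (hG2 : Integrable (fun t => ‖G t‖ ^ 2) ν)
    (hψ : ∀ u v, ⟪tensor I (star u) (V v), ψ⟫_ℂ = ∫ t, ⟪G t, u⟫_ℂ * ⟪v, G t⟫_ℂ ∂ν) :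
    ∃ (ι : Type) (a : HilbertBasis ι ℂ (SpaceIn I)) (b : HilbertBasis ι ℂ (SpaceOut I))
      (s : ι → ℝ), IsSchmidt ψ a b s ∧
        ∑' j, ENNReal.ofReal (s j) = ENNReal.ofReal (∫ t, ‖G t‖ ^ 2 ∂ν) := by
  have hK : ∀ u v, ⟪v, kernelOp V.toLinearIsometry ψ u⟫_ℂ = ∫ t, ⟪G t, u⟫_ℂ * ⟪v, G t⟫_ℂ ∂ν :=
    fun u v => by rw [inner_kernelOp, ← hψ]; rfl
  have hsymm : (kernelOp V.toLinearIsometry ψ).IsSymmetric := by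
    intro u v
    have h1 : ⟪kernelOp V.toLinearIsometry ψ u, v⟫_ℂ =
        starRingEnd ℂ ⟪v, kernelOp V.toLinearIsometry ψ u⟫_ℂ := (inner_conj_symm _ _).symm
    refine h1.trans ?_
    rw [hK, ← integral_conj]
    refine Eq.trans ?_ (hK v u).symm
    refine integral_congr_ae (Filter.Eventually.of_forall fun t => ?_)
    simp only [map_mul, inner_conj_symm, mul_comm]
  obtain ⟨ι, e, m, he⟩ := exists_hilbertBasis_eigen (isCompactOperator_kernelOp _ ψ) hsymm
  have : Fact ((2 : ℝ≥0∞) ≠ ∞) := ⟨ENNReal.ofNat_ne_top⟩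
  have hc : Countable ι := countable_of_hilbertBasis e
  obtain ⟨a, ha⟩ := exists_hilbertBasis_of_antiunitary e
    (inner_star_star (μ := volume)) star_involutive.surjective
  have hVe : Orthonormal ℂ fun i => V (e i) := e.orthonormal.comp_linearIsometryEquiv V
  obtain ⟨b, hb⟩ := exists_hilbertBasis_coe_eq hVe fun x hx => by
    have : V.symm x = 0 := eq_of_forall_inner_hilbertBasis e fun i => by
      rw [inner_zero_right, ← hx i, ← V.inner_map_map, V.apply_symm_apply]
    simpa using this
  -- The diagonal matrix elements show that the eigenvalues are integrals of squares. They are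
  -- nonnegative, so they can be the Schmidt coefficients themselves, without absolute values or
  -- phases.
  have hm : ∀ j, m j = ((∫ t, ‖⟪e j, G t⟫_ℂ‖ ^ 2 ∂ν : ℝ) : ℂ) := by
    intro j
    have h1 := hK (e j) (e j)
    rw [he, inner_smul_right, inner_self_eq_norm_sq_to_K, e.orthonormal.1] at h1
    rw [← integral_complex_ofReal]
    simp only [RCLike.ofReal_one, one_pow, mul_one] at h1
    rw [h1]
    refine integral_congr_ae (Filter.Eventually.of_forall fun t => ?_)
    simp only
    rw [← inner_conj_symm (G t), mul_comm, RCLike.mul_conj]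
    push_cast
    rfl
  have hint : ∀ j, Integrable (fun t => ‖⟪e j, G t⟫_ℂ‖ ^ 2) ν := fun j => by
    refine hG2.mono' ((hGm (e j)).norm.pow 2) (Filter.Eventually.of_forall fun t => ?_)
    rw [Real.norm_of_nonneg (by positivity)]
    have := norm_inner_le_norm (𝕜 := ℂ) (e j) (G t)
    rw [e.orthonormal.1, one_mul] at this
    gcongr
  refine ⟨ι, a, b, fun j => ∫ t, ‖⟪e j, G t⟫_ℂ‖ ^ 2 ∂ν, ⟨?_, ?_, ?_⟩, ?_⟩
  · exact fun j => integral_nonneg fun t => by positivity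
  · intro j
    have h1 := inner_kernelOp V.toLinearIsometry ψ (e j) (e j)
    rw [he, inner_smul_right, inner_self_eq_norm_sq_to_K, e.orthonormal.1] at h1
    rw [ha, hb, ← hm]
    simpa using h1.symm
  · intro j k hjk
    have h1 := inner_kernelOp V.toLinearIsometry ψ (e j) (e k)
    rw [he, inner_smul_right, e.orthonormal.2 (Ne.symm hjk), mul_zero] at h1
    rw [ha, hb]
    exact h1.symm
  -- The trace: the sum over `j` goes under the integral and Parseval turns it into `‖G t‖ ^ 2`.
  · calc _ = ∑' j, ∫⁻ t, ENNReal.ofReal (‖⟪e j, G t⟫_ℂ‖ ^ 2) ∂ν :=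
          tsum_congr fun j => ofReal_integral_eq_lintegral_ofReal (hint j)
            (Filter.Eventually.of_forall fun t => by positivity)
      _ = ∫⁻ t, ∑' j, ENNReal.ofReal (‖⟪e j, G t⟫_ℂ‖ ^ 2) ∂ν :=
          (lintegral_tsum fun j => (hint j).aestronglyMeasurable.aemeasurable.ennreal_ofReal).symm
      _ = ∫⁻ t, ENNReal.ofReal (‖G t‖ ^ 2) ∂ν :=
          lintegral_congr fun t => tsum_ofReal_sq_norm_inner e (G t)
      _ = _ := (ofReal_integral_eq_lintegral_ofReal hG2
            (Filter.Eventually.of_forall fun t => by positivity)).symm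

end Positive

/-! ## Gaussians are Schwartz functions -/

section Gaussian

open scoped Matrix ContDiff

lemma exists_bound_pow_mul_exp_neg_sq {c : ℝ} (hc : 0 < c) (m : ℕ) :
    ∃ C, ∀ r : ℝ, 0 ≤ r → (1 + r) ^ m * Real.exp (-(c * r ^ 2)) ≤ C := by
  -- From `(1 + r)^m ≤ m! e^{1 + r}` and the maximum `1/(4c)` of `r - c r²`.
  refine ⟨m.factorial * Real.exp (1 + 1 / (4 * c)), fun r hr => ?_⟩
  have h1 := Real.pow_div_factorial_le_exp (1 + r) (by positivity) m
  rw [div_le_iff₀ (by positivity)] at h1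
  calc _ ≤ Real.exp (1 + r) * m.factorial * Real.exp (-(c * r ^ 2)) := by gcongr
    _ = m.factorial * Real.exp (1 + r + -(c * r ^ 2)) := by rw [Real.exp_add _ (-(c * r ^ 2))]; ring
    _ ≤ _ := by
      refine mul_le_mul_of_nonneg_left (Real.exp_le_exp.2 ?_) (by positivity)
      have : 0 ≤ c * (r - 1 / (2 * c)) ^ 2 := by positivity
      have h2 : c * (r - 1 / (2 * c)) ^ 2 = c * r ^ 2 - r + 1 / (4 * c) := by
        field_simp; ring
      linarith

lemma norm_iteratedFDeriv_ofReal_exp (n : ℕ) (t : ℝ) :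
    ‖iteratedFDeriv ℝ n (fun t : ℝ => (Real.exp t : ℂ)) t‖ = Real.exp t := by
  have h := Complex.ofRealLI.norm_iteratedFDeriv_comp_left (x := t)
    (Real.contDiff_exp (n := n)).contDiffAt le_rfl
  have h2 : (fun t : ℝ => (Real.exp t : ℂ)) = Complex.ofRealLI ∘ Real.exp := rfl
  rw [h2, h, norm_iteratedFDeriv_eq_norm_iteratedDeriv, iteratedDeriv_eq_iterate,
    Real.iter_deriv_exp, Real.norm_of_nonneg (Real.exp_pos t).le]

/-- By the Faà di Bruno bound, each derivative of `exp ∘ f` is at most `exp ∘ f` times a power of `1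
+ ‖x‖`, and the Gaussian decay absorbs all such powers. -/
lemma exists_schwartzMap_exp {E : Type*} [NormedAddCommGroup E] [NormedSpace ℝ E] {f : E → ℝ}
    (hf : Function.HasTemperateGrowth f) {c C : ℝ} (hc : 0 < c)
    (hb : ∀ x, f x ≤ C - c * ‖x‖ ^ 2) : ∃ φ : 𝓢(E, ℂ), ∀ x, φ x = (Real.exp (f x) : ℂ) := by
  have hg : ContDiff ℝ ∞ fun t : ℝ => (Real.exp t : ℂ) :=
    Complex.ofRealCLM.contDiff.comp Real.contDiff_exp
  refine ⟨⟨fun x => (Real.exp (f x) : ℂ), hg.comp hf.1, fun k n => ?_⟩, fun x => rfl⟩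
  obtain ⟨l, B, hB, hl⟩ := hf.norm_iteratedFDeriv_le_uniform n
  obtain ⟨M, hM⟩ := exists_bound_pow_mul_exp_neg_sq hc (k + l * n)
  refine ⟨n.factorial * (1 + B) ^ n * Real.exp C * M, fun x => ?_⟩
  have hx := norm_nonneg x
  have h1 := norm_iteratedFDeriv_comp_le (N := ∞) hg hf.1 (mod_cast le_top) x
    -- The bound on the `i`-th derivative has to be `D ^ i`; `1 + B` in place of `B` ensures `1 ≤
    -- D`, hence `D ≤ D ^ i`.
    (C := Real.exp (f x)) (D := (1 + B) * (1 + ‖x‖) ^ l)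
    (fun i _ => (norm_iteratedFDeriv_ofReal_exp i (f x)).le) fun i hi hin => by
      have h2 : 1 ≤ (1 + B) * (1 + ‖x‖) ^ l := by
        have := one_le_pow₀ (n := l) (show 1 ≤ 1 + ‖x‖ by linarith)
        nlinarith
      refine (hl i hin x).trans ?_
      calc B * (1 + ‖x‖) ^ l ≤ (1 + B) * (1 + ‖x‖) ^ l := by gcongr; linarith
        _ ≤ _ := le_self_pow₀ h2 (by omega)
  calc ‖x‖ ^ k * _ ≤ (1 + ‖x‖) ^ k *
        (n.factorial * Real.exp (C - c * ‖x‖ ^ 2) * ((1 + B) * (1 + ‖x‖) ^ l) ^ n) := by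
        gcongr
        · linarith
        · refine h1.trans ?_
          gcongr
          exact hb x
    _ = n.factorial * (1 + B) ^ n * Real.exp C *
        ((1 + ‖x‖) ^ (k + l * n) * Real.exp (-(c * ‖x‖ ^ 2))) := by
        rw [sub_eq_add_neg, Real.exp_add, mul_pow, ← pow_mul, pow_add]
        ring
    _ ≤ _ := by
        gcongr
        exact hM _ hx

variable {L : Type*} [Fintype L]

lemma hasTemperateGrowth_coord (i : L) : Function.HasTemperateGrowth fun x : L → ℝ => x i :=
  (ContinuousLinearMap.proj (R := ℝ) (φ := fun _ : L => ℝ) i).hasTemperateGrowth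

lemma hasTemperateGrowth_dotProduct (v : L → ℝ) :
    Function.HasTemperateGrowth fun x : L → ℝ => x ⬝ᵥ v :=
  Function.HasTemperateGrowth.sum fun i _ =>
    (hasTemperateGrowth_coord i).mul (Function.HasTemperateGrowth.const (v i))

lemma hasTemperateGrowth_quadratic (A : Matrix L L ℝ) :
    Function.HasTemperateGrowth fun x : L → ℝ => x ⬝ᵥ A *ᵥ x :=
  Function.HasTemperateGrowth.sum fun i _ => (hasTemperateGrowth_coord i).mul
    (Function.HasTemperateGrowth.sum fun j _ =>
      (Function.HasTemperateGrowth.const (A i j)).mul (hasTemperateGrowth_coord j))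

lemma exists_pos_le_quadratic {A : Matrix L L ℝ} (hA : ∀ x, x ≠ 0 → 0 < x ⬝ᵥ A *ᵥ x) :
    ∃ c > 0, ∀ x, c * ‖x‖ ^ 2 ≤ x ⬝ᵥ A *ᵥ x := by
  have hcont : Continuous fun x : L → ℝ => x ⬝ᵥ A *ᵥ x := by
    simp only [dotProduct, Matrix.mulVec]
    fun_prop
  rcases (Metric.sphere (0 : L → ℝ) 1).eq_empty_or_nonempty with hS | hS
  -- The unit sphere is empty only if there are no coordinates, and then the sole vector is zero.
  · refine ⟨1, one_pos, fun x => ?_⟩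
    have hx : x = 0 := by
      by_contra hx
      have : ‖x‖⁻¹ • x ∈ Metric.sphere (0 : L → ℝ) 1 := by
        rw [mem_sphere_zero_iff_norm, norm_smul, norm_inv, norm_norm,
          inv_mul_cancel₀ (norm_ne_zero_iff.2 hx)]
      rw [hS] at this
      exact this
    simp [hx]
  · obtain ⟨y, hy, hmin⟩ := (isCompact_sphere (0 : L → ℝ) 1).exists_isMinOn hS hcont.continuousOn
    rw [mem_sphere_zero_iff_norm] at hy
    refine ⟨y ⬝ᵥ A *ᵥ y, hA y (by rintro rfl; simp at hy), fun x => ?_⟩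
    by_cases hx : x = 0
    · simp [hx]
    have hx' : 0 < ‖x‖ := norm_pos_iff.2 hx
    have h1 : ‖x‖⁻¹ • x ∈ Metric.sphere (0 : L → ℝ) 1 := by
      rw [mem_sphere_zero_iff_norm, norm_smul, norm_inv, norm_norm, inv_mul_cancel₀ hx'.ne']
    have h2 := hmin h1
    simp only [Set.mem_ofPred_eq, Matrix.mulVec_smul, dotProduct_smul, smul_dotProduct,
      smul_eq_mul] at h2
    calc _ ≤ (‖x‖⁻¹ * (‖x‖⁻¹ * (x ⬝ᵥ A *ᵥ x))) * ‖x‖ ^ 2 := by gcongr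
      _ = _ := by field_simp

lemma exists_schwartzMap_gaussian {A : Matrix L L ℝ} (hA : ∀ x, x ≠ 0 → 0 < x ⬝ᵥ A *ᵥ x)
    (v : L → ℝ) (r : ℝ) :
    ∃ φ : 𝓢(L → ℝ, ℂ), ∀ x, φ x = (Real.exp (-(1 / 2) * (x ⬝ᵥ A *ᵥ x) + x ⬝ᵥ v + r) : ℂ) := by
  obtain ⟨c, hc, hcA⟩ := exists_pos_le_quadratic hA
  set M := ∑ i, ‖v i‖
  have hM : ∀ x : L → ℝ, x ⬝ᵥ v ≤ ‖x‖ * M := fun x => by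
    rw [dotProduct, Finset.mul_sum]
    refine Finset.sum_le_sum fun i _ => ?_
    calc x i * v i ≤ ‖x i * v i‖ := Real.le_norm_self _
      _ = ‖x i‖ * ‖v i‖ := norm_mul _ _
      _ ≤ _ := by gcongr; exact norm_le_pi_norm x i
  -- Half of the decay `c/2` absorbs the linear term: `‖x‖ M ≤ (c/4) ‖x‖² + M²/c`.
  refine exists_schwartzMap_exp (c := c / 4) (C := M ^ 2 / c + r) ?_ (by positivity) fun x => ?_
  · exact (((Function.HasTemperateGrowth.const _).mul (hasTemperateGrowth_quadratic A)).add
      (hasTemperateGrowth_dotProduct v)).add (Function.HasTemperateGrowth.const r)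
  · have h1 := hcA x
    have h2 := hM x
    have h3 : 0 ≤ (c / 2 * ‖x‖ - M) ^ 2 / c := by positivity
    have h4 : (c / 2 * ‖x‖ - M) ^ 2 / c = c / 4 * ‖x‖ ^ 2 - ‖x‖ * M + M ^ 2 / c := by
      field_simp; ring
    nlinarith

end Gaussian

/-! ## Ladder operators -/

section Ladder

open scoped Matrix

variable {L : Type} [Fintype L] [DecidableEq L]

/-- A Schwartz function as a vector of the Hilbert space. -/
noncomputable abbrev toSpace : 𝓢(L → ℝ, ℂ) →L[ℂ] Space L :=
  SchwartzMap.toLpCLM ℂ ℂ 2 (volume : Measure (L → ℝ))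

/-- The partial derivative `∂ᵢ` on Schwartz functions. -/
noncomputable def partialDeriv (i : L) : 𝓢(L → ℝ, ℂ) →L[ℂ] 𝓢(L → ℝ, ℂ) :=
  LineDeriv.lineDerivOpCLM ℂ 𝓢(L → ℝ, ℂ) (Pi.single i (1 : ℝ) : L → ℝ)

/-- Multiplication of Schwartz functions by the linear form `x ↦ (A x)ᵢ`. -/
noncomputable def mulRow (A : Matrix L L ℝ) (i : L) : 𝓢(L → ℝ, ℂ) →L[ℂ] 𝓢(L → ℝ, ℂ) :=
  ∑ j, (A i j : ℂ) • position j

/-- The annihilation operator `∂ᵢ + (A x)ᵢ`. -/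
noncomputable def annihilation (A : Matrix L L ℝ) (i : L) : 𝓢(L → ℝ, ℂ) →L[ℂ] 𝓢(L → ℝ, ℂ) :=
  partialDeriv i + mulRow A i

/-- The creation operator `-∂ᵢ + (A x)ᵢ`. -/
noncomputable def creation (A : Matrix L L ℝ) (i : L) : 𝓢(L → ℝ, ℂ) →L[ℂ] 𝓢(L → ℝ, ℂ) :=
  -partialDeriv i + mulRow A i

lemma partialDeriv_apply (i : L) (f : 𝓢(L → ℝ, ℂ)) (x : L → ℝ) :
    partialDeriv i f x = fderiv ℝ f x (Pi.single i 1) :=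
  SchwartzMap.lineDerivOp_apply_eq_fderiv _ f x

lemma mulRow_apply (A : Matrix L L ℝ) (i : L) (f : 𝓢(L → ℝ, ℂ)) (x : L → ℝ) :
    mulRow A i f x = (((A *ᵥ x) i : ℝ) : ℂ) * f x := by
  simp only [mulRow, sum_apply, smul_apply, position_apply, Matrix.mulVec, dotProduct]
  push_cast
  rw [Finset.sum_mul]
  simp only [smul_eq_mul, mul_assoc]

lemma annihilation_apply (A : Matrix L L ℝ) (i : L) (f : 𝓢(L → ℝ, ℂ)) (x : L → ℝ) :
    annihilation A i f x = fderiv ℝ f x (Pi.single i 1) + (((A *ᵥ x) i : ℝ) : ℂ) * f x := by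
  rw [annihilation, add_apply, add_apply, partialDeriv_apply, mulRow_apply]

lemma creation_apply (A : Matrix L L ℝ) (i : L) (f : 𝓢(L → ℝ, ℂ)) (x : L → ℝ) :
    creation A i f x = -fderiv ℝ f x (Pi.single i 1) + (((A *ᵥ x) i : ℝ) : ℂ) * f x := by
  rw [creation, add_apply, add_apply, neg_apply, neg_apply,
    partialDeriv_apply, mulRow_apply]

lemma inner_toSpace (f g : 𝓢(L → ℝ, ℂ)) :
    ⟪toSpace f, toSpace g⟫_ℂ = ∫ x, starRingEnd ℂ (f x) * g x := by
  refine (SchwartzMap.inner_toL2_toL2_eq f g volume).trans ?_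
  simp only [RCLike.inner_apply, mul_comm]

lemma inner_partialDeriv (i : L) (f g : 𝓢(L → ℝ, ℂ)) :
    ⟪toSpace (partialDeriv i f), toSpace g⟫_ℂ = -⟪toSpace f, toSpace (partialDeriv i g)⟫_ℂ := by
  rw [inner_toSpace, inner_toSpace]
  have h := SchwartzMap.integral_bilinear_lineDerivOp_right_eq_neg_left (μ := volume) f g
    ((ContinuousLinearMap.mul ℝ ℂ).comp Complex.conjCLE.toContinuousLinearMap)
    (Pi.single i (1 : ℝ) : L → ℝ)
  rw [eq_neg_iff_add_eq_zero, add_comm, ← eq_neg_iff_add_eq_zero]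
  exact h

lemma inner_mulRow (A : Matrix L L ℝ) (i : L) (f g : 𝓢(L → ℝ, ℂ)) :
    ⟪toSpace (mulRow A i f), toSpace g⟫_ℂ = ⟪toSpace f, toSpace (mulRow A i g)⟫_ℂ := by
  rw [inner_toSpace, inner_toSpace]
  refine integral_congr_ae (Filter.Eventually.of_forall fun x => ?_)
  simp only [mulRow_apply, map_mul, Complex.conj_ofReal]
  ring

lemma inner_creation (A : Matrix L L ℝ) (i : L) (f g : 𝓢(L → ℝ, ℂ)) :
    ⟪toSpace (creation A i f), toSpace g⟫_ℂ = ⟪toSpace f, toSpace (annihilation A i g)⟫_ℂ := by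
  rw [creation, annihilation, add_apply, add_apply, map_add, map_add, inner_add_left,
    inner_add_right, inner_mulRow, neg_apply, map_neg, inner_neg_left, inner_partialDeriv, neg_neg]

lemma fderiv_mulRow (A : Matrix L L ℝ) (i : L) (f : 𝓢(L → ℝ, ℂ)) (x : L → ℝ) :
    fderiv ℝ (mulRow A i f) x (Pi.single i 1) =
      (A i i : ℂ) * f x + (((A *ᵥ x) i : ℝ) : ℂ) * fderiv ℝ f x (Pi.single i 1) := by
  have h0 : HasFDerivAt (fun x : L → ℝ => (((A *ᵥ x) i : ℝ) : ℂ))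
      (Complex.ofRealCLM ∘L ((ContinuousLinearMap.proj i).comp
        (Matrix.toLin' A).toContinuousLinearMap)) x :=
    (Complex.ofRealCLM ∘L ((ContinuousLinearMap.proj (R := ℝ) (φ := fun _ : L => ℝ) i).comp
        (Matrix.toLin' A).toContinuousLinearMap)).hasFDerivAt
  have h1 := h0.mul (f.hasFDerivAt x)
  have h2 : (mulRow A i f : (L → ℝ) → ℂ) = fun x => (((A *ᵥ x) i : ℝ) : ℂ) * f x :=
    funext fun x => mulRow_apply A i f x
  rw [h2]
  have h3 := h1.fderiv
  simp only [Pi.mul_def] at h3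
  rw [h3]
  simp
  ring

/-- The cross terms of `(-∂ᵢ + (Ax)ᵢ)(∂ᵢ + (Ax)ᵢ)` leave only `-Aᵢᵢ`, which sums to the trace;
symmetry of `A` gives `∑ᵢ (Ax)ᵢ² = x·A²x`. -/
lemma hamiltonian_eq (A : Matrix L L ℝ) (hA : Aᵀ = A) (f : 𝓢(L → ℝ, ℂ)) :
    hamiltonian 1 (A * A) f = (1 / 2 : ℂ) • ∑ i, creation A i (annihilation A i f) +
      ((A.trace / 2 : ℝ) : ℂ) • f := by
  ext x
  have hmom : ∀ i : L, momentum i (momentum i f) = -partialDeriv i (partialDeriv i f) := by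
    intro i
    simp only [momentum, partialDeriv, smul_apply, map_smul, smul_smul]
    simp
  have hX : ∑ i, ∑ j, ((A * A) i j : ℂ) * ((x i : ℂ) * ((x j : ℂ) * f x)) =
      ∑ i, (((A *ᵥ x) i : ℝ) : ℂ) * ((((A *ᵥ x) i : ℝ) : ℂ) * f x) := by
    have h1 : ∑ i, ∑ j, (A * A) i j * (x i * x j) = ∑ i, (A *ᵥ x) i * (A *ᵥ x) i := by
      have h2 : x ⬝ᵥ (A * A) *ᵥ x = (A *ᵥ x) ⬝ᵥ (A *ᵥ x) := by
        rw [← Matrix.mulVec_mulVec, Matrix.dotProduct_mulVec, ← Matrix.mulVec_transpose, hA]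
      rw [dotProduct, dotProduct] at h2
      rw [← h2]
      refine Finset.sum_congr rfl fun i _ => ?_
      rw [Matrix.mulVec, dotProduct, Finset.mul_sum]
      exact Finset.sum_congr rfl fun j _ => by ring
    have h3 : ((∑ i, ∑ j, (A * A) i j * (x i * x j) : ℝ) : ℂ) * f x =
        ((∑ i, (A *ᵥ x) i * (A *ᵥ x) i : ℝ) : ℂ) * f x := by rw [h1]
    push_cast at h3
    simp only [Finset.sum_mul] at h3
    simpa only [mul_assoc, Complex.ofReal_sum, Complex.ofReal_mul] using h3
  have hcre : ∀ i, creation A i (annihilation A i f) x = -partialDeriv i (partialDeriv i f) x -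
      (A i i : ℂ) * f x + (((A *ᵥ x) i : ℝ) : ℂ) * ((((A *ᵥ x) i : ℝ) : ℂ) * f x) := by
    intro i
    have h1 : fderiv ℝ (annihilation A i f) x (Pi.single i 1) =
        partialDeriv i (partialDeriv i f) x + ((A i i : ℂ) * f x +
          (((A *ᵥ x) i : ℝ) : ℂ) * fderiv ℝ f x (Pi.single i 1)) := by
      rw [← partialDeriv_apply, annihilation, add_apply, map_add, add_apply,
        partialDeriv_apply i (mulRow A i f), fderiv_mulRow]
    rw [creation_apply, h1, annihilation_apply]
    ring
  simp only [hamiltonian, smul_apply, sum_apply, add_apply,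
    ContinuousLinearMap.comp_apply, position_apply, smul_eq_mul, hcre, Finset.sum_add_distrib, hX,
    Finset.sum_sub_distrib]
  have h1 : ∑ i, ∑ j, ((1 : Matrix L L ℝ) i j : ℂ) * momentum i (momentum j f) x =
      ∑ i, -partialDeriv i (partialDeriv i f) x := by
    refine Finset.sum_congr rfl fun i _ => ?_
    rw [Finset.sum_eq_single i]
    · rw [hmom]; simp
    · intro j _ hj; simp [Matrix.one_apply_ne (Ne.symm hj)]
    · simp
  rw [h1, Matrix.trace, ← Finset.sum_mul]
  simp only [Matrix.diag]
  push_cast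
  ring

lemma re_inner_hamiltonian (A : Matrix L L ℝ) (hA : Aᵀ = A) (f : 𝓢(L → ℝ, ℂ)) :
    RCLike.re ⟪toSpace f, toSpace (hamiltonian 1 (A * A) f)⟫_ℂ =
      1 / 2 * ∑ i, ‖toSpace (annihilation A i f)‖ ^ 2 + A.trace / 2 * ‖toSpace f‖ ^ 2 := by
  have h1 : ∀ i, ⟪toSpace f, toSpace (creation A i (annihilation A i f))⟫_ℂ =
      ((‖toSpace (annihilation A i f)‖ ^ 2 : ℝ) : ℂ) := fun i => by
    rw [← inner_conj_symm, inner_creation, inner_conj_symm, inner_self_eq_norm_sq_to_K]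
    push_cast
    rfl
  rw [hamiltonian_eq A hA, map_add, map_smul, map_smul, map_sum, inner_add_right,
    inner_smul_right, inner_smul_right, inner_sum, inner_self_eq_norm_sq_to_K]
  simp only [h1]
  have h2 : (1 / 2 : ℂ) * ∑ i, ((‖toSpace (annihilation A i f)‖ ^ 2 : ℝ) : ℂ) +
      ((A.trace / 2 : ℝ) : ℂ) * (RCLike.ofReal ‖toSpace f‖ : ℂ) ^ 2 =
      ((1 / 2 * ∑ i, ‖toSpace (annihilation A i f)‖ ^ 2 +
        A.trace / 2 * ‖toSpace f‖ ^ 2 : ℝ) : ℂ) := by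
    push_cast
    rfl
  rw [h2]
  exact Complex.ofReal_re _

lemma mem_hamiltonianGraph (P X : Matrix L L ℝ) (f : 𝓢(L → ℝ, ℂ)) :
    (toSpace f, toSpace (hamiltonian P X f)) ∈ hamiltonianGraph P X :=
  Submodule.le_topologicalClosure _ ⟨f, rfl⟩

/-- The graph is a closure, so closed conditions need only be checked on Schwartz functions. -/
lemma hamiltonianGraph_induction {P X : Matrix L L ℝ} {p : Space L × Space L → Prop}
    (hp : IsClosed {z | p z}) (h : ∀ f, p (toSpace f, toSpace (hamiltonian P X f)))
    {φ χ : Space L} (hm : (φ, χ) ∈ hamiltonianGraph P X) : p (φ, χ) := by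
  rw [hamiltonianGraph, ← SetLike.mem_coe, Submodule.topologicalClosure_coe] at hm
  exact closure_minimal (by rintro _ ⟨f, rfl⟩; exact h f) hp hm

lemma le_re_inner_of_mem_hamiltonianGraph {A : Matrix L L ℝ} (hA : Aᵀ = A) {φ χ : Space L}
    (hm : (φ, χ) ∈ hamiltonianGraph 1 (A * A)) :
    A.trace / 2 * ‖φ‖ ^ 2 ≤ RCLike.re ⟪φ, χ⟫_ℂ := by
  refine hamiltonianGraph_induction (p := fun z => A.trace / 2 * ‖z.1‖ ^ 2 ≤
    RCLike.re ⟪z.1, z.2⟫_ℂ) (isClosed_le (by fun_prop) (by fun_prop)) (fun f => ?_) hm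
  simp only
  rw [re_inner_hamiltonian A hA]
  have : 0 ≤ ∑ i, ‖toSpace (annihilation A i f)‖ ^ 2 := Finset.sum_nonneg fun _ _ => by positivity
  linarith

/-- A weak form of `‖cᵢ φ‖² ≤ 2 (⟨φ, Hφ⟩ - ½ tr A ‖φ‖²)`. Moving the annihilation operator onto a
Schwartz test function makes sense for every `φ` in the domain and gives a closed condition. -/
lemma sq_norm_inner_creation_le {A : Matrix L L ℝ} (hA : Aᵀ = A) {φ χ : Space L}
    (hm : (φ, χ) ∈ hamiltonianGraph 1 (A * A)) (i : L) (η : 𝓢(L → ℝ, ℂ)) :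
    ‖⟪toSpace (creation A i η), φ⟫_ℂ‖ ^ 2 ≤
      2 * ‖toSpace η‖ ^ 2 * (RCLike.re ⟪φ, χ⟫_ℂ - A.trace / 2 * ‖φ‖ ^ 2) := by
  refine hamiltonianGraph_induction (p := fun z => ‖⟪toSpace (creation A i η), z.1⟫_ℂ‖ ^ 2 ≤
      2 * ‖toSpace η‖ ^ 2 * (RCLike.re ⟪z.1, z.2⟫_ℂ - A.trace / 2 * ‖z.1‖ ^ 2))
    (isClosed_le (by fun_prop) (by fun_prop)) (fun f => ?_) hm
  simp only
  rw [re_inner_hamiltonian A hA, inner_creation]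
  have h1 := norm_inner_le_norm (𝕜 := ℂ) (toSpace η) (toSpace (annihilation A i f))
  have h2 : ‖toSpace (annihilation A i f)‖ ^ 2 ≤ ∑ i, ‖toSpace (annihilation A i f)‖ ^ 2 :=
    Finset.single_le_sum (f := fun i => ‖toSpace (annihilation A i f)‖ ^ 2)
      (fun _ _ => by positivity) (Finset.mem_univ i)
  calc _ ≤ (‖toSpace η‖ * ‖toSpace (annihilation A i f)‖) ^ 2 := by gcongr
    _ = ‖toSpace η‖ ^ 2 * ‖toSpace (annihilation A i f)‖ ^ 2 := mul_pow _ _ _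
    _ ≤ ‖toSpace η‖ ^ 2 * ∑ i, ‖toSpace (annihilation A i f)‖ ^ 2 := by gcongr
    _ = _ := by ring

end Ladder

/-! ## Ground states -/

section WeakDerivative

open scoped Convolution ContDiff

/-- The mollifications of `u` have zero derivative, so they are constant, and they converge to `u`
almost everywhere. -/
lemma ae_eq_const_of_integral_fderiv_eq_zero {E : Type*} [NormedAddCommGroup E] [NormedSpace ℝ E]
    [FiniteDimensional ℝ E] [MeasurableSpace E] [BorelSpace E] {μ : Measure E}
    [μ.IsAddHaarMeasure] {u : E → ℂ} (hu : LocallyIntegrable u μ)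
    (h : ∀ ζ : E → ℝ, ContDiff ℝ ∞ ζ → HasCompactSupport ζ → ∀ v,
      ∫ x, fderiv ℝ ζ x v • u x ∂μ = 0) :
    ∃ c, u =ᵐ[μ] fun _ => c := by
  have hconst : ∀ f : E → ℝ, ContDiff ℝ ∞ f → HasCompactSupport f → ∀ x y,
      (f ⋆[ContinuousLinearMap.lsmul ℝ ℝ, μ] u) x = (f ⋆[ContinuousLinearMap.lsmul ℝ ℝ, μ] u) y := by
    intro f hf hfc
    have hf1 : ContDiff ℝ 1 f := hf.of_le (by exact_mod_cast le_top)
    have hd := hfc.hasFDerivAt_convolution_left (μ := μ)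
      (ContinuousLinearMap.lsmul ℝ ℝ : ℝ →L[ℝ] ℂ →L[ℝ] ℂ) hf1 hu
    refine is_const_of_fderiv_eq_zero (𝕜 := ℝ) (fun x => (hd x).differentiableAt) fun x => ?_
    rw [(hd x).fderiv]
    ext v
    have hex := (hfc.fderiv (𝕜 := ℝ)).convolutionExists_left (μ := μ)
      (ContinuousLinearMap.precompL E (ContinuousLinearMap.lsmul ℝ ℝ : ℝ →L[ℝ] ℂ →L[ℝ] ℂ))
      (hf1.continuous_fderiv one_ne_zero) hu x
    rw [convolution_def, ContinuousLinearMap.integral_apply hex]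
    simp only [ContinuousLinearMap.precompL_apply, ContinuousLinearMap.lsmul_apply,
      zero_apply]
    rw [← integral_sub_left_eq_self _ μ x]
    -- The derivative of the convolution at `x` is, up to sign, `u` tested against the derivative of
    -- the reflected and translated bump.
    have h1 := h (fun t => f (x - t)) (hf.comp (contDiff_const.sub contDiff_id))
      (hfc.comp_homeomorph (Homeomorph.subLeft x)) v
    rw [← neg_eq_zero, ← integral_neg, ← h1]
    refine integral_congr_ae (Filter.Eventually.of_forall fun t => ?_)
    have h3 := ((hf1.differentiable one_ne_zero) (x - t)).hasFDerivAt.comp t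
      ((hasFDerivAt_id t).const_sub x)
    have h4 : fderiv ℝ (fun t => f (x - t)) t = _ := h3.fderiv
    simp [h4]
  -- The outer radius is twice the inner one; almost everywhere convergence requires this ratio to
  -- stay bounded, whence `K = 2` below.
  let φ : ℕ → ContDiffBump (0 : E) := fun n =>
    ⟨1 / (2 * ((n : ℝ) + 1)), 1 / ((n : ℝ) + 1), by positivity, by
      gcongr
      have : (0 : ℝ) < n + 1 := by positivity
      linarith⟩
  have hlim := ContDiffBump.ae_convolution_tendsto_right_of_locallyIntegrable (μ := μ) (φ := φ)
    (l := Filter.atTop) (K := 2) (by exact tendsto_one_div_add_atTop_nhds_zero_nat)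
    (Filter.Eventually.of_forall fun n => le_of_eq <| by
      change 1 / ((n : ℝ) + 1) = 2 * (1 / (2 * ((n : ℝ) + 1)))
      field_simp) hu
  obtain ⟨x₀, hx₀⟩ := hlim.exists
  refine ⟨u x₀, ?_⟩
  filter_upwards [hlim] with x hx
  refine tendsto_nhds_unique hx (hx₀.congr fun n => ?_)
  exact hconst _ ((φ n).contDiff_normed) (φ n).hasCompactSupport_normed _ _

end WeakDerivative

section GroundState

open scoped Matrix ContDiff

variable {L : Type} [Fintype L] [DecidableEq L] {A : Matrix L L ℝ}

lemma hasFDerivAt_quadratic (hA : Aᵀ = A) (x : L → ℝ) :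
    ∃ q' : (L → ℝ) →L[ℝ] ℝ, HasFDerivAt (fun x : L → ℝ => x ⬝ᵥ A *ᵥ x) q' x ∧
      ∀ v, q' v = 2 * (v ⬝ᵥ A *ᵥ x) := by
  have h1 : ∀ k, HasFDerivAt (fun x : L → ℝ => x k)
      (ContinuousLinearMap.proj (R := ℝ) (φ := fun _ : L => ℝ) k) x := fun k =>
    (ContinuousLinearMap.proj (R := ℝ) (φ := fun _ : L => ℝ) k).hasFDerivAt
  have h2 : ∀ k, HasFDerivAt (fun x : L → ℝ => (A *ᵥ x) k)
      ((ContinuousLinearMap.proj (R := ℝ) (φ := fun _ : L => ℝ) k).comp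
        (Matrix.toLin' A).toContinuousLinearMap) x := fun k =>
    ((ContinuousLinearMap.proj (R := ℝ) (φ := fun _ : L => ℝ) k).comp
        (Matrix.toLin' A).toContinuousLinearMap).hasFDerivAt
  have h3 := HasFDerivAt.fun_sum (u := Finset.univ) fun k _ => (h1 k).mul (h2 k)
  refine ⟨_, h3, fun v => ?_⟩
  have h4 : x ⬝ᵥ A *ᵥ v = v ⬝ᵥ A *ᵥ x := by
    rw [Matrix.dotProduct_mulVec, ← Matrix.mulVec_transpose, hA, dotProduct_comm]
  rw [two_mul]
  nth_rw 1 [← h4]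
  simp [dotProduct, Finset.sum_add_distrib, mul_comm]

lemma fderiv_exp_quadratic (hA : Aᵀ = A) (s : ℝ) (x : L → ℝ) (i : L) :
    HasFDerivAt (fun x : L → ℝ => Real.exp (s * (x ⬝ᵥ A *ᵥ x)))
      (fderiv ℝ (fun x : L → ℝ => Real.exp (s * (x ⬝ᵥ A *ᵥ x))) x) x ∧
    fderiv ℝ (fun x : L → ℝ => Real.exp (s * (x ⬝ᵥ A *ᵥ x))) x (Pi.single i 1) =
      2 * s * (A *ᵥ x) i * Real.exp (s * (x ⬝ᵥ A *ᵥ x)) := by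
  obtain ⟨q', hq, hq'⟩ := hasFDerivAt_quadratic hA x
  have h := (hq.const_mul s).exp
  refine ⟨h.differentiableAt.hasFDerivAt, ?_⟩
  rw [h.fderiv]
  simp [hq']
  ring

variable {φ : 𝓢(L → ℝ, ℂ)}

lemma annihilation_gaussian (hA : Aᵀ = A)
    (hφ : ∀ x, φ x = (Real.exp (-(1 / 2) * (x ⬝ᵥ A *ᵥ x)) : ℂ)) (i : L) :
    annihilation A i φ = 0 := by
  ext x
  have h2 := fderiv_exp_quadratic hA (-(1 / 2)) x i
  have h1 : (φ : (L → ℝ) → ℂ) =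
      Complex.ofRealCLM ∘ fun x : L → ℝ => Real.exp (-(1 / 2) * (x ⬝ᵥ A *ᵥ x)) := funext hφ
  have h3 := (Complex.ofRealCLM.hasFDerivAt.comp x h2.1).fderiv
  rw [annihilation_apply, h1, h3, ContinuousLinearMap.comp_apply, h2.2]
  simp

lemma hamiltonian_gaussian (hA : Aᵀ = A)
    (hφ : ∀ x, φ x = (Real.exp (-(1 / 2) * (x ⬝ᵥ A *ᵥ x)) : ℂ)) :
    hamiltonian 1 (A * A) φ = ((A.trace / 2 : ℝ) : ℂ) • φ := by
  simp [hamiltonian_eq A hA, annihilation_gaussian hA hφ]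

lemma toSpace_gaussian_ne_zero (hφ : ∀ x, φ x = (Real.exp (-(1 / 2) * (x ⬝ᵥ A *ᵥ x)) : ℂ)) :
    toSpace φ ≠ 0 := by
  intro h
  have h1 : φ = 0 := SchwartzMap.injective_toLp 2 (volume : Measure (L → ℝ))
    (h.trans (map_zero toSpace).symm)
  have h2 := hφ 0
  rw [h1] at h2
  simp at h2

lemma isGroundState_gaussian (hA : Aᵀ = A)
    (hφ : ∀ x, φ x = (Real.exp (-(1 / 2) * (x ⬝ᵥ A *ᵥ x)) : ℂ)) :
    IsGroundState 1 (A * A) (((‖toSpace φ‖⁻¹ : ℝ) : ℂ) • toSpace φ) := by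
  have h0 := norm_ne_zero_iff.2 (toSpace_gaussian_ne_zero hφ)
  refine ⟨?_, A.trace / 2, ?_, fun φ χ h => le_re_inner_of_mem_hamiltonianGraph hA h⟩
  · rw [norm_smul, Complex.norm_real, norm_inv, norm_norm, inv_mul_cancel₀ h0]
  · have h1 := mem_hamiltonianGraph 1 (A * A) φ
    rw [hamiltonian_gaussian hA hφ, map_smul] at h1
    have h2 := Submodule.smul_mem _ ((‖toSpace φ‖⁻¹ : ℝ) : ℂ) h1
    rwa [Prod.smul_mk, smul_comm] at h2

/-- The creation operator kills `w = exp(½ x·Ax)`, so applied to the test function `wζ` it gives `-w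
∂ᵢζ`. Orthogonality of `ψ` to its range thus says that `∂ᵢ(wψ) = 0` weakly. -/
lemma integral_fderiv_smul_exp_quadratic_mul (hA : Aᵀ = A) {ψ : Space L} {i : L}
    (hψ : ∀ η, ⟪toSpace (creation A i η), ψ⟫_ℂ = 0) {w : (L → ℝ) → ℝ}
    (hw : w = fun x => Real.exp (1 / 2 * (x ⬝ᵥ A *ᵥ x))) (hwc : ContDiff ℝ ∞ w)
    {ζ : (L → ℝ) → ℝ} (hζ : ContDiff ℝ ∞ ζ) (hζc : HasCompactSupport ζ) :
    ∫ x, fderiv ℝ ζ x (Pi.single i 1) • ((w x : ℂ) * ψ x) = 0 := by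
  have hηs : ContDiff ℝ ∞ (Complex.ofReal ∘ (w * ζ)) :=
    Complex.ofRealCLM.contDiff.comp (hwc.mul hζ)
  have hηc : HasCompactSupport (Complex.ofReal ∘ (w * ζ)) :=
    (hζc.mul_left (f := w)).comp_left Complex.ofReal_zero
  set η : 𝓢(L → ℝ, ℂ) := hηc.toSchwartzMap hηs with hη
  have hη' : (η : (L → ℝ) → ℂ) = Complex.ofRealCLM ∘ (w * ζ) := rfl
  have h1 := hψ η
  rw [L2.inner_def] at h1
  rw [← neg_eq_zero, ← integral_neg, ← h1]
  refine integral_congr_ae ?_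
  filter_upwards [SchwartzMap.coeFn_toLp (creation A i η) 2
    (volume : Measure (L → ℝ))] with x hx
  have h2 := fderiv_exp_quadratic hA (1 / 2) x i
  rw [← hw] at h2
  have h3 := h2.1.mul ((hζ.differentiable (by simp)) x).hasFDerivAt
  have h4 := (Complex.ofRealCLM.hasFDerivAt.comp x h3).fderiv
  have h5 : fderiv ℝ η x (Pi.single i 1) =
      (((w x * fderiv ℝ ζ x (Pi.single i 1) + ζ x * ((A *ᵥ x) i * w x) : ℝ)) : ℂ) := by
    have h6 := h2.2
    rw [show Real.exp (1 / 2 * (x ⬝ᵥ A *ᵥ x)) = w x by rw [hw]] at h6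
    rw [hη', h4, ContinuousLinearMap.comp_apply, add_apply, smul_apply, smul_apply, h6]
    simp
  have h7 : toSpace (creation A i η) x = ((-(w x * fderiv ℝ ζ x (Pi.single i 1)) : ℝ) : ℂ) := by
    refine Eq.trans hx ?_
    rw [creation_apply, h5, hη']
    simp
    ring
  rw [h7, RCLike.inner_apply, Complex.conj_ofReal, Complex.real_smul]
  push_cast
  ring

lemma exists_smul_gaussian_of_creation_orthogonal (hA : Aᵀ = A)
    (hφ : ∀ x, φ x = (Real.exp (-(1 / 2) * (x ⬝ᵥ A *ᵥ x)) : ℂ)) {ψ : Space L}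
    (hψ : ∀ i η, ⟪toSpace (creation A i η), ψ⟫_ℂ = 0) : ∃ c : ℂ, ψ = c • toSpace φ := by
  obtain ⟨w, hw⟩ : ∃ w : (L → ℝ) → ℝ, w = fun x => Real.exp (1 / 2 * (x ⬝ᵥ A *ᵥ x)) := ⟨_, rfl⟩
  have hwc : ContDiff ℝ ∞ w := by
    rw [hw]
    exact Real.contDiff_exp.comp (contDiff_const.mul (hasTemperateGrowth_quadratic A).1)
  have hul : LocallyIntegrable (fun x => (w x : ℂ) * ψ x) volume :=
    ((Lp.memLp ψ).locallyIntegrable one_le_two).continuous_mul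
      (Complex.continuous_ofReal.comp hwc.continuous)
  obtain ⟨c, hc⟩ := ae_eq_const_of_integral_fderiv_eq_zero hul fun ζ hζ hζc v => by
    have hbasis := fun i : L => integral_fderiv_smul_exp_quadratic_mul hA (hψ i) hw hwc hζ hζc
    have hv : v = ∑ i, v i • (Pi.single i 1 : L → ℝ) := by
      ext j
      simp [Finset.sum_apply, Pi.single_apply]
    have hint : ∀ i : L, Integrable
        (fun x => fderiv ℝ ζ x (Pi.single i 1) • ((w x : ℂ) * ψ x)) volume := fun i =>
      hul.integrable_smul_left_of_hasCompactSupport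
        ((hζ.continuous_fderiv (by simp)).clm_apply continuous_const)
        (hζc.fderiv_apply ℝ _)
    rw [hv]
    simp only [map_sum, map_smul, Finset.sum_smul, smul_assoc]
    rw [integral_finsetSum _ fun i _ => by exact (hint i).smul (v i)]
    refine Finset.sum_eq_zero fun i _ => ?_
    rw [integral_smul, hbasis, smul_zero]
  refine ⟨c, ?_⟩
  ext1
  filter_upwards [hc, SchwartzMap.coeFn_toLp φ 2 (volume : Measure (L → ℝ)),
    Lp.coeFn_smul c (toSpace φ)] with x h1 h2 h3
  rw [h3, Pi.smul_apply]
  refine Eq.trans ?_ (congrArg (c • ·) h2).symm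
  have h4 : (φ x * (w x : ℂ)) = 1 := by
    rw [hφ, ← Complex.ofReal_mul, hw, ← Real.exp_add, neg_mul, neg_add_cancel, Real.exp_zero,
      Complex.ofReal_one]
  rw [← h1, smul_eq_mul]
  linear_combination (-ψ x) * h4

/-- The ground state of the harmonic Hamiltonian is unique up to a phase. -/
lemma exists_smul_gaussian_of_isGroundState (hA : Aᵀ = A)
    (hφ : ∀ x, φ x = (Real.exp (-(1 / 2) * (x ⬝ᵥ A *ᵥ x)) : ℂ)) {ψ : Space L}
    (hψ : IsGroundState 1 (A * A) ψ) : ∃ c : ℂ, ψ = c • toSpace φ := by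
  obtain ⟨h1, e, he, hmin⟩ := hψ
  have hre : RCLike.re ⟪ψ, (e : ℂ) • ψ⟫_ℂ = e := by
    rw [inner_smul_right, inner_self_eq_norm_sq_to_K, h1]
    simp
  have hle : e ≤ A.trace / 2 := by
    have h2 := hmin _ _ (mem_hamiltonianGraph 1 (A * A) φ)
    have h0 := norm_pos_iff.2 (toSpace_gaussian_ne_zero hφ)
    rw [hamiltonian_gaussian hA hφ, map_smul, inner_smul_right, inner_self_eq_norm_sq_to_K] at h2
    have h3 : RCLike.re (((A.trace / 2 : ℝ) : ℂ) * (RCLike.ofReal ‖toSpace φ‖ : ℂ) ^ 2) =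
        A.trace / 2 * ‖toSpace φ‖ ^ 2 := by
      have : ((A.trace / 2 : ℝ) : ℂ) * (RCLike.ofReal ‖toSpace φ‖ : ℂ) ^ 2 =
          ((A.trace / 2 * ‖toSpace φ‖ ^ 2 : ℝ) : ℂ) := by push_cast; rfl
      rw [this]; exact Complex.ofReal_re _
    rw [h3] at h2
    exact le_of_mul_le_mul_right h2 (by positivity)
  -- Comparison with the Gaussian gave `e ≤ ½ tr A`, so the weak bound on `cᵢ ψ` has a nonpositive
  -- right-hand side.
  refine exists_smul_gaussian_of_creation_orthogonal hA hφ fun i η => ?_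
  have h2 := sq_norm_inner_creation_le hA he i η
  rw [hre, h1, one_pow, mul_one] at h2
  have h3 : ‖⟪toSpace (creation A i η), ψ⟫_ℂ‖ ^ 2 ≤ 0 :=
    h2.trans (mul_nonpos_of_nonneg_of_nonpos (by positivity) (by linarith))
  exact norm_eq_zero.1 (pow_eq_zero_iff two_ne_zero |>.1 (le_antisymm h3 (by positivity)))

end GroundState

/-! ### Gaussian integrals of quadratic forms. -/

section GaussianIntegral

open scoped Matrix

variable {ι : Type} [Fintype ι] [DecidableEq ι]

lemma quadratic_transpose_mul_self (C : Matrix ι ι ℝ) (x : ι → ℝ) :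
    x ⬝ᵥ (Cᵀ * C) *ᵥ x = C *ᵥ x ⬝ᵥ C *ᵥ x := by
  rw [← Matrix.mulVec_mulVec, Matrix.dotProduct_mulVec, Matrix.vecMul_transpose]

lemma exists_eq_transpose_mul_self {P : Matrix ι ι ℝ} (hP : P.PosSemidef) :
    ∃ C : Matrix ι ι ℝ, P = Cᵀ * C := by
  open scoped MatrixOrder in
  have h0 : 0 ≤ CFC.sqrt P := CFC.sqrt_nonneg P
  refine ⟨CFC.sqrt P, ?_⟩
  have h1 : (CFC.sqrt P)ᵀ = CFC.sqrt P := by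
    have := (Matrix.nonneg_iff_posSemidef.1 h0).isHermitian
    simpa [Matrix.IsHermitian] using this
  rw [h1, CFC.sqrt_mul_sqrt_self P hP.nonneg]

lemma quadratic_pos_of_posDef {P : Matrix ι ι ℝ} (hP : P.PosDef) (x : ι → ℝ) (hx : x ≠ 0) :
    0 < x ⬝ᵥ P *ᵥ x := by
  simpa using hP.dotProduct_mulVec_pos hx

lemma continuous_quadratic (P : Matrix ι ι ℝ) : Continuous fun x : ι → ℝ => x ⬝ᵥ P *ᵥ x := by
  simp only [dotProduct, Matrix.mulVec]
  fun_prop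

lemma integral_exp_neg_quadratic {P : Matrix ι ι ℝ} (hP : P.PosDef) {s : ℝ} :
    ∫ x : ι → ℝ, Real.exp (-s * (x ⬝ᵥ P *ᵥ x)) =
      √(Real.pi / s) ^ Fintype.card ι / √P.det := by
  obtain ⟨C, rfl⟩ := exists_eq_transpose_mul_self hP.posSemidef
  have hdet : (Cᵀ * C).det = C.det ^ 2 := by
    rw [Matrix.det_mul, Matrix.det_transpose, sq]
  have hC : C.det ≠ 0 := by
    have := hP.det_pos
    rw [hdet] at this
    exact fun h => by simp [h] at this
  have hmeas : AEStronglyMeasurable (fun y : ι → ℝ => Real.exp (-s * (y ⬝ᵥ y)))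
      (Measure.map (Matrix.toLin' C) volume) := by
    refine Continuous.aestronglyMeasurable ?_
    simp only [dotProduct]
    fun_prop
  calc _ = ∫ x : ι → ℝ, Real.exp (-s * (Matrix.toLin' C x ⬝ᵥ Matrix.toLin' C x)) := by
        simp only [quadratic_transpose_mul_self, Matrix.toLin'_apply]
    _ = ∫ y, Real.exp (-s * (y ⬝ᵥ y)) ∂(Measure.map (Matrix.toLin' C) volume) :=
        (integral_map (LinearMap.continuous_of_finiteDimensional _).aemeasurable hmeas).symm
    _ = |C.det⁻¹| * ∫ y : ι → ℝ, ∏ i, Real.exp (-s * y i ^ 2) := by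
        rw [Real.map_matrix_volume_pi_eq_smul_volume_pi hC, integral_smul_measure,
          ENNReal.toReal_ofReal (abs_nonneg _), smul_eq_mul]
        congr 2
        ext y
        rw [← Real.exp_sum, dotProduct, Finset.mul_sum]
        simp only [sq]
    _ = _ := by
        rw [integral_fintype_prod_volume_eq_pow (fun t : ℝ => Real.exp (-s * t ^ 2)),
          integral_gaussian, hdet, Real.sqrt_sq_eq_abs, abs_inv]
        field_simp

lemma integrable_exp_neg_quadratic {P : Matrix ι ι ℝ} (hP : P.PosDef) {s : ℝ} (hs : 0 < s) :
    Integrable fun x : ι → ℝ => Real.exp (-s * (x ⬝ᵥ P *ᵥ x)) := by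
  -- A function that is not integrable has integral `0` by convention, while the computed value is
  -- positive.
  refine not_imp_comm.1 integral_undef ?_
  rw [integral_exp_neg_quadratic hP]
  have := hP.det_pos
  positivity

lemma integral_exp_neg_quadratic_add_smul (P : Matrix ι ι ℝ) {s : ℝ} (v : ι → ℝ) :
    ∫ x : ι → ℝ, Real.exp (-s * ((v + (2 : ℝ) • x) ⬝ᵥ P *ᵥ (v + (2 : ℝ) • x))) =
      (2 ^ Fintype.card ι)⁻¹ * ∫ x : ι → ℝ, Real.exp (-s * (x ⬝ᵥ P *ᵥ x)) := by
  rw [Measure.integral_comp_smul volume (fun x : ι → ℝ => Real.exp (-s * ((v + x) ⬝ᵥ P *ᵥ (v + x)))) 2,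
    integral_add_left_eq_self (fun x : ι → ℝ => Real.exp (-s * (x ⬝ᵥ P *ᵥ x)))]
  rw [Module.finrank_fintype_fun_eq_card, smul_eq_mul, abs_of_nonneg (by positivity)]

lemma integrable_exp_neg_quadratic_add_smul {P : Matrix ι ι ℝ} (hP : P.PosDef) {s : ℝ} (hs : 0 < s)
    (v : ι → ℝ) : Integrable
      fun x : ι → ℝ => Real.exp (-s * ((v + (2 : ℝ) • x) ⬝ᵥ P *ᵥ (v + (2 : ℝ) • x))) :=
  ((integrable_exp_neg_quadratic hP hs).comp_add_left v).comp_smul two_ne_zero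

/-- The shear `(x, y) ↦ (x + y, y)` preserves the measure and turns `x - y`, `x + y` into `x`, `x +
2y`. The integral over `y` then loses its dependence on `x` by translation, and the scaling by `2`
yields the power of `2`. -/
lemma integral_exp_neg_quadratic_sub_add {P Q : Matrix ι ι ℝ} (hP : P.PosDef) (hQ : Q.PosDef)
    {s : ℝ} (hs : 0 < s) :
    ∫ z : (ι → ℝ) × (ι → ℝ), Real.exp (-s * ((z.1 - z.2) ⬝ᵥ P *ᵥ (z.1 - z.2)) +
        -s * ((z.1 + z.2) ⬝ᵥ Q *ᵥ (z.1 + z.2))) ∂(volume.prod volume) =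
      (√(Real.pi / s) ^ Fintype.card ι) ^ 2 / (2 ^ Fintype.card ι * √(P.det * Q.det)) := by
  have hmp := measurePreserving_add_prod (volume : Measure (ι → ℝ)) (volume : Measure (ι → ℝ))
  have hcont : Continuous fun z : (ι → ℝ) × (ι → ℝ) =>
      Real.exp (-s * ((z.1 - z.2) ⬝ᵥ P *ᵥ (z.1 - z.2)) +
        -s * ((z.1 + z.2) ⬝ᵥ Q *ᵥ (z.1 + z.2))) := by
    have h1 := (continuous_quadratic P).comp (continuous_fst.sub continuous_snd)
    have h2 := (continuous_quadratic Q).comp (continuous_fst.add continuous_snd)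
    exact Real.continuous_exp.comp ((continuous_const.mul h1).add (continuous_const.mul h2))
  have hcont' : Continuous fun z : (ι → ℝ) × (ι → ℝ) => Real.exp (-s * (z.1 ⬝ᵥ P *ᵥ z.1)) *
      Real.exp (-s * ((z.1 + (2 : ℝ) • z.2) ⬝ᵥ Q *ᵥ (z.1 + (2 : ℝ) • z.2))) := by
    have h1 := (continuous_quadratic P).comp (continuous_fst (X := ι → ℝ) (Y := ι → ℝ))
    have h2 := (continuous_quadratic Q).comp
      (continuous_fst.add (continuous_snd.const_smul (2 : ℝ)) :
        Continuous fun z : (ι → ℝ) × (ι → ℝ) => z.1 + (2 : ℝ) • z.2)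
    exact (Real.continuous_exp.comp (continuous_const.mul h1)).mul
      (Real.continuous_exp.comp (continuous_const.mul h2))
  have hint : Integrable (fun z : (ι → ℝ) × (ι → ℝ) => Real.exp (-s * (z.1 ⬝ᵥ P *ᵥ z.1)) *
      Real.exp (-s * ((z.1 + (2 : ℝ) • z.2) ⬝ᵥ Q *ᵥ (z.1 + (2 : ℝ) • z.2))))
      (volume.prod volume) := by
    rw [integrable_prod_iff hcont'.aestronglyMeasurable]
    constructor
    · exact .of_forall fun x => (integrable_exp_neg_quadratic_add_smul hQ hs x).const_mul
        (Real.exp (-s * (x ⬝ᵥ P *ᵥ x)))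
    simp only [norm_mul, Real.norm_eq_abs, Real.abs_exp, integral_const_mul,
      integral_exp_neg_quadratic_add_smul]
    exact (integrable_exp_neg_quadratic hP hs).mul_const _
  rw [← hmp.map_eq, integral_map hmp.aemeasurable hcont.aestronglyMeasurable]
  have hshift : ∀ z : (ι → ℝ) × (ι → ℝ), z.1 + z.2 + z.2 = z.1 + (2 : ℝ) • z.2 := fun z => by
    rw [two_smul, add_assoc]
  simp only [add_sub_cancel_right, hshift, Real.exp_add]
  rw [integral_prod _ hint]
  simp only [integral_const_mul, integral_exp_neg_quadratic_add_smul]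
  rw [integral_mul_const, integral_exp_neg_quadratic hP, integral_exp_neg_quadratic hQ,
    Real.sqrt_mul hP.det_pos.le]
  have h1 := Real.sqrt_pos.2 hP.det_pos
  have h2 := Real.sqrt_pos.2 hQ.det_pos
  field_simp

end GaussianIntegral

/-! ### Identification of the two halves of the lattice by a signed reflection. -/

section Reflection

variable {L : Type} [Fintype L] [DecidableEq L] {I : Finset L}
  (ρ : {i : L // i ∈ I} ≃ {i : L // i ∉ I}) {ε : ℝ} (hε : ε * ε = 1)

/-- The map `y ↦ ε y ∘ ρ⁻¹` between configurations of the two halves of the lattice. -/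
noncomputable def reflectEquiv : ({i : L // i ∈ I} → ℝ) ≃ᵐ ({i : L // i ∉ I} → ℝ) where
  toFun y o := ε * y (ρ.symm o)
  invFun z j := ε * z (ρ j)
  left_inv y := by ext j; simp [← mul_assoc, hε]
  right_inv z := by ext o; simp [← mul_assoc, hε]
  measurable_toFun := by
    simp only [Equiv.coe_fn_mk]
    fun_prop
  measurable_invFun := by
    simp only [Equiv.coe_fn_symm_mk]
    fun_prop

lemma measurePreserving_reflectEquiv :
    MeasurePreserving (reflectEquiv ρ hε) volume volume := by
  have h1 := volume_measurePreserving_piCongrLeft (fun _ : {i : L // i ∉ I} => ℝ) ρ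
  have h2 : ∀ y, MeasurableEquiv.piCongrLeft (fun _ : {i : L // i ∉ I} => ℝ) ρ y =
      fun o => y (ρ.symm o) := fun y => by
    ext o
    obtain ⟨j, rfl⟩ := ρ.surjective o
    simp [MeasurableEquiv.coe_piCongrLeft, Equiv.piCongrLeft_apply_apply]
  rcases mul_self_eq_one_iff.1 hε with h | h
  · convert h1 using 1
    ext y o
    rw [h2]
    simp [reflectEquiv, h]
  · convert (Measure.measurePreserving_neg volume).comp h1 using 1
    ext y o
    rw [Function.comp_apply, h2]
    simp [reflectEquiv, h]

/-- The unitary `L²(ℝ^I) → L²(ℝ^O)` induced by `reflectEquiv`. -/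
noncomputable def reflectUnitary : SpaceIn I ≃ₗᵢ[ℂ] SpaceOut I :=
  LinearIsometryEquiv.ofSurjective
    (Lp.compMeasurePreservingₗᵢ ℂ (reflectEquiv ρ hε).symm
      (measurePreserving_reflectEquiv ρ hε).symm)
    fun g => by
      refine ⟨Lp.compMeasurePreserving _ (measurePreserving_reflectEquiv ρ hε) g, ?_⟩
      have hmp := (measurePreserving_reflectEquiv ρ hε).symm
      ext1
      have h1 := Lp.coeFn_compMeasurePreserving
        (Lp.compMeasurePreserving _ (measurePreserving_reflectEquiv ρ hε) g) hmp
      have h2 := hmp.quasiMeasurePreserving.ae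
        (Lp.coeFn_compMeasurePreserving g (measurePreserving_reflectEquiv ρ hε))
      refine h1.trans ?_
      filter_upwards [h2] with z hz
      rw [Function.comp_apply, hz, Function.comp_apply, MeasurableEquiv.apply_symm_apply]

lemma reflectUnitary_ae (f : SpaceIn I) :
    reflectUnitary ρ hε f =ᵐ[volume] f ∘ (reflectEquiv ρ hε).symm :=
  Lp.coeFn_compMeasurePreserving f (measurePreserving_reflectEquiv ρ hε).symm

/-- A configuration of the whole lattice from one of `I` and the reflection of another one. -/
noncomputable def glueEquiv :
    ({i : L // i ∈ I} → ℝ) × ({i : L // i ∈ I} → ℝ) ≃ᵐ (L → ℝ) :=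
  ((MeasurableEquiv.refl _).prodCongr (reflectEquiv ρ hε)).trans (splitEquiv I).symm

lemma glueEquiv_apply (z : ({i : L // i ∈ I} → ℝ) × ({i : L // i ∈ I} → ℝ)) :
    glueEquiv ρ hε z = (splitEquiv I).symm (z.1, reflectEquiv ρ hε z.2) := rfl

lemma glueEquiv_apply_in (z : ({i : L // i ∈ I} → ℝ) × ({i : L // i ∈ I} → ℝ))
    (j : {i : L // i ∈ I}) : glueEquiv ρ hε z j = z.1 j := by
  have h : (splitEquiv I (glueEquiv ρ hε z)).1 j = z.1 j := by
    rw [glueEquiv_apply, MeasurableEquiv.apply_symm_apply]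
  exact h

lemma glueEquiv_apply_out (z : ({i : L // i ∈ I} → ℝ) × ({i : L // i ∈ I} → ℝ))
    (j : {i : L // i ∈ I}) : glueEquiv ρ hε z (ρ j) = ε * z.2 j := by
  have h : (splitEquiv I (glueEquiv ρ hε z)).2 (ρ j) = ε * z.2 j := by
    rw [glueEquiv_apply, MeasurableEquiv.apply_symm_apply]
    simp [reflectEquiv]
  exact h

lemma measurePreserving_id_prod_reflectEquiv : MeasurePreserving
    (Prod.map id (reflectEquiv ρ hε) : ({i : L // i ∈ I} → ℝ) × ({i : L // i ∈ I} → ℝ) → _)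
      (volume.prod volume) (volume.prod volume) :=
  (MeasurePreserving.id _).prod (measurePreserving_reflectEquiv ρ hε)

lemma measurePreserving_glueEquiv :
    MeasurePreserving (glueEquiv ρ hε) (volume.prod volume) volume :=
  (measurePreserving_split I).symm.comp (measurePreserving_id_prod_reflectEquiv ρ hε)

/-- In glued coordinates a vector of the whole lattice is an integral kernel on two copies of `ℝ^I`;
the `star` on `u` undoes the conjugation in the inner product. -/
lemma inner_tensor_reflectUnitary (u v : SpaceIn I) (φ : 𝓢(L → ℝ, ℂ)) :
    ⟪tensor I (star u) (reflectUnitary ρ hε v), toSpace φ⟫_ℂ =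
      ∫ z : ({i : L // i ∈ I} → ℝ) × ({i : L // i ∈ I} → ℝ),
        u z.1 * starRingEnd ℂ (v z.2) * φ (glueEquiv ρ hε z) ∂(volume.prod volume) := by
  have hmp := measurePreserving_id_prod_reflectEquiv ρ hε
  have hemb : MeasurableEmbedding (Prod.map id (reflectEquiv ρ hε) :
      ({i : L // i ∈ I} → ℝ) × ({i : L // i ∈ I} → ℝ) → _) :=
    ((MeasurableEquiv.refl _).prodCongr (reflectEquiv ρ hε)).measurableEmbedding
  rw [inner_tensor_left, ← hmp.integral_comp hemb]
  refine integral_congr_ae ?_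
  have h1 := (Measure.quasiMeasurePreserving_fst (μ := (volume : Measure ({i : L // i ∈ I} → ℝ)))
    (ν := (volume : Measure ({i : L // i ∈ I} → ℝ)))).ae (Lp.coeFn_star u)
  have h2 := ((measurePreserving_reflectEquiv ρ hε).quasiMeasurePreserving.comp
    (Measure.quasiMeasurePreserving_snd (μ := (volume : Measure ({i : L // i ∈ I} → ℝ)))
    (ν := (volume : Measure ({i : L // i ∈ I} → ℝ))))).ae (reflectUnitary_ae ρ hε v)
  have h3 := (measurePreserving_glueEquiv ρ hε).quasiMeasurePreserving.ae
    (φ.coeFn_toLp 2 (volume : Measure (L → ℝ)))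
  filter_upwards [h1, h2, h3] with z h1 h2 h3
  simp only [Function.comp_apply, MeasurableEquiv.symm_apply_apply] at h2
  rw [glueEquiv_apply] at h3
  simp only [Prod.map_fst, Prod.map_snd, id_eq, h1, h2]
  rw [glueEquiv_apply, ← h3]
  simp only [Pi.star_apply, map_mul, RCLike.star_def, RingHomCompTriple.comp_apply, RingHom.id_apply]
  rfl

end Reflection

/-! ### Gaussian kernels as superpositions of product functions. -/

section GaussianKernel

open scoped Matrix

variable {ι : Type} [Fintype ι] [DecidableEq ι]

/-- The Gaussians `x ↦ exp(-½ x·Px + x·Bᵀt - ¼ t·t)`. -/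
noncomputable def shiftedGaussian (P B : Matrix ι ι ℝ) (t x : ι → ℝ) : ℝ :=
  Real.exp (-(1 / 2) * (x ⬝ᵥ P *ᵥ x) + x ⬝ᵥ Bᵀ *ᵥ t + -(1 / 4) * (t ⬝ᵥ t))

lemma continuous_uncurry_shiftedGaussian (P B : Matrix ι ι ℝ) :
    Continuous (Function.uncurry (shiftedGaussian P B)) := by
  simp only [Function.uncurry_def, shiftedGaussian, dotProduct, Matrix.mulVec]
  fun_prop

lemma memLp_shiftedGaussian {P : Matrix ι ι ℝ} (hP : P.PosDef) (B : Matrix ι ι ℝ) (t : ι → ℝ) :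
    MemLp (shiftedGaussian P B t) 2 volume := by
  obtain ⟨φ, hφ⟩ := exists_schwartzMap_gaussian (quadratic_pos_of_posDef hP) (Bᵀ *ᵥ t)
    (-(1 / 4) * (t ⬝ᵥ t))
  refine (φ.memLp 2 volume).re.congr_norm ?_ (.of_forall fun x => ?_)
  · exact ((continuous_uncurry_shiftedGaussian P B).comp
      (Continuous.prodMk_right t)).aestronglyMeasurable
  · rw [hφ]
    rfl

lemma exp_quadratic_completion (v t : ι → ℝ) :
    Real.exp (-(1 / 2) * (t ⬝ᵥ t) + v ⬝ᵥ t) =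
      Real.exp (1 / 2 * (v ⬝ᵥ v)) * Real.exp (-(1 / 2) * ((t - v) ⬝ᵥ (1 : Matrix ι ι ℝ) *ᵥ (t - v))) := by
  rw [← Real.exp_add, Matrix.one_mulVec, dotProduct_sub, sub_dotProduct, sub_dotProduct,
    dotProduct_comm t v]
  congr 1
  ring

lemma quadratic_sub_add_parallelogram (P : Matrix ι ι ℝ) (x y : ι → ℝ) :
    (x - y) ⬝ᵥ P *ᵥ (x - y) + (x + y) ⬝ᵥ P *ᵥ (x + y) =
      2 * (x ⬝ᵥ P *ᵥ x) + 2 * (y ⬝ᵥ P *ᵥ y) := by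
  simp only [Matrix.mulVec_sub, Matrix.mulVec_add, dotProduct_sub, sub_dotProduct, dotProduct_add,
    add_dotProduct]
  ring

/-- Completing the square in `t` around `v = B(x + y)` leaves `½ v·v = ¼ (x + y)·(P - Q)(x + y)`,
and the parallelogram identity for `P` converts the remaining terms to `x - y` and `x + y`. The
factor containing `t` has an integral independent of `x` and `y`. -/
lemma shiftedGaussian_mul {P Q B : Matrix ι ι ℝ} (hB : (1 / 2 : ℝ) • (P - Q) = Bᵀ * B)
    (t x y : ι → ℝ) : shiftedGaussian P B t x * shiftedGaussian P B t y =
      Real.exp (-(1 / 4) * ((x - y) ⬝ᵥ P *ᵥ (x - y)) + -(1 / 4) * ((x + y) ⬝ᵥ Q *ᵥ (x + y))) *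
      Real.exp (-(1 / 2) *
        ((t - B *ᵥ (x + y)) ⬝ᵥ (1 : Matrix ι ι ℝ) *ᵥ (t - B *ᵥ (x + y)))) := by
  have h1 := exp_quadratic_completion (B *ᵥ (x + y)) t
  have h2 : B *ᵥ (x + y) ⬝ᵥ B *ᵥ (x + y) =
      1 / 2 * ((x + y) ⬝ᵥ P *ᵥ (x + y) - (x + y) ⬝ᵥ Q *ᵥ (x + y)) := by
    rw [← quadratic_transpose_mul_self, ← hB, Matrix.smul_mulVec, Matrix.sub_mulVec,
      dotProduct_smul, dotProduct_sub, smul_eq_mul]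
  have h3 := quadratic_sub_add_parallelogram P x y
  have h4 : x ⬝ᵥ Bᵀ *ᵥ t + y ⬝ᵥ Bᵀ *ᵥ t = B *ᵥ (x + y) ⬝ᵥ t := by
    rw [← add_dotProduct, Matrix.dotProduct_mulVec, Matrix.vecMul_transpose]
  set K := (t - B *ᵥ (x + y)) ⬝ᵥ (1 : Matrix ι ι ℝ) *ᵥ (t - B *ᵥ (x + y))
  rw [← Real.exp_add, Real.exp_eq_exp] at h1
  rw [shiftedGaussian, shiftedGaussian, ← Real.exp_add, ← Real.exp_add]
  congr 1
  linear_combination h1 + 1 / 2 * h2 + 1 / 4 * h3 + h4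

lemma integrable_shiftedGaussian_mul {P Q B : Matrix ι ι ℝ}
    (hB : (1 / 2 : ℝ) • (P - Q) = Bᵀ * B) (x y : ι → ℝ) :
    Integrable fun t => shiftedGaussian P B t x * shiftedGaussian P B t y := by
  simp only [shiftedGaussian_mul hB]
  exact ((integrable_exp_neg_quadratic Matrix.PosDef.one (by norm_num)).comp_sub_right _).const_mul _

lemma integral_shiftedGaussian_mul {P Q B : Matrix ι ι ℝ}
    (hB : (1 / 2 : ℝ) • (P - Q) = Bᵀ * B) (x y : ι → ℝ) :
    ∫ t, shiftedGaussian P B t x * shiftedGaussian P B t y =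
      Real.exp (-(1 / 4) * ((x - y) ⬝ᵥ P *ᵥ (x - y)) + -(1 / 4) * ((x + y) ⬝ᵥ Q *ᵥ (x + y))) *
      √(Real.pi / (1 / 2)) ^ Fintype.card ι := by
  simp only [shiftedGaussian_mul hB]
  rw [integral_const_mul, integral_sub_right_eq_self (fun t : ι → ℝ =>
      Real.exp (-(1 / 2) * (t ⬝ᵥ (1 : Matrix ι ι ℝ) *ᵥ t))),
    integral_exp_neg_quadratic Matrix.PosDef.one, Matrix.det_one, Real.sqrt_one, div_one]

lemma integral_shiftedGaussian_sq {P Q B : Matrix ι ι ℝ}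
    (hB : (1 / 2 : ℝ) • (P - Q) = Bᵀ * B) (x : ι → ℝ) :
    ∫ t, shiftedGaussian P B t x ^ 2 =
      Real.exp (-1 * (x ⬝ᵥ Q *ᵥ x)) * √(Real.pi / (1 / 2)) ^ Fintype.card ι := by
  simp only [sq]
  rw [integral_shiftedGaussian_mul hB, sub_self, Matrix.mulVec_zero, dotProduct_zero, ← two_smul ℝ x,
    Matrix.mulVec_smul, dotProduct_smul, smul_dotProduct, smul_eq_mul, smul_eq_mul]
  congr 2
  ring

lemma integrable_shiftedGaussian_sq {P Q B : Matrix ι ι ℝ} (hQ : Q.PosDef)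
    (hB : (1 / 2 : ℝ) • (P - Q) = Bᵀ * B) :
    Integrable (fun p : (ι → ℝ) × (ι → ℝ) => shiftedGaussian P B p.1 p.2 ^ 2)
      (volume.prod volume) := by
  have hc : Continuous fun p : (ι → ℝ) × (ι → ℝ) => shiftedGaussian P B p.1 p.2 ^ 2 :=
    (continuous_uncurry_shiftedGaussian P B).pow 2
  rw [integrable_prod_iff' hc.aestronglyMeasurable]
  constructor
  · refine .of_forall fun x => ?_
    simpa only [sq] using integrable_shiftedGaussian_mul hB x x
  · simp only [norm_pow, Real.norm_eq_abs, sq_abs, integral_shiftedGaussian_sq hB]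
    exact (integrable_exp_neg_quadratic hQ one_pos).mul_const _

lemma integral_integral_shiftedGaussian_sq {P Q B : Matrix ι ι ℝ} (hQ : Q.PosDef)
    (hB : (1 / 2 : ℝ) • (P - Q) = Bᵀ * B) :
    ∫ t, ∫ x, shiftedGaussian P B t x ^ 2 =
      √Real.pi ^ Fintype.card ι / √Q.det * √(Real.pi / (1 / 2)) ^ Fintype.card ι := by
  rw [integral_integral_swap (integrable_shiftedGaussian_sq hQ hB)]
  simp only [integral_shiftedGaussian_sq hB]
  rw [integral_mul_const, integral_exp_neg_quadratic hQ, div_one]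

end GaussianKernel

/-! ### The sum of the Schmidt coefficients of a reflected Gaussian. -/

section GaussianSchmidt

open scoped Matrix

variable {L : Type} [Fintype L] [DecidableEq L] {I : Finset L}
  (ρ : {i : L // i ∈ I} ≃ {i : L // i ∉ I}) {ε : ℝ} (hε : ε * ε = 1)

lemma norm_sq_toSpace_gaussian {A : Matrix L L ℝ} {P Q : Matrix {i : L // i ∈ I} {i : L // i ∈ I} ℝ}
    (hP : P.PosDef) (hQ : Q.PosDef)
    (hA : ∀ z, glueEquiv ρ hε z ⬝ᵥ A *ᵥ glueEquiv ρ hε z =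
      1 / 2 * ((z.1 - z.2) ⬝ᵥ P *ᵥ (z.1 - z.2) + (z.1 + z.2) ⬝ᵥ Q *ᵥ (z.1 + z.2)))
    {φ : 𝓢(L → ℝ, ℂ)} (hφ : ∀ x, φ x = (Real.exp (-(1 / 2) * (x ⬝ᵥ A *ᵥ x)) : ℂ)) :
    ‖toSpace φ‖ ^ 2 = Real.pi ^ Fintype.card {i : L // i ∈ I} / √(P.det * Q.det) := by
  have h1 := integral_exp_neg_quadratic_sub_add hP hQ (s := 1 / 2) (by norm_num)
  have h2 : ((‖toSpace φ‖ ^ 2 : ℝ) : ℂ) = ((∫ z : ({i : L // i ∈ I} → ℝ) × ({i : L // i ∈ I} → ℝ),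
      Real.exp (-(1 / 2) * ((z.1 - z.2) ⬝ᵥ P *ᵥ (z.1 - z.2)) +
        -(1 / 2) * ((z.1 + z.2) ⬝ᵥ Q *ᵥ (z.1 + z.2))) ∂(volume.prod volume) : ℝ) : ℂ) := by
    have h3 := inner_self_eq_norm_sq_to_K (𝕜 := ℂ) (toSpace φ)
    rw [Complex.ofReal_pow]
    refine h3.symm.trans ?_
    rw [inner_toSpace, ← (measurePreserving_glueEquiv ρ hε).integral_comp', ← integral_complex_ofReal]
    refine integral_congr_ae (.of_forall fun z => ?_)
    simp only [hφ, Complex.conj_ofReal, ← Complex.ofReal_mul, ← Real.exp_add, hA]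
    congr 2
    ring
  rw [Complex.ofReal_inj.1 h2, h1, ← pow_mul, mul_comm _ 2, pow_mul, Real.sq_sqrt (by positivity),
    div_div_eq_mul_div, div_one, mul_pow]
  have := Real.sqrt_pos.2 (mul_pos hP.det_pos hQ.det_pos)
  field_simp

/-- Since `P - Q ≥ 0` has a factorisation `2 BᵀB`, the Gaussian is a positive kernel. Its trace is
proportional to `∫ exp(-x·Qx) dx`, of order `det Q ^ (-1/2)`, and its norm to `(det P det Q) ^
(-1/4)`; the quotient is the stated fourth root. -/
theorem exists_isSchmidt_gaussian {A : Matrix L L ℝ}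
    {P Q : Matrix {i : L // i ∈ I} {i : L // i ∈ I} ℝ}
    (hP : P.PosDef) (hQ : Q.PosDef) (hPQ : (P - Q).PosSemidef)
    (hA : ∀ z, glueEquiv ρ hε z ⬝ᵥ A *ᵥ glueEquiv ρ hε z =
      1 / 2 * ((z.1 - z.2) ⬝ᵥ P *ᵥ (z.1 - z.2) + (z.1 + z.2) ⬝ᵥ Q *ᵥ (z.1 + z.2)))
    {φ : 𝓢(L → ℝ, ℂ)} (hφ : ∀ x, φ x = (Real.exp (-(1 / 2) * (x ⬝ᵥ A *ᵥ x)) : ℂ)) :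
    ∃ (ι : Type) (a : HilbertBasis ι ℂ (SpaceIn I)) (b : HilbertBasis ι ℂ (SpaceOut I))
      (s : ι → ℝ), IsSchmidt (((‖toSpace φ‖⁻¹ : ℝ) : ℂ) • toSpace φ) a b s ∧
        ∑' j, ENNReal.ofReal (s j) = ENNReal.ofReal (√√(P.det / Q.det)) := by
  obtain ⟨B, hB⟩ := exists_eq_transpose_mul_self
    (hPQ.smul (show (0 : ℝ) ≤ 1 / 2 by norm_num))
  have hφ0 : 0 < ‖toSpace φ‖ := norm_pos_iff.2 (toSpace_gaussian_ne_zero hφ)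
  set κ : ℝ := √(Real.pi / (1 / 2)) ^ Fintype.card {i : L // i ∈ I} with hκ
  have hκ0 : 0 < κ := by positivity
  set k : ℝ := √(‖toSpace φ‖⁻¹ / κ) with hk
  have hk2 : k ^ 2 * κ = ‖toSpace φ‖⁻¹ := by
    rw [hk, Real.sq_sqrt (by positivity)]
    field_simp
  set g : ({i : L // i ∈ I} → ℝ) → ({i : L // i ∈ I} → ℝ) → ℝ :=
    fun t x => k * shiftedGaussian P B t x with hg
  have hgc : Continuous (Function.uncurry g) :=
    continuous_const.mul (continuous_uncurry_shiftedGaussian P B)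
  have hg2 : ∀ t, MemLp (g t) 2 volume := fun t => (memLp_shiftedGaussian hP B t).const_mul k
  have hgint : Integrable (fun p : _ × _ => g p.1 p.2 ^ 2) (volume.prod volume) := by
    simp only [hg, mul_pow]
    exact (integrable_shiftedGaussian_sq hQ hB).const_mul _
  set G : ({i : L // i ∈ I} → ℝ) → SpaceIn I := fun t => ((hg2 t).ofReal (K := ℂ)).toLp _ with hG
  have hGae : ∀ t, G t =ᵐ[volume] fun x => (g t x : ℂ) := fun t => MemLp.coeFn_toLp _
  have hinner : ∀ t (u : SpaceIn I), ⟪G t, u⟫_ℂ = ∫ x, u x * (g t x : ℂ) := fun t u => by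
    rw [L2.inner_def]
    refine integral_congr_ae ?_
    filter_upwards [hGae t] with x hx
    simp [hx]
  have hinner' : ∀ t (u : SpaceIn I),
      ⟪u, G t⟫_ℂ = ∫ x, starRingEnd ℂ (u x) * (g t x : ℂ) := fun t u => by
    rw [L2.inner_def]
    refine integral_congr_ae ?_
    filter_upwards [hGae t] with x hx
    simp [hx, mul_comm]
  have hnorm : ∀ t, ‖G t‖ ^ 2 = ∫ x, g t x ^ 2 := fun t => by
    have h1 := inner_self_eq_norm_sq_to_K (𝕜 := ℂ) (G t)
    rw [hinner] at h1
    have h2 : ∫ x, G t x * (g t x : ℂ) = ((∫ x, g t x ^ 2 : ℝ) : ℂ) := by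
      rw [← integral_complex_ofReal]
      refine integral_congr_ae ?_
      filter_upwards [hGae t] with x hx
      rw [hx]
      push_cast
      ring
    rw [h2] at h1
    exact Complex.ofReal_injective (h1.trans (Complex.ofReal_pow _ _).symm).symm
  have hnormint : Integrable fun t => ∫ x, g t x ^ 2 := hgint.integral_prod_left
  have key := exists_isSchmidt_of_kernel (V := reflectUnitary ρ hε)
    (ψ := ((‖toSpace φ‖⁻¹ : ℝ) : ℂ) • toSpace φ) (G := G) (ν := volume)
    (fun u => by
      simp only [hinner']
      have hm : StronglyMeasurable fun p : ({i : L // i ∈ I} → ℝ) × ({i : L // i ∈ I} → ℝ) =>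
          starRingEnd ℂ (u p.2) * (g p.1 p.2 : ℂ) := by
        refine StronglyMeasurable.mul ?_ (Complex.continuous_ofReal.comp hgc).stronglyMeasurable
        exact Complex.continuous_conj.comp_stronglyMeasurable
          ((Lp.stronglyMeasurable u).comp_measurable measurable_snd)
      exact hm.integral_prod_right'.aestronglyMeasurable)
    (by simpa only [hnorm] using hnormint)
    (fun u v => by
      rw [inner_smul_right, inner_tensor_reflectUnitary, ← integral_const_mul]
      simp only [hinner, hinner']
      have hvm : StronglyMeasurable fun x => starRingEnd ℂ (v x) :=
        Complex.continuous_conj.comp_stronglyMeasurable (Lp.stronglyMeasurable v)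
      rw [← integral_prod_kernel hgc.measurable hg2 hnormint (Lp.memLp u)
        (v := fun x => starRingEnd ℂ (v x)) (Lp.memLp v).star (Lp.stronglyMeasurable u) hvm]
      refine integral_congr_ae (.of_forall fun z => ?_)
      have h1 : ∫ t, g t z.1 * g t z.2 = ‖toSpace φ‖⁻¹ *
          Real.exp (-(1 / 2) * (glueEquiv ρ hε z ⬝ᵥ A *ᵥ glueEquiv ρ hε z)) := by
        have h2 : ∀ t, g t z.1 * g t z.2 =
            k ^ 2 * (shiftedGaussian P B t z.1 * shiftedGaussian P B t z.2) := fun t => by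
          simp only [hg]
          ring
        simp only [h2]
        rw [integral_const_mul, integral_shiftedGaussian_mul hB, hA, mul_left_comm, ← hκ, hk2,
          mul_comm]
        congr 2
        ring
      simp only [h1, hφ]
      push_cast
      ring)
  obtain ⟨ι, a, b, s, h1, h2⟩ := key
  refine ⟨ι, a, b, s, h1, h2.trans ?_⟩
  congr 1
  simp only [hnorm, hg, mul_pow, integral_const_mul]
  rw [integral_integral_shiftedGaussian_sq hQ hB, ← hκ]
  have h3 := norm_sq_toSpace_gaussian ρ hε hP hQ hA hφ
  have hp := hP.det_pos
  have hq := hQ.det_pos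
  have h4 : (√Real.pi ^ Fintype.card {i : L // i ∈ I} / √Q.det * ‖toSpace φ‖⁻¹) ^ 2 =
      √(P.det / Q.det) := by
    rw [mul_pow, inv_pow, h3, div_pow, ← pow_mul, mul_comm _ 2, pow_mul,
      Real.sq_sqrt Real.pi_pos.le, Real.sq_sqrt hq.le, Real.sqrt_mul hp.le, Real.sqrt_div hp.le]
    have h5 := Real.sqrt_pos.2 hp
    have h6 := Real.sqrt_pos.2 hq
    field_simp
    rw [Real.sq_sqrt hq.le]
  rw [← h4, Real.sqrt_sq (by positivity), ← hk2]
  ring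

end GaussianSchmidt

/-! ### Square roots of positive definite matrices. -/

section SquareRoot

open scoped Matrix

variable {ι : Type} [Fintype ι] [DecidableEq ι]

lemma exists_posDef_mul_self_eq {H : Matrix ι ι ℝ} (hH : H.PosDef) :
    ∃ P : Matrix ι ι ℝ, P.PosDef ∧ P * P = H := by
  open scoped MatrixOrder in
  have h0 : 0 ≤ CFC.sqrt H := CFC.sqrt_nonneg H
  have h1 : CFC.sqrt H * CFC.sqrt H = H := CFC.sqrt_mul_sqrt_self H hH.posSemidef.nonneg
  refine ⟨CFC.sqrt H, ?_, h1⟩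
  rw [(Matrix.nonneg_iff_posSemidef.1 h0).posDef_iff_det_ne_zero]
  intro h
  have h2 := hH.det_pos
  rw [← h1, Matrix.det_mul, h, zero_mul] at h2
  exact h2.false

/-- The square root is operator monotone. -/
lemma posSemidef_sub_of_mul_self {P Q : Matrix ι ι ℝ} (hP : P.PosDef) (hQ : Q.PosDef)
    (h : (P * P - Q * Q).PosSemidef) : (P - Q).PosSemidef := by
  have hH : (P - Q).IsHermitian := hP.isHermitian.sub hQ.isHermitian
  rw [hH.posSemidef_iff_eigenvalues_nonneg]
  intro j
  by_contra hj
  replace hj : hH.eigenvalues j < 0 := not_le.1 hj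
  set x : ι → ℝ := ⇑(hH.eigenvectorBasis j) with hx
  have hx0 : x ≠ 0 := by
    intro h0
    have h1 := hH.eigenvectorBasis.orthonormal.ne_zero j
    apply h1
    ext i
    exact congrFun h0 i
  have hx1 : (P - Q) *ᵥ x = hH.eigenvalues j • x := hH.mulVec_eigenvectorBasis j
  have hx2 : x ᵥ* (P - Q) = hH.eigenvalues j • x := by
    have h1 : (P - Q)ᵀ = P - Q := by simpa [Matrix.IsHermitian] using hH
    rw [← hx1, ← Matrix.vecMul_transpose, h1]
  have h1 := quadratic_pos_of_posDef (hP.add hQ) x hx0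
  have h2 : 0 ≤ x ⬝ᵥ (P * P - Q * Q) *ᵥ x := by simpa using h.dotProduct_mulVec_nonneg x
  -- On an eigenvector `x` of `P - Q` with eigenvalue `λ`, this form equals `λ x·(P + Q)x`, which
  -- would be negative for `λ < 0`.
  have h3 : P * P - Q * Q = (1 / 2 : ℝ) • ((P + Q) * (P - Q) + (P - Q) * (P + Q)) := by
    simp only [mul_add, add_mul, mul_sub, sub_mul]
    module
  rw [h3, Matrix.smul_mulVec, Matrix.add_mulVec, ← Matrix.mulVec_mulVec, ← Matrix.mulVec_mulVec,
    hx1, dotProduct_smul, dotProduct_add, Matrix.dotProduct_mulVec x (P - Q), hx2, Matrix.mulVec_smul,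
    dotProduct_smul, smul_dotProduct] at h2
  simp only [smul_eq_mul] at h2
  nlinarith

end SquareRoot

/-! ### Matrices symmetric under the reflection, and their ground states. -/

section ReflectionSymmetric

open scoped Matrix

variable {L : Type} [Fintype L] [DecidableEq L] {I : Finset L}
  (ρ : {i : L // i ∈ I} ≃ {i : L // i ∉ I}) {κ : Type*}

/-- The matrix of the restriction `x ↦ x|_I`. -/
def restrictMatrix (I : Finset L) : Matrix {i : L // i ∈ I} L ℝ :=
  Matrix.of fun j l => if (j : L) = l then 1 else 0

/-- The matrix of `x ↦ x|_O ∘ ρ`. -/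
def reflectMatrix : Matrix {i : L // i ∈ I} L ℝ :=
  Matrix.of fun j l => if (ρ j : L) = l then 1 else 0

/-- The matrix of `x ↦ x|_I + δ x|_O ∘ ρ`. -/
def foldMatrix (δ : ℝ) : Matrix {i : L // i ∈ I} L ℝ :=
  restrictMatrix I + δ • reflectMatrix ρ

lemma restrictMatrix_mul (Y : Matrix L κ ℝ) (i : {i : L // i ∈ I}) (k : κ) :
    (restrictMatrix I * Y) i k = Y i k := by
  simp [restrictMatrix, Matrix.mul_apply]

lemma reflectMatrix_mul (Y : Matrix L κ ℝ) (i : {i : L // i ∈ I}) (k : κ) :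
    (reflectMatrix ρ * Y) i k = Y (ρ i) k := by
  simp [reflectMatrix, Matrix.mul_apply]

lemma mul_restrictMatrix_transpose (Y : Matrix κ L ℝ) (i : {i : L // i ∈ I}) (k : κ) :
    (Y * (restrictMatrix I)ᵀ) k i = Y k i := by
  simp [restrictMatrix, Matrix.mul_apply]

lemma mul_reflectMatrix_transpose (Y : Matrix κ L ℝ) (i : {i : L // i ∈ I}) (k : κ) :
    (Y * (reflectMatrix ρ)ᵀ) k i = Y k (ρ i) := by
  simp [reflectMatrix, Matrix.mul_apply]

lemma foldMatrix_mulVec (δ : ℝ) (x : L → ℝ) (j : {i : L // i ∈ I}) :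
    (foldMatrix ρ δ *ᵥ x) j = x j + δ * x (ρ j) := by
  simp [foldMatrix, restrictMatrix, reflectMatrix, Matrix.mulVec, dotProduct, add_mul,
    Finset.sum_add_distrib]

lemma foldMatrix_mul_restrictMatrix_transpose (δ : ℝ) :
    foldMatrix ρ δ * (restrictMatrix I)ᵀ = 1 := by
  ext i j
  have : (ρ i : L) ≠ j := fun h => (ρ i).2 (h ▸ j.2)
  rw [mul_restrictMatrix_transpose]
  simp [foldMatrix, restrictMatrix, reflectMatrix, this, Matrix.one_apply]

lemma foldMatrix_mul_reflectMatrix_transpose (δ : ℝ) :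
    foldMatrix ρ δ * (reflectMatrix ρ)ᵀ = δ • 1 := by
  ext i j
  have h1 : (i : L) ≠ ρ j := fun h => (ρ j).2 (h ▸ i.2)
  have h2 : (ρ i : L) = ρ j ↔ i = j := by rw [← Subtype.ext_iff, ρ.injective.eq_iff]
  rw [mul_reflectMatrix_transpose]
  simp [foldMatrix, restrictMatrix, reflectMatrix, h1, h2, Matrix.one_apply]

/-- Together with `foldMatrix_mul_transpose_neg`: up to the factor `√2`, the matrices for `δ` and
`-δ` are the two blocks of an orthogonal change of coordinates to even and odd configurations. -/
lemma foldMatrix_mul_transpose {δ : ℝ} (hδ : δ * δ = 1) :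
    foldMatrix ρ δ * (foldMatrix ρ δ)ᵀ = (2 : ℝ) • 1 := by
  nth_rw 2 [foldMatrix]
  rw [Matrix.transpose_add, Matrix.transpose_smul, Matrix.mul_add, Matrix.mul_smul,
    foldMatrix_mul_restrictMatrix_transpose, foldMatrix_mul_reflectMatrix_transpose, smul_smul, hδ]
  module

lemma foldMatrix_mul_transpose_neg {δ : ℝ} (hδ : δ * δ = 1) :
    foldMatrix ρ δ * (foldMatrix ρ (-δ))ᵀ = 0 := by
  nth_rw 2 [foldMatrix]
  rw [Matrix.transpose_add, Matrix.transpose_smul, Matrix.mul_add, Matrix.mul_smul,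
    foldMatrix_mul_restrictMatrix_transpose, foldMatrix_mul_reflectMatrix_transpose, smul_smul,
    neg_mul, hδ]
  module

/-- The matrix `½ (D₊ᵀ P D₊ + D₋ᵀ Q D₋)`, where `D±` is `foldMatrix ρ (±δ)`. -/
noncomputable def unfoldMatrix (δ : ℝ) (P Q : Matrix {i : L // i ∈ I} {i : L // i ∈ I} ℝ) : Matrix L L ℝ :=
  (1 / 2 : ℝ) • ((foldMatrix ρ δ)ᵀ * P * foldMatrix ρ δ +
    (foldMatrix ρ (-δ))ᵀ * Q * foldMatrix ρ (-δ))

/-- In even and odd coordinates `unfoldMatrix` is block diagonal, hence multiplicative. A square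
root of `X` can therefore be taken block by block. -/
lemma unfoldMatrix_mul_unfoldMatrix {δ : ℝ} (hδ : δ * δ = 1)
    (P Q P' Q' : Matrix {i : L // i ∈ I} {i : L // i ∈ I} ℝ) :
    unfoldMatrix ρ δ P Q * unfoldMatrix ρ δ P' Q' = unfoldMatrix ρ δ (P * P') (Q * Q') := by
  have hδ' : -δ * -δ = 1 := by rw [neg_mul_neg, hδ]
  have h1 := foldMatrix_mul_transpose ρ hδ
  have h2 := foldMatrix_mul_transpose ρ hδ'
  have h3 := foldMatrix_mul_transpose_neg ρ hδ
  have h4 := foldMatrix_mul_transpose_neg ρ hδ'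
  rw [neg_neg] at h4
  simp only [unfoldMatrix]
  set D := foldMatrix ρ δ
  set D' := foldMatrix ρ (-δ)
  have e1 : ∀ U : Matrix {i : L // i ∈ I} L ℝ, D * (Dᵀ * U) = (2 : ℝ) • U := fun U => by
    rw [← Matrix.mul_assoc, h1, Matrix.smul_mul, Matrix.one_mul]
  have e2 : ∀ U : Matrix {i : L // i ∈ I} L ℝ, D' * (D'ᵀ * U) = (2 : ℝ) • U := fun U => by
    rw [← Matrix.mul_assoc, h2, Matrix.smul_mul, Matrix.one_mul]
  have e3 : ∀ U : Matrix {i : L // i ∈ I} L ℝ, D * (D'ᵀ * U) = 0 := fun U => by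
    rw [← Matrix.mul_assoc, h3, Matrix.zero_mul]
  have e4 : ∀ U : Matrix {i : L // i ∈ I} L ℝ, D' * (Dᵀ * U) = 0 := fun U => by
    rw [← Matrix.mul_assoc, h4, Matrix.zero_mul]
  simp only [Matrix.smul_mul, Matrix.mul_smul, Matrix.add_mul, Matrix.mul_add,
    Matrix.mul_assoc, e1, e2, e3, e4, Matrix.mul_zero]
  module

lemma transpose_unfoldMatrix (δ : ℝ) {P Q : Matrix {i : L // i ∈ I} {i : L // i ∈ I} ℝ}
    (hP : Pᵀ = P) (hQ : Qᵀ = Q) : (unfoldMatrix ρ δ P Q)ᵀ = unfoldMatrix ρ δ P Q := by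
  simp only [unfoldMatrix, Matrix.transpose_smul, Matrix.transpose_add, Matrix.transpose_mul,
    Matrix.transpose_transpose, hP, hQ, Matrix.mul_assoc]

lemma quadratic_unfoldMatrix (δ : ℝ) (P Q : Matrix {i : L // i ∈ I} {i : L // i ∈ I} ℝ) (x : L → ℝ) :
    x ⬝ᵥ unfoldMatrix ρ δ P Q *ᵥ x = 1 / 2 *
      ((foldMatrix ρ δ *ᵥ x) ⬝ᵥ P *ᵥ (foldMatrix ρ δ *ᵥ x) +
        (foldMatrix ρ (-δ) *ᵥ x) ⬝ᵥ Q *ᵥ (foldMatrix ρ (-δ) *ᵥ x)) := by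
  simp only [unfoldMatrix, Matrix.smul_mulVec, Matrix.add_mulVec, dotProduct_smul, dotProduct_add,
    smul_eq_mul, ← Matrix.mulVec_mulVec, Matrix.dotProduct_mulVec x (_)ᵀ, Matrix.vecMul_transpose]

/-- The block of `X` inside `I`. -/
def innerBlock (I : Finset L) (X : Matrix L L ℝ) : Matrix {i : L // i ∈ I} {i : L // i ∈ I} ℝ :=
  Matrix.of fun i j => X i j

/-- The block of `X` between `I` and its complement, the latter identified with `I`. -/
def crossBlock (X : Matrix L L ℝ) : Matrix {i : L // i ∈ I} {i : L // i ∈ I} ℝ :=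
  Matrix.of fun i j => X i (ρ j)

lemma restrictMatrix_mul_unfoldMatrix (δ : ℝ) (P Q : Matrix {i : L // i ∈ I} {i : L // i ∈ I} ℝ) :
    restrictMatrix I * unfoldMatrix ρ δ P Q =
      (1 / 2 : ℝ) • (P * foldMatrix ρ δ + Q * foldMatrix ρ (-δ)) := by
  have h : ∀ δ, restrictMatrix I * (foldMatrix ρ δ)ᵀ = 1 := fun δ => by
    rw [← Matrix.transpose_one, ← foldMatrix_mul_restrictMatrix_transpose ρ δ,
      Matrix.transpose_mul, Matrix.transpose_transpose]
  rw [unfoldMatrix, Matrix.mul_smul, Matrix.mul_add]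
  simp only [← Matrix.mul_assoc, h, Matrix.one_mul]

lemma reflectMatrix_mul_unfoldMatrix (δ : ℝ) (P Q : Matrix {i : L // i ∈ I} {i : L // i ∈ I} ℝ) :
    reflectMatrix ρ * unfoldMatrix ρ δ P Q =
      (δ / 2) • (P * foldMatrix ρ δ - Q * foldMatrix ρ (-δ)) := by
  have h : ∀ δ, reflectMatrix ρ * (foldMatrix ρ δ)ᵀ = δ • 1 := fun δ => by
    rw [← Matrix.transpose_one, ← Matrix.transpose_smul,
      ← foldMatrix_mul_reflectMatrix_transpose ρ δ,
      Matrix.transpose_mul, Matrix.transpose_transpose]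
  rw [unfoldMatrix, Matrix.mul_smul, Matrix.mul_add]
  simp only [← Matrix.mul_assoc, h, Matrix.one_mul, Matrix.smul_mul]
  module

/-- A matrix commuting with the reflection is block diagonal in even and odd coordinates; the proof
compares the four blocks of both sides. -/
lemma unfoldMatrix_eq_of_symmetric {X : Matrix L L ℝ} {δ : ℝ} (hδ : δ * δ = 1)
    (h1 : ∀ i j, X (ρ i) (ρ j) = X i j) (h2 : ∀ i j : {i : L // i ∈ I}, X (ρ i) j = X i (ρ j)) :
    unfoldMatrix ρ δ (innerBlock I X + δ • crossBlock ρ X) (innerBlock I X - δ • crossBlock ρ X) = X := by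
  set P := innerBlock I X + δ • crossBlock ρ X with hP
  set Q := innerBlock I X - δ • crossBlock ρ X with hQ
  have e1 : restrictMatrix I * unfoldMatrix ρ δ P Q * (restrictMatrix I)ᵀ = innerBlock I X := by
    rw [restrictMatrix_mul_unfoldMatrix, Matrix.smul_mul, Matrix.add_mul, Matrix.mul_assoc,
      Matrix.mul_assoc, foldMatrix_mul_restrictMatrix_transpose,
      foldMatrix_mul_restrictMatrix_transpose, Matrix.mul_one, Matrix.mul_one, hP, hQ]
    module
  have e2 : restrictMatrix I * unfoldMatrix ρ δ P Q * (reflectMatrix ρ)ᵀ = crossBlock ρ X := by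
    rw [restrictMatrix_mul_unfoldMatrix, Matrix.smul_mul, Matrix.add_mul, Matrix.mul_assoc,
      Matrix.mul_assoc, foldMatrix_mul_reflectMatrix_transpose,
      foldMatrix_mul_reflectMatrix_transpose, Matrix.mul_smul, Matrix.mul_smul, Matrix.mul_one,
      Matrix.mul_one, hP, hQ]
    linear_combination (norm := module) hδ • crossBlock ρ X
  have e3 : reflectMatrix ρ * unfoldMatrix ρ δ P Q * (restrictMatrix I)ᵀ = crossBlock ρ X := by
    rw [reflectMatrix_mul_unfoldMatrix, Matrix.smul_mul, Matrix.sub_mul, Matrix.mul_assoc,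
      Matrix.mul_assoc, foldMatrix_mul_restrictMatrix_transpose,
      foldMatrix_mul_restrictMatrix_transpose, Matrix.mul_one, Matrix.mul_one, hP, hQ]
    linear_combination (norm := module) hδ • crossBlock ρ X
  have e4 : reflectMatrix ρ * unfoldMatrix ρ δ P Q * (reflectMatrix ρ)ᵀ = innerBlock I X := by
    rw [reflectMatrix_mul_unfoldMatrix, Matrix.smul_mul, Matrix.sub_mul, Matrix.mul_assoc,
      Matrix.mul_assoc, foldMatrix_mul_reflectMatrix_transpose,
      foldMatrix_mul_reflectMatrix_transpose, Matrix.mul_smul, Matrix.mul_smul, Matrix.mul_one,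
      Matrix.mul_one, hP, hQ]
    linear_combination (norm := module) hδ • innerBlock I X
  have key : ∀ l : L, (∃ i : {i : L // i ∈ I}, l = i) ∨ ∃ i : {i : L // i ∈ I}, l = ρ i := fun l => by
    by_cases hl : l ∈ I
    · exact .inl ⟨⟨l, hl⟩, rfl⟩
    · exact .inr ⟨ρ.symm ⟨l, hl⟩, by simp⟩
  ext l l'
  rcases key l with ⟨i, rfl⟩ | ⟨i, rfl⟩ <;> rcases key l' with ⟨j, rfl⟩ | ⟨j, rfl⟩
  · have := congrFun₂ e1 i j
    rwa [mul_restrictMatrix_transpose, restrictMatrix_mul] at this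
  · have := congrFun₂ e2 i j
    rwa [mul_reflectMatrix_transpose, restrictMatrix_mul] at this
  · have := congrFun₂ e3 i j
    rw [mul_restrictMatrix_transpose, reflectMatrix_mul] at this
    rw [this, h2]
    rfl
  · have := congrFun₂ e4 i j
    rw [mul_reflectMatrix_transpose, reflectMatrix_mul] at this
    rw [this, h1]
    rfl

/-- The sign built into the gluing cancels the one in the folding. With `δ = -ε`, the first block of
`unfoldMatrix` therefore acts on `z.1 - z.2`. -/
lemma foldMatrix_mulVec_glueEquiv {ε : ℝ} (hε : ε * ε = 1)
    (z : ({i : L // i ∈ I} → ℝ) × ({i : L // i ∈ I} → ℝ)) :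
    foldMatrix ρ ε *ᵥ glueEquiv ρ hε z = z.1 + z.2 ∧
      foldMatrix ρ (-ε) *ᵥ glueEquiv ρ hε z = z.1 - z.2 := by
  constructor
  · ext j
    rw [foldMatrix_mulVec, glueEquiv_apply_in, glueEquiv_apply_out, Pi.add_apply]
    linear_combination hε * z.2 j
  · ext j
    rw [foldMatrix_mulVec, glueEquiv_apply_in, glueEquiv_apply_out, Pi.sub_apply]
    linear_combination -hε * z.2 j

lemma quadratic_unfoldMatrix_pos {ε : ℝ} (hε : ε * ε = 1)
    {P Q : Matrix {i : L // i ∈ I} {i : L // i ∈ I} ℝ}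
    (hP : P.PosDef) (hQ : Q.PosDef) (x : L → ℝ) (hx : x ≠ 0) :
    0 < x ⬝ᵥ unfoldMatrix ρ (-ε) P Q *ᵥ x := by
  have hP' : ∀ y, 0 ≤ y ⬝ᵥ P *ᵥ y := fun y => by
    simpa using hP.posSemidef.dotProduct_mulVec_nonneg y
  have hQ' : ∀ y, 0 ≤ y ⬝ᵥ Q *ᵥ y := fun y => by
    simpa using hQ.posSemidef.dotProduct_mulVec_nonneg y
  rw [quadratic_unfoldMatrix, neg_neg]
  obtain ⟨z, rfl⟩ := (glueEquiv ρ hε).surjective x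
  rw [(foldMatrix_mulVec_glueEquiv ρ hε z).1, (foldMatrix_mulVec_glueEquiv ρ hε z).2]
  by_cases h1 : z.1 - z.2 = 0
  · by_cases h2 : z.1 + z.2 = 0
    · exfalso
      apply hx
      have h3 : z.1 = 0 := by
        linear_combination (norm := module) (1 / 2 : ℝ) • h1 + (1 / 2 : ℝ) • h2
      have h4 : z.2 = 0 := by
        linear_combination (norm := module) (1 / 2 : ℝ) • h2 - (1 / 2 : ℝ) • h1
      ext l
      by_cases hl : l ∈ I
      · rw [glueEquiv_apply_in ρ hε z ⟨l, hl⟩, h3]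
        rfl
      · have := glueEquiv_apply_out ρ hε z (ρ.symm ⟨l, hl⟩)
        rw [Equiv.apply_symm_apply] at this
        rw [this, h4]
        simp
    · have := quadratic_pos_of_posDef hQ _ h2
      have := hP' (z.1 - z.2)
      positivity
  · have := quadratic_pos_of_posDef hP _ h1
    have := hQ' (z.1 + z.2)
    positivity

lemma pureState_smul_of_norm_eq {c d : ℂ} (h : ‖c‖ = ‖d‖) (ψ : Space L) :
    pureState (c • ψ) = pureState (d • ψ) := by
  ext1 x
  simp only [pureState, InnerProductSpace.rankOne_apply, inner_smul_left, smul_smul]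
  congr 1
  have h1 : starRingEnd ℂ c * c = starRingEnd ℂ d * d := by
    rw [Complex.conj_mul', Complex.conj_mul', h]
  linear_combination ⟪ψ, x⟫_ℂ * h1

/-- Ground states of a harmonic system that is symmetric under a reflection `ρ` exchanging the
two halves `I` and `O` of the lattice. -/
theorem entanglement_of_reflection_symmetric {X : Matrix L L ℝ} {ε : ℝ} (hε : ε * ε = 1)
    (h1 : ∀ i j, X (ρ i) (ρ j) = X i j) (h2 : ∀ i j : {i : L // i ∈ I}, X (ρ i) j = X i (ρ j))
    (hH : (innerBlock I X + (-ε) • crossBlock ρ X).PosDef)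
    (hK : (innerBlock I X - (-ε) • crossBlock ρ X).PosDef)
    (hB : ((-ε) • crossBlock ρ X).PosSemidef) :
    (∃ ψ : Space L, IsGroundState 1 X ψ) ∧ ∀ ψ : Space L, IsGroundState 1 X ψ →
      ((vonNeumannEntropy (partialTrace I (pureState ψ)) : ℝ≥0∞) : EReal) ≤
        logNegativity I (pureState ψ) ∧
      logNegativity I (pureState ψ) = ((1 / 4 * Real.logb 2
        ((innerBlock I X + (-ε) • crossBlock ρ X).det /
          (innerBlock I X - (-ε) • crossBlock ρ X).det) : ℝ) : EReal) := by
  have hδ : -ε * -ε = 1 := by rw [neg_mul_neg, hε]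
  obtain ⟨P, hP, hPH⟩ := exists_posDef_mul_self_eq hH
  obtain ⟨Q, hQ, hQK⟩ := exists_posDef_mul_self_eq hK
  set A := unfoldMatrix ρ (-ε) P Q with hAdef
  have hAX : X = A * A := by
    rw [unfoldMatrix_mul_unfoldMatrix ρ hδ, hPH, hQK, unfoldMatrix_eq_of_symmetric ρ hδ h1 h2]
  have hAt : Aᵀ = A := transpose_unfoldMatrix ρ _ (by simpa [Matrix.IsHermitian] using hP.isHermitian)
    (by simpa [Matrix.IsHermitian] using hQ.isHermitian)
  -- Here `P * P - Q * Q` is twice `-ε` times the cross block; this is where the sign condition on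
  -- the coupling between the halves enters.
  have hPQ : (P - Q).PosSemidef := by
    refine posSemidef_sub_of_mul_self hP hQ ?_
    rw [hPH, hQK]
    convert hB.smul (zero_le_two (α := ℝ)) using 1
    module
  have hA : ∀ z, glueEquiv ρ hε z ⬝ᵥ A *ᵥ glueEquiv ρ hε z =
      1 / 2 * ((z.1 - z.2) ⬝ᵥ P *ᵥ (z.1 - z.2) + (z.1 + z.2) ⬝ᵥ Q *ᵥ (z.1 + z.2)) := fun z => by
    rw [quadratic_unfoldMatrix, neg_neg, (foldMatrix_mulVec_glueEquiv ρ hε z).1,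
      (foldMatrix_mulVec_glueEquiv ρ hε z).2]
  obtain ⟨φ, hφ⟩ := exists_schwartzMap_gaussian (quadratic_unfoldMatrix_pos ρ hε hP hQ) 0 0
  simp only [dotProduct_zero, add_zero] at hφ
  have hφ0 := toSpace_gaussian_ne_zero hφ
  refine ⟨⟨_, hAX ▸ isGroundState_gaussian hAt hφ⟩, fun ψ hψ => ?_⟩
  obtain ⟨ι, a, b, s, hs, hτ⟩ := exists_isSchmidt_gaussian ρ hε hP hQ hPQ hA hφ
  -- By uniqueness, any ground state is the normalised Gaussian up to a phase, which the pure state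
  -- does not see.
  obtain ⟨c, rfl⟩ := exists_smul_gaussian_of_isGroundState hAt hφ (hAX ▸ hψ)
  have hc : ‖c‖ = ‖((‖toSpace φ‖⁻¹ : ℝ) : ℂ)‖ := by
    have h := hψ.1
    rw [norm_smul] at h
    rw [Complex.norm_real, norm_inv, norm_norm]
    exact eq_inv_of_mul_eq_one_left h
  have hnorm : ‖((‖toSpace φ‖⁻¹ : ℝ) : ℂ) • toSpace φ‖ = 1 := by
    rw [norm_smul, ← hc, ← norm_smul, hψ.1]
  have hp := hP.det_pos
  have hq := hQ.det_pos
  have hr : 0 < P.det / Q.det := div_pos hp hq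
  have hτ0 : 0 < √√(P.det / Q.det) := by positivity
  have hlog : 2 * Real.logb 2 √√(P.det / Q.det) = 1 / 4 * Real.logb 2
      ((innerBlock I X + (-ε) • crossBlock ρ X).det /
        (innerBlock I X - (-ε) • crossBlock ρ X).det) := by
    rw [← hPH, ← hQK, Matrix.det_mul, Matrix.det_mul, mul_div_mul_comm, ← sq, Real.logb_pow,
      Real.logb, Real.log_sqrt (by positivity), Real.log_sqrt hr.le, Real.logb]
    push_cast
    ring
  rw [pureState_smul_of_norm_eq hc, hs.logNegativity_eq hτ0 hτ, ← hlog]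
  exact ⟨hs.vonNeumannEntropy_le hnorm hτ0 hτ, rfl⟩

end ReflectionSymmetric

/-! ### Largest and smallest eigenvalue of the chain coupling. -/

section Spectrum

open scoped Matrix

variable {N : ℕ} [NeZero N]

lemma chainCoupling_mulVec (hN : 3 ≤ N) (a b : ℝ) (x : Fin N → ℝ) (i : Fin N) :
    (chainCoupling N a b *ᵥ x) i = a * x i + b * x (i - 1) + b * x (i + 1) := by
  -- The residues `0`, `1` and `-1` are distinct because `N ≥ 3`.
  have h1 : ∀ k : Fin N, (if k.val = 0 then a else if k.val = 1 ∨ k.val = N - 1 then b else 0) =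
      (if k = 0 then a else 0) + (if k = 1 then b else 0) + (if k = -1 then b else 0) := fun k => by
    have e1 : k = 0 ↔ k.val = 0 := by rw [Fin.ext_iff, Fin.val_zero]
    have e2 : k = 1 ↔ k.val = 1 := by
      rw [Fin.ext_iff, Fin.val_one', Nat.mod_eq_of_lt (by omega)]
    have e3 : k = -1 ↔ k.val = N - 1 := by
      rw [Fin.ext_iff, Fin.val_neg', Fin.val_one', Nat.mod_eq_of_lt (by omega : 1 < N),
        Nat.mod_eq_of_lt (by omega)]
    simp only [e1, e2, e3]
    split_ifs <;> first | omega | simp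
  have h2 : (chainCoupling N a b *ᵥ x) i =
      ∑ k, (if k.val = 0 then a else if k.val = 1 ∨ k.val = N - 1 then b else 0) * x (i - k) := by
    rw [Matrix.mulVec, dotProduct]
    refine Fintype.sum_equiv (Equiv.subLeft i) _ _ fun j => ?_
    simp only [chainCoupling, Matrix.circulant_apply, Equiv.subLeft_apply, sub_sub_cancel]
  rw [h2]
  simp only [h1, add_mul, Finset.sum_add_distrib, ite_mul, zero_mul, Finset.sum_ite_eq',
    Finset.mem_univ, if_true, sub_zero, sub_neg_eq_add]

/-- The difference is `b` times the sum of the two cyclic shifts, which are isometries. -/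
lemma norm_toEuclideanCLM_chainCoupling_sub_le (hN : 3 ≤ N) (a b : ℝ)
    (x : EuclideanSpace ℝ (Fin N)) :
    ‖Matrix.toEuclideanCLM (𝕜 := ℝ) (chainCoupling N a b) x - a • x‖ ≤ 2 * |b| * ‖x‖ := by
  have h1 : Matrix.toEuclideanCLM (𝕜 := ℝ) (chainCoupling N a b) x - a • x =
      b • LinearIsometryEquiv.piLpCongrLeft 2 ℝ ℝ (Equiv.addRight (1 : Fin N)) x +
        b • LinearIsometryEquiv.piLpCongrLeft 2 ℝ ℝ (Equiv.subRight (1 : Fin N)) x := by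
    ext i
    have := chainCoupling_mulVec hN a b x.ofLp i
    simp [Matrix.ofLp_toEuclideanCLM, this, LinearIsometryEquiv.piLpCongrLeft_apply,
      Equiv.piCongrLeft', sub_eq_add_neg]
    ring
  rw [h1]
  refine (norm_add_le _ _).trans_eq ?_
  rw [norm_smul, norm_smul, LinearIsometryEquiv.norm_map, LinearIsometryEquiv.norm_map,
    Real.norm_eq_abs]
  ring

lemma toEuclideanCLM_chainCoupling_eigenvector (hN : 3 ≤ N) (a b : ℝ) {δ : ℝ}
    {w : Fin N → ℝ} (hw : ∀ i, w (i + 1) = δ * w i) (hδ : δ * δ = 1) :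
    Matrix.toEuclideanCLM (𝕜 := ℝ) (chainCoupling N a b) (WithLp.toLp 2 w) =
      (a + 2 * (δ * b)) • WithLp.toLp 2 w := by
  ext i
  have h1 := chainCoupling_mulVec hN a b w i
  have h2 : w (i - 1) = δ * w i := by
    have := hw (i - 1)
    rw [sub_add_cancel] at this
    rw [this, ← mul_assoc, hδ, one_mul]
  simp [h1, h2, hw]
  ring

/-- The powers `δ ^ i` close up around the ring since `δ ^ N = 1` for even `N`. These vectors attain
the extremal eigenvalues `a ± 2|b|`. -/
lemma exists_alternating (hN : Even N) {δ : ℝ} (hδ : δ = 1 ∨ δ = -1) :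
    ∃ w : Fin N → ℝ, (∀ i, w (i + 1) = δ * w i) ∧ w ≠ 0 := by
  refine ⟨fun i => δ ^ i.val, fun i => ?_, fun h => ?_⟩
  · have hN1 : δ ^ N = 1 := by
      rcases hδ with rfl | rfl
      · exact one_pow _
      · exact hN.neg_one_pow
    simp only
    rw [Fin.val_add, Fin.val_one', ← pow_succ']
    have h1 : ∀ k, δ ^ (k % N) = δ ^ k := fun k => by
      conv_rhs => rw [← Nat.div_add_mod k N, pow_add, pow_mul, hN1, one_pow, one_mul]
    rw [h1, pow_add, h1, pow_one, pow_succ]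
  · have h0 := congrFun h 0
    simp at h0

lemma opNorm_chainCoupling (hN : Even N) (hN3 : 3 ≤ N) {a b : ℝ} (hab : 2 * |b| < a) :
    opNorm (chainCoupling N a b) = a + 2 * |b| := by
  have ha : 0 ≤ a := by linarith [abs_nonneg b]
  refine le_antisymm (ContinuousLinearMap.opNorm_le_bound _ (by positivity) fun x => ?_) ?_
  · have h1 := norm_toEuclideanCLM_chainCoupling_sub_le hN3 a b x
    have h2 := norm_le_norm_sub_add (Matrix.toEuclideanCLM (𝕜 := ℝ) (chainCoupling N a b) x) (a • x)
    rw [norm_smul, Real.norm_of_nonneg ha] at h2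
    linarith
  · obtain ⟨δ, hδ, hδb⟩ : ∃ δ : ℝ, (δ = 1 ∨ δ = -1) ∧ δ * b = |b| := by
      rcases abs_choice b with h | h
      · exact ⟨1, .inl rfl, by rw [h, one_mul]⟩
      · exact ⟨-1, .inr rfl, by rw [h, neg_one_mul]⟩
    obtain ⟨w, hw, hw0⟩ := exists_alternating hN hδ
    have h1 := toEuclideanCLM_chainCoupling_eigenvector hN3 a b hw (mul_self_eq_one_iff.2 hδ)
    have h2 := ContinuousLinearMap.le_opNorm
      (Matrix.toEuclideanCLM (𝕜 := ℝ) (chainCoupling N a b)) (WithLp.toLp 2 w)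
    rw [h1, hδb, norm_smul, Real.norm_of_nonneg (by positivity)] at h2
    refine le_of_mul_le_mul_right h2 (norm_pos_iff.2 fun h => hw0 ?_)
    simpa using h

lemma lambdaMin_chainCoupling (hN : Even N) (hN3 : 3 ≤ N) (a b : ℝ) :
    lambdaMin (chainCoupling N a b) = a - 2 * |b| := by
  have hspec : ∀ μ : ℝ, μ ∈ spectrum ℝ (chainCoupling N a b) ↔
      ∃ x : EuclideanSpace ℝ (Fin N), x ≠ 0 ∧
        Matrix.toEuclideanCLM (𝕜 := ℝ) (chainCoupling N a b) x = μ • x := fun μ => by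
    rw [← Matrix.spectrum_toLpLin 2, ← Module.End.hasEigenvalue_iff_mem_spectrum]
    constructor
    · intro h
      obtain ⟨x, hx⟩ := h.exists_hasEigenvector
      exact ⟨x, hx.2, hx.apply_eq_smul⟩
    · rintro ⟨x, hx0, hx⟩
      exact Module.End.hasEigenvalue_of_hasEigenvector
        ⟨Module.End.mem_eigenspace_iff.2 hx, hx0⟩
  refine IsLeast.csInf_eq ⟨?_, fun μ hμ => ?_⟩
  · obtain ⟨δ, hδ, hδb⟩ : ∃ δ : ℝ, (δ = 1 ∨ δ = -1) ∧ δ * b = -|b| := by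
      rcases abs_choice b with h | h
      · exact ⟨-1, .inr rfl, by rw [h, neg_one_mul]⟩
      · exact ⟨1, .inl rfl, by rw [h, one_mul, neg_neg]⟩
    obtain ⟨w, hw, hw0⟩ := exists_alternating hN hδ
    refine (hspec _).2 ⟨WithLp.toLp 2 w, fun h => hw0 (by simpa using h), ?_⟩
    rw [toEuclideanCLM_chainCoupling_eigenvector hN3 a b hw (mul_self_eq_one_iff.2 hδ), hδb]
    congr 1
    ring
  · obtain ⟨x, hx0, hx⟩ := (hspec μ).1 hμ
    have h1 := norm_toEuclideanCLM_chainCoupling_sub_le hN3 a b x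
    rw [hx, ← sub_smul, norm_smul, Real.norm_eq_abs] at h1
    have h2 := le_of_mul_le_mul_right h1 (norm_pos_iff.2 hx0)
    linarith [neg_abs_le (μ - a)]

end Spectrum

/-! ### The half-chain of a ring with `2(n + 1)` sites. -/

section HalfChain

open scoped Matrix

variable {n : ℕ}

lemma mem_halfChain {N : ℕ} (i : Fin N) : i ∈ halfChain N ↔ i.val < N / 2 := by
  simp [halfChain]

lemma chainCoupling_apply {N : ℕ} (hN : 3 ≤ N) (a b : ℝ) (i j : Fin N) :
    chainCoupling N a b i j = if i.val = j.val then a else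
      if i.val = j.val + 1 ∨ j.val = i.val + 1 ∨ (i.val = 0 ∧ j.val = N - 1) ∨
        (j.val = 0 ∧ i.val = N - 1) then b else 0 := by
  rw [chainCoupling, Matrix.circulant_apply]
  have hi := i.isLt
  have hj := j.isLt
  rcases le_or_gt j i with h | h
  · rw [Fin.sub_val_of_le h]
    have h' : j.val ≤ i.val := h
    split_ifs <;> first | rfl | omega
  · rw [Fin.coe_sub_iff_lt.2 h]
    have h' : i.val < j.val := h
    split_ifs <;> first | rfl | omega

/-- The reflection `i ↦ N + 1 - i` of the chain exchanges its two halves. -/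
def halfChainReflection (n : ℕ) : {i : Fin (n + 1 + (n + 1)) // i ∈ halfChain (n + 1 + (n + 1))} ≃
    {i : Fin (n + 1 + (n + 1)) // i ∉ halfChain (n + 1 + (n + 1))} :=
  Fin.revPerm.subtypeEquiv fun i => by
    rw [mem_halfChain, mem_halfChain, Fin.revPerm_apply, Fin.val_rev]
    omega

lemma val_halfChainReflection (i : {i : Fin (n + 1 + (n + 1)) // i ∈ halfChain (n + 1 + (n + 1))}) :
    (halfChainReflection n i : Fin (n + 1 + (n + 1))).val = 2 * n + 1 - i.1.val := by
  have : (halfChainReflection n i : Fin (n + 1 + (n + 1))) = Fin.rev i.1 := rfl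
  rw [this, Fin.val_rev]
  omega

lemma val_le_of_mem_halfChain
    (i : {i : Fin (n + 1 + (n + 1)) // i ∈ halfChain (n + 1 + (n + 1))}) : i.1.val ≤ n := by
  have := (mem_halfChain _).1 i.2
  omega

/-- The site with number `k` of the half-chain. -/
def halfChainSite (k : ℕ) (hk : k ≤ n) :
    {i : Fin (n + 1 + (n + 1)) // i ∈ halfChain (n + 1 + (n + 1))} :=
  ⟨⟨k, by omega⟩, (mem_halfChain _).2 (by simp only; omega)⟩

lemma card_halfChain :
    Fintype.card {i : Fin (n + 1 + (n + 1)) // i ∈ halfChain (n + 1 + (n + 1))} = n + 1 := by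
  refine (Fintype.card_congr ?_).trans (Fintype.card_fin (n + 1))
  exact
    { toFun := fun i => ⟨i.1.val, Nat.lt_succ_of_le (val_le_of_mem_halfChain i)⟩
      invFun := fun k => halfChainSite k.val (Nat.le_of_lt_succ k.isLt)
      left_inv := fun i => rfl
      right_inv := fun k => rfl }

/-- The incidence matrix of the half-chain: its `k`-th column is `e_k + δ e_{k+1}`. -/
def incidence (n : ℕ) (δ : ℝ) :
    Matrix {i : Fin (n + 1 + (n + 1)) // i ∈ halfChain (n + 1 + (n + 1))} (Fin n) ℝ :=
  Matrix.of fun i k => (if i.1.val = k.val then 1 else 0) +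
    δ * (if i.1.val = k.val + 1 then 1 else 0)

/-- For `δ = ±1` this is a signed Laplacian of the path `0, …, n`: its diagonal counts the
neighbours, so the end points miss one. -/
lemma incidence_mul_transpose_apply (δ : ℝ)
    (i j : {i : Fin (n + 1 + (n + 1)) // i ∈ halfChain (n + 1 + (n + 1))}) :
    (incidence n δ * (incidence n δ)ᵀ) i j =
      (if i.1.val = j.1.val then
        (if i.1.val = n then 0 else 1) + δ * δ * (if i.1.val = 0 then 0 else 1) else 0) +
      δ * ((if j.1.val = i.1.val + 1 then 1 else 0) + (if i.1.val = j.1.val + 1 then 1 else 0)) := by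
  have hi := val_le_of_mem_halfChain i
  have hj := val_le_of_mem_halfChain j
  have h1 : ∀ (p : ℕ) (f : ℕ → ℝ), p ≤ n →
      ∑ k : Fin n, (if p = k.val then 1 else 0) * f k.val = if p = n then 0 else f p := by
    intro p f hp
    split_ifs with h
    · exact Finset.sum_eq_zero fun k _ => by rw [if_neg (by omega), zero_mul]
    · rw [Finset.sum_eq_single ⟨p, by omega⟩ (fun k _ hk => by
        rw [if_neg (fun h' => hk (Fin.ext h'.symm)), zero_mul]) (by simp)]
      simp
  have h2 : ∀ (p : ℕ) (f : ℕ → ℝ), p ≤ n →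
      ∑ k : Fin n, (if p = k.val + 1 then 1 else 0) * f k.val = if p = 0 then 0 else f (p - 1) := by
    intro p f hp
    split_ifs with h
    · exact Finset.sum_eq_zero fun k _ => by rw [if_neg (by omega), zero_mul]
    · rw [Finset.sum_eq_single ⟨p - 1, by omega⟩ (fun k _ hk => by
        rw [if_neg (fun h' => hk (Fin.ext (by simp only; omega))), zero_mul]) (by simp)]
      rw [if_pos (by simp only; omega), one_mul]
  simp only [Matrix.mul_apply, incidence, Matrix.transpose_apply, Matrix.of_apply]
  simp only [add_mul, Finset.sum_add_distrib, mul_assoc, ← Finset.mul_sum]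
  rw [h1 _ (fun k => (if j.1.val = k then 1 else 0) + δ * (if j.1.val = k + 1 then 1 else 0)) hi,
    h2 _ (fun k => (if j.1.val = k then 1 else 0) + δ * (if j.1.val = k + 1 then 1 else 0)) hi]
  split_ifs <;> first | omega | simp only [mul_zero, mul_one, zero_add, add_zero]

/-- Adjacent columns overlap with inner product `δ` and `-δ` respectively, so these terms cancel,
while every column has squared norm `2`. -/
lemma transpose_mul_incidence_add (δ : ℝ) (hδ : δ * δ = 1) :
    (incidence n δ)ᵀ * incidence n δ + (incidence n (-δ))ᵀ * incidence n (-δ) = (4 : ℝ) • 1 := by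
  have h1 : ∀ (p : ℕ) (hp : p ≤ n) (f : ℕ → ℝ),
      ∑ i : {i : Fin (n + 1 + (n + 1)) // i ∈ halfChain (n + 1 + (n + 1))},
        (if i.1.val = p then 1 else 0) * f i.1.val = f p := by
    intro p hp f
    rw [Finset.sum_eq_single (halfChainSite p hp) (fun k _ hk => by
      rw [if_neg (fun h' : k.1.val = p => hk (Subtype.ext (Fin.ext h'))), zero_mul]) (by simp)]
    simp [halfChainSite]
  ext k l
  have hk := k.isLt
  have h2 := h1 k.val hk.le fun i => if i = l.val then 1 else 0
  have h3 := h1 (k.val + 1) hk fun i => if i = l.val + 1 then 1 else 0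
  have h4 : ((4 : ℝ) • (1 : Matrix (Fin n) (Fin n) ℝ)) k l = if k.val = l.val then 4 else 0 := by
    simp [Matrix.one_apply, Fin.ext_iff]
  rw [h4, Matrix.add_apply, Matrix.mul_apply, Matrix.mul_apply, ← Finset.sum_add_distrib]
  calc _ = ∑ i : {i : Fin (n + 1 + (n + 1)) // i ∈ halfChain (n + 1 + (n + 1))},
        (2 * ((if i.1.val = k.val then 1 else 0) * (if i.1.val = l.val then 1 else 0)) +
          2 * ((if i.1.val = k.val + 1 then 1 else 0) *
            (if i.1.val = l.val + 1 then (1 : ℝ) else 0))) := by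
        refine Finset.sum_congr rfl fun i _ => ?_
        simp only [incidence, Matrix.transpose_apply, Matrix.of_apply]
        linear_combination 2 * ((if i.1.val = k.val + 1 then 1 else 0) *
            (if i.1.val = l.val + 1 then (1 : ℝ) else 0)) * hδ
    _ = _ := by
        rw [Finset.sum_add_distrib, ← Finset.mul_sum, ← Finset.mul_sum, h2, h3]
        split_ifs <;> first | omega | norm_num

/-- Sylvester's determinant identity; the size difference of one leaves a single factor `c`. -/
lemma det_smul_one_add_mul_transpose {ι κ : Type*} [Fintype ι] [Fintype κ] [DecidableEq ι]
    [DecidableEq κ] (hcard : Fintype.card ι = Fintype.card κ + 1) {c : ℝ} (hc : c ≠ 0) (β : ℝ)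
    (M : Matrix ι κ ℝ) :
    (c • 1 + β • (M * Mᵀ)).det = c * (c • 1 + β • (Mᵀ * M)).det := by
  have h1 : c • (1 : Matrix ι ι ℝ) + β • (M * Mᵀ) = c • (1 + (c⁻¹ * β) • M * Mᵀ) := by
    rw [smul_add, Matrix.smul_mul, smul_smul, mul_inv_cancel_left₀ hc]
  have h2 : c • (1 : Matrix κ κ ℝ) + β • (Mᵀ * M) = c • (1 + Mᵀ * (c⁻¹ * β) • M) := by
    rw [smul_add, Matrix.mul_smul, smul_smul, mul_inv_cancel_left₀ hc]
  rw [h1, h2, Matrix.det_smul, Matrix.det_smul, Matrix.det_one_add_mul_comm, hcard, pow_succ]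
  ring

lemma diagonal_halfChain_apply
    (d : {i : Fin (n + 1 + (n + 1)) // i ∈ halfChain (n + 1 + (n + 1))} → ℝ) (i j) :
    Matrix.diagonal d i j = if i.1.val = j.1.val then d i else 0 := by
  rw [Matrix.diagonal_apply]
  exact if_congr (by rw [Subtype.ext_iff, Fin.ext_iff]) rfl rfl

/-- The only bonds between the halves join `n` to `n + 1` and `0` to the last site. Both join a site
to its mirror image, so the cross block is diagonal and supported at the ends, which are distinct as
`1 ≤ n`. Its `±|b|` is exactly the degree defect of the path Laplacian at the end points. -/
lemma halfChain_blocks (hn : 1 ≤ n) {a b δ : ℝ} (hδ : δ * δ = 1) (hδb : δ * b = |b|) :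
    innerBlock (halfChain (n + 1 + (n + 1))) (chainCoupling (n + 1 + (n + 1)) a b) -
        δ • crossBlock (halfChainReflection n) (chainCoupling (n + 1 + (n + 1)) a b) =
      (a - 2 * |b|) • 1 + |b| • (incidence n δ * (incidence n δ)ᵀ) ∧
    innerBlock (halfChain (n + 1 + (n + 1))) (chainCoupling (n + 1 + (n + 1)) a b) +
        δ • crossBlock (halfChainReflection n) (chainCoupling (n + 1 + (n + 1)) a b) =
      (a + 2 * |b|) • 1 + (-|b|) • (incidence n (-δ) * (incidence n (-δ))ᵀ) ∧
    δ • crossBlock (halfChainReflection n) (chainCoupling (n + 1 + (n + 1)) a b) =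
      Matrix.diagonal fun i => if i.1.val = 0 ∨ i.1.val = n then |b| else 0 := by
  have hb : δ * |b| = b := by rw [← hδb, ← mul_assoc, hδ, one_mul]
  have hN : 3 ≤ n + 1 + (n + 1) := by omega
  have hcross : δ • crossBlock (halfChainReflection n) (chainCoupling (n + 1 + (n + 1)) a b) =
      Matrix.diagonal fun i => if i.1.val = 0 ∨ i.1.val = n then |b| else 0 := by
    ext i j
    have hi := val_le_of_mem_halfChain i
    have hj := val_le_of_mem_halfChain j
    rw [Matrix.smul_apply, crossBlock, Matrix.of_apply, chainCoupling_apply hN,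
      val_halfChainReflection, diagonal_halfChain_apply, ← hδb]
    split_ifs <;> first | omega | simp
  have hone : ∀ i j : {i : Fin (n + 1 + (n + 1)) // i ∈ halfChain (n + 1 + (n + 1))},
      (1 : Matrix _ _ ℝ) i j = if i.1.val = j.1.val then 1 else 0 := fun i j => by
    rw [← Matrix.diagonal_one, diagonal_halfChain_apply]
  refine ⟨?_, ?_, hcross⟩
  · rw [hcross]
    ext i j
    have hi := val_le_of_mem_halfChain i
    have hj := val_le_of_mem_halfChain j
    rw [Matrix.sub_apply, Matrix.add_apply, Matrix.smul_apply, Matrix.smul_apply,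
      incidence_mul_transpose_apply, hone, innerBlock, Matrix.of_apply, chainCoupling_apply hN,
      diagonal_halfChain_apply, hδ]
    simp only [smul_eq_mul]
    split_ifs <;> first | omega | linarith
  · rw [hcross]
    ext i j
    have hi := val_le_of_mem_halfChain i
    have hj := val_le_of_mem_halfChain j
    rw [Matrix.add_apply, Matrix.add_apply, Matrix.smul_apply, Matrix.smul_apply,
      incidence_mul_transpose_apply, hone, innerBlock, Matrix.of_apply, chainCoupling_apply hN,
      diagonal_halfChain_apply, neg_mul_neg, hδ]
    simp only [smul_eq_mul]
    split_ifs <;> first | omega | linarith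

theorem entanglement_halfChain (hn : 1 ≤ n) {a b : ℝ} (hab : 2 * |b| < a) :
    (∃ ψ : Space (Fin (n + 1 + (n + 1))),
      IsGroundState 1 (chainCoupling (n + 1 + (n + 1)) a b) ψ) ∧
    ∀ ψ : Space (Fin (n + 1 + (n + 1))),
      IsGroundState 1 (chainCoupling (n + 1 + (n + 1)) a b) ψ →
      ((vonNeumannEntropy (partialTrace (halfChain (n + 1 + (n + 1))) (pureState ψ)) : ℝ≥0∞) :
          EReal) ≤ logNegativity (halfChain (n + 1 + (n + 1))) (pureState ψ) ∧
      logNegativity (halfChain (n + 1 + (n + 1))) (pureState ψ) =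
        ((1 / 4 * Real.logb 2 ((a + 2 * |b|) / (a - 2 * |b|)) : ℝ) : EReal) := by
  -- The sign of the gluing is opposed to that of `b`, which makes `-ε` times the cross block
  -- positive.
  obtain ⟨ε, hε, hεb⟩ : ∃ ε : ℝ, ε * ε = 1 ∧ -ε * b = |b| := by
    rcases abs_choice b with h | h
    · exact ⟨-1, by norm_num, by rw [h]; ring⟩
    · exact ⟨1, by norm_num, by rw [h]; ring⟩
  have hδ : -ε * -ε = 1 := by rw [neg_mul_neg, hε]
  obtain ⟨hlow, hhigh, hcross⟩ := halfChain_blocks hn (a := a) hδ hεb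
  have hN : 3 ≤ n + 1 + (n + 1) := by omega
  have hb := abs_nonneg b
  have hlowpos : (innerBlock (halfChain (n + 1 + (n + 1))) (chainCoupling (n + 1 + (n + 1)) a b) -
      (-ε) • crossBlock (halfChainReflection n) (chainCoupling (n + 1 + (n + 1)) a b)).PosDef := by
    rw [hlow]
    refine (Matrix.PosDef.one.smul (by linarith)).add_posSemidef (Matrix.PosSemidef.smul ?_ hb)
    simpa using Matrix.posSemidef_self_mul_conjTranspose (incidence n (-ε))
  have hcrosspos : ((-ε) • crossBlock (halfChainReflection n)
      (chainCoupling (n + 1 + (n + 1)) a b)).PosSemidef := by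
    rw [hcross]
    exact Matrix.PosSemidef.diagonal fun i => by
      simp only [Pi.zero_apply]
      split_ifs <;> simp
  have hhighpos : (innerBlock (halfChain (n + 1 + (n + 1))) (chainCoupling (n + 1 + (n + 1)) a b) +
      (-ε) • crossBlock (halfChainReflection n) (chainCoupling (n + 1 + (n + 1)) a b)).PosDef := by
    convert hlowpos.add_posSemidef (hcrosspos.smul (zero_le_two (α := ℝ))) using 1
    module
  have hdet : (innerBlock (halfChain (n + 1 + (n + 1))) (chainCoupling (n + 1 + (n + 1)) a b) +
      (-ε) • crossBlock (halfChainReflection n) (chainCoupling (n + 1 + (n + 1)) a b)).det /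
      (innerBlock (halfChain (n + 1 + (n + 1))) (chainCoupling (n + 1 + (n + 1)) a b) -
      (-ε) • crossBlock (halfChainReflection n) (chainCoupling (n + 1 + (n + 1)) a b)).det =
      (a + 2 * |b|) / (a - 2 * |b|) := by
    have hpos := hlowpos.det_pos
    have hcard : Fintype.card {i : Fin (n + 1 + (n + 1)) // i ∈ halfChain (n + 1 + (n + 1))} =
        Fintype.card (Fin n) + 1 := by rw [card_halfChain, Fintype.card_fin]
    rw [hlow, det_smul_one_add_mul_transpose hcard (by linarith)] at hpos
    have hsum := transpose_mul_incidence_add (n := n) (-ε) hδ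
    rw [hlow, hhigh, det_smul_one_add_mul_transpose hcard (by linarith),
      det_smul_one_add_mul_transpose hcard (by linarith)]
    -- After Sylvester's identity the remaining `n × n` matrices coincide: the sum rule with `4`
    -- turns `a + 2|b|` into `a - 2|b|`. Only the two scalar factors survive in the ratio.
    have heq : (a + 2 * |b|) • (1 : Matrix (Fin n) (Fin n) ℝ) +
        (-|b|) • ((incidence n (-(-ε)))ᵀ * incidence n (-(-ε))) =
        (a - 2 * |b|) • 1 + |b| • ((incidence n (-ε))ᵀ * incidence n (-ε)) := by
      linear_combination (norm := module) (-|b|) • hsum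
    rw [heq]
    have hne := (pos_of_mul_pos_right hpos (by linarith)).ne'
    exact mul_div_mul_right _ _ hne
  have hsymm : ∀ i j : Fin (n + 1 + (n + 1)), chainCoupling (n + 1 + (n + 1)) a b i.rev j.rev =
      chainCoupling (n + 1 + (n + 1)) a b i j := fun i j => by
    have hi := i.isLt
    have hj := j.isLt
    rw [chainCoupling_apply hN, chainCoupling_apply hN, Fin.val_rev, Fin.val_rev]
    split_ifs <;> first | rfl | omega
  have h := entanglement_of_reflection_symmetric (halfChainReflection n) hε
    (X := chainCoupling (n + 1 + (n + 1)) a b) (fun i j => hsymm i j)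
    (fun i j => by
      have h := hsymm i.1 j.1.rev
      rw [Fin.rev_rev] at h
      exact h) hhighpos hlowpos hcrosspos
  rwa [hdet] at h

end HalfChain

end HarmonicChain

/-! ### The theorem for rings of even length. -/

theorem mainTheorem4 (N : ℕ) (hN : Even N) (hN4 : 4 ≤ N) (a b : ℝ) (hab : 2 * |b| < a) :
    (∃ ψ : HarmonicChain.Space (Fin N),
      HarmonicChain.IsGroundState 1 (HarmonicChain.chainCoupling N a b) ψ) ∧
    ∀ ψ : HarmonicChain.Space (Fin N),
      HarmonicChain.IsGroundState 1 (HarmonicChain.chainCoupling N a b) ψ →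
      ((HarmonicChain.vonNeumannEntropy
          (HarmonicChain.partialTrace (HarmonicChain.halfChain N) (HarmonicChain.pureState ψ)) :
            ENNReal) : EReal) ≤
        HarmonicChain.logNegativity (HarmonicChain.halfChain N) (HarmonicChain.pureState ψ) ∧
      HarmonicChain.logNegativity (HarmonicChain.halfChain N) (HarmonicChain.pureState ψ) =
        ((1 / 4 * Real.logb 2 ((a + 2 * |b|) / (a - 2 * |b|)) : ℝ) : EReal) ∧
      1 / 4 * Real.logb 2 ((a + 2 * |b|) / (a - 2 * |b|)) =
        1 / 2 * Real.logb 2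
          (√(HarmonicChain.opNorm (HarmonicChain.chainCoupling N a b)) /
            √(HarmonicChain.lambdaMin (HarmonicChain.chainCoupling N a b))) := by
  have : NeZero N := ⟨by omega⟩
  have hratio : 1 / 4 * Real.logb 2 ((a + 2 * |b|) / (a - 2 * |b|)) =
      1 / 2 * Real.logb 2 (√(HarmonicChain.opNorm (HarmonicChain.chainCoupling N a b)) /
        √(HarmonicChain.lambdaMin (HarmonicChain.chainCoupling N a b))) := by
    have h1 : 0 ≤ a + 2 * |b| := by linarith [abs_nonneg b]
    have h2 : 0 ≤ (a + 2 * |b|) / (a - 2 * |b|) := div_nonneg h1 (by linarith)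
    rw [HarmonicChain.opNorm_chainCoupling hN (by omega) hab,
      HarmonicChain.lambdaMin_chainCoupling hN (by omega), ← Real.sqrt_div h1, Real.logb, Real.logb,
      Real.log_sqrt h2]
    ring
  obtain ⟨r, rfl⟩ := hN
  -- With `N = 2(n + 1)`, the assumption `4 ≤ N` is what yields `1 ≤ n`.
  obtain ⟨n, rfl⟩ : ∃ n, r = n + 1 := ⟨r - 1, by omega⟩
  obtain ⟨h1, h2⟩ := HarmonicChain.entanglement_halfChain (n := n) (by omega) hab
  exact ⟨h1, fun ψ hψ => ⟨(h2 ψ hψ).1, (h2 ψ hψ).2, hratio⟩⟩
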